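/- **Theorem 1.6 (Ill-posedness in $\widehat L^p$).** For $1\le p\le\infty$ and $\frac1p+\frac1{p'}=1$ let $\widehat L^p(\mathbb R^d)=\{f\in\mathcal S'(\mathbb R^d):\ \mathcal F f\in L^{p'}(\mathbb R^d)\}$ with norm $\|f\|_{\widehat L^p}=\|\mathcal Ff\|_{L^{p'}}$, where $\mathcal Ff(\xi)=\int_{\mathbb R^d} e^{-2\pi i x\cdot\xi}f(x)\,dx$. Intersections and $N$-fold products of normed spaces carry the maximum norm. Let $0<\alpha<\infty$, $\kappa\in\mathbb R\setminus\{0\}$, $2<p\le\infty$ and $0<\gamma<2d\left(\frac12-\frac1p\right)$. Let $(\#)$ be either the Hartree–Fock system ($N\ge2$) $$i\partial_t\psi_k-(-\Delta)^{\alpha/2}\psi_k+\kappa\sum_{l=1}^N\left(|x|^{-\gamma}*|\psi_l|^2\right)\psi_k-\kappa\sum_{l=1}^N\psi_l\left(|x|^{-\gamma}*(\overline{\psi_l}\psi_k)\right)=0,\qquad \psi_k|_{t=0}=\psi_{0,k},\qquad k=1,\dots,N,$$ or the reduced Hartree–Fock system ($N\ge1$), in which the last sum is omitted. Write $X=L^2(\mathbb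 R^d)\cap\widehat L^p(\mathbb R^d)$. A solution on $[0,T]$ is a $\psi\in C([0,T],X^N)$ that satisfies Duhamel's formula for $(\#)$ with the propagator $e^{-it(-\Delta)^{\alpha/2}}=\mathcal F^{-1}e^{-i(2\pi)^\alpha|\xi|^\alpha t}\mathcal F$. 1. $(\#)$ is locally well-posed in $X^N$: two solutions on the same interval $[0,T]$ with the same initial data coincide, and for every bounded $B\subset X^N$ there is a $T>0$ such that every $\psi_0\in B$ has a solution $\psi$ on $[0,T]$ and the map $B\ni\psi_0\mapsto\psi\in C([0,T],X^N)$ is uniformly continuous. 2. $(\#)$ is not locally well-posed in $\widehat L^p$. Let $B$ be any ball (of any centre and any radius $r>0$) in $\widehat L^p(\mathbb R^d)^N$ and let $T>0$. Then: * there is no uniformly continuous map $S:B\to C([0,T],\widehat L^p(\mathbb R^d)^N)$ such that for every $\psi_0\in B\cap X^N$ the function $S(\psi_0)$ is the solution of $(\#)$ on $[0,T]$ with initial data $\psi_0$; * the failure is not caused by a lack of solutions on $[0,T]$: there is an $\varepsilon>0$ such that for every $\delta>0$ there are $\tau\in(0,T]$ and solutions $\psi,\varphi$ on $[0,\tau]$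 with initial data $\psi_0,\varphi_0\in B\cap X^N$ such that $\|\psi_0-\varphi_0\|_{(\widehat L^p)^N}<\delta$ and $\sup_{t\in[0,\tau]}\|\psi(t)-\varphi(t)\|_{(\widehat L^p)^N}\ge\varepsilon$. -/

import Mathlib

open MeasureTheory Set
open scoped ENNReal SchwartzMap FourierTransform ComplexConjugate

namespace HartreeFock

noncomputable section

/-- Euclidean space `ℝ^d`. -/
abbrev Rd (d : ℕ) : Type := EuclideanSpace ℝ (Fin d)

/-- The space `L²(ℝ^d; ℂ)`. -/
abbrev L2 (d : ℕ) : Type := Lp (α := Rd d) ℂ 2 volume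

/-- The conjugate exponent `p'` is at least `1`. -/
instance fact_one_le_conjExponent (p : ℝ≥0∞) : Fact (1 ≤ p.conjExponent) :=
  ⟨by unfold ENNReal.conjExponent; exact le_self_add⟩

/-- The space `L^{p'}(ℝ^d; ℂ)`, where `1/p + 1/p' = 1`. -/
abbrev LpConj (d : ℕ) (p : ℝ≥0∞) : Type := Lp (α := Rd d) ℂ p.conjExponent volume

/-! ### The Fourier-Lebesgue space -/

/-- The tempered distributions `f` whose Fourier transform `𝓕 f` (normalized with the character
`exp (-2 π i x · ξ)`) is given by a function in `L^{p'}`, as a linear subspace of `𝓢'(ℝ^d)`. -/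
def fourierLebesgueSubmodule (d : ℕ) (p : ℝ≥0∞) : Submodule ℂ 𝓢'(Rd d, ℂ) :=
  (Lp.toTemperedDistributionCLM (E := Rd d) ℂ volume p.conjExponent).range.comap
    (FourierTransform.fourierCLM ℂ 𝓢'(Rd d, ℂ)).toLinearMap

theorem mem_fourierLebesgueSubmodule {d : ℕ} {p : ℝ≥0∞} {f : 𝓢'(Rd d, ℂ)} :
    f ∈ fourierLebesgueSubmodule d p ↔
      ∃ g : LpConj d p, Lp.toTemperedDistribution g = 𝓕 f := Iff.rfl

/-- The Fourier-Lebesgue space `L̂^p(ℝ^d)`. It is a type of its own, so that it carries the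
topology of its norm (below) and not the one of `𝓢'(ℝ^d)`. -/
def FL (d : ℕ) (p : ℝ≥0∞) : Type := fourierLebesgueSubmodule d p

instance (d : ℕ) (p : ℝ≥0∞) : AddCommGroup (FL d p) :=
  inferInstanceAs (AddCommGroup (fourierLebesgueSubmodule d p))

instance (d : ℕ) (p : ℝ≥0∞) : Module ℂ (FL d p) :=
  inferInstanceAs (Module ℂ (fourierLebesgueSubmodule d p))

/-- An `L^{p'}` function is determined by the tempered distribution it defines. -/
theorem toTemperedDistribution_injective (d : ℕ) (p : ℝ≥0∞) :
    Function.Injective (fun g : LpConj d p => (Lp.toTemperedDistribution g : 𝓢'(Rd d, ℂ))) :=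
  LinearMap.ker_eq_bot.1
    (Lp.ker_toTemperedDistributionCLM_eq_bot (E := Rd d) (F := ℂ) (μ := volume)
      (p := p.conjExponent))

/-- The Fourier transform of an element of `L̂^p`, as an element of `L^{p'}`. -/
def FL.hat {d : ℕ} {p : ℝ≥0∞} (f : FL d p) : LpConj d p :=
  Classical.choose (mem_fourierLebesgueSubmodule.1 f.2)

theorem FL.hat_spec {d : ℕ} {p : ℝ≥0∞} (f : FL d p) :
    (Lp.toTemperedDistribution f.hat : 𝓢'(Rd d, ℂ)) = 𝓕 f.1 :=
  Classical.choose_spec (mem_fourierLebesgueSubmodule.1 f.2)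

/-- `FL.hat` as a linear map. -/
def FL.hatₗ (d : ℕ) (p : ℝ≥0∞) : FL d p →ₗ[ℂ] LpConj d p where
  toFun := FL.hat
  map_add' f g := by
    apply toTemperedDistribution_injective d p
    have h := (Lp.toTemperedDistributionCLM (E := Rd d) ℂ volume p.conjExponent).map_add f.hat g.hat
    simp only [Lp.toTemperedDistributionCLM_apply] at h
    simp only [h, FL.hat_spec]
    exact FourierTransform.fourier_add f.1 g.1
  map_smul' c f := by
    apply toTemperedDistribution_injective d p
    have h := (Lp.toTemperedDistributionCLM (E := Rd d) ℂ volume p.conjExponent).map_smul c f.hat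
    simp only [Lp.toTemperedDistributionCLM_apply] at h
    simp only [RingHom.id_apply, h, FL.hat_spec]
    exact FourierTransform.fourier_smul c f.1

theorem FL.hatₗ_injective (d : ℕ) (p : ℝ≥0∞) : Function.Injective (FL.hatₗ d p) := by
  intro f g h
  have h' : 𝓕 f.1 = 𝓕 g.1 := by
    rw [← FL.hat_spec f, ← FL.hat_spec g]
    exact congrArg _ h
  apply Subtype.ext
  calc f.1 = 𝓕⁻ (𝓕 f.1 : 𝓢'(Rd d, ℂ)) := (FourierTransform.fourierInv_fourier_eq f.1).symm
    _ = 𝓕⁻ (𝓕 g.1 : 𝓢'(Rd d, ℂ)) := by rw [h']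
    _ = g.1 := FourierTransform.fourierInv_fourier_eq g.1

/-- The norm of `L̂^p` is `‖f‖ = ‖𝓕 f‖_{L^{p'}}`. -/
instance (d : ℕ) (p : ℝ≥0∞) : NormedAddCommGroup (FL d p) :=
  NormedAddCommGroup.induced (FL d p) (LpConj d p) (FL.hatₗ d p) (FL.hatₗ_injective d p)

theorem FL.norm_def {d : ℕ} {p : ℝ≥0∞} (f : FL d p) : ‖f‖ = ‖f.hat‖ := rfl

/-! ### The space `L² ∩ L̂^p` -/

/-- The functions in `L²` that belong to `L̂^p`. -/
def l2InterSubmodule (d : ℕ) (p : ℝ≥0∞) : Submodule ℂ (L2 d) :=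
  (fourierLebesgueSubmodule d p).comap
    (Lp.toTemperedDistributionCLM (E := Rd d) ℂ volume 2).toLinearMap

/-- The space `L²(ℝ^d) ∩ L̂^p(ℝ^d)`. -/
def L2FL (d : ℕ) (p : ℝ≥0∞) : Type := l2InterSubmodule d p

instance (d : ℕ) (p : ℝ≥0∞) : AddCommGroup (L2FL d p) :=
  inferInstanceAs (AddCommGroup (l2InterSubmodule d p))

instance (d : ℕ) (p : ℝ≥0∞) : Module ℂ (L2FL d p) :=
  inferInstanceAs (Module ℂ (l2InterSubmodule d p))

/-- The inclusion of `L² ∩ L̂^p` into `L²`. -/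
def L2FL.toL2 {d : ℕ} {p : ℝ≥0∞} (f : L2FL d p) : L2 d := f.1

/-- The inclusion of `L² ∩ L̂^p` into `L̂^p`. -/
def L2FL.toFL {d : ℕ} {p : ℝ≥0∞} (f : L2FL d p) : FL d p :=
  ⟨Lp.toTemperedDistribution f.1, f.2⟩

/-- The diagonal inclusion of `L² ∩ L̂^p` into `L² × L̂^p`. -/
def L2FL.toProdₗ (d : ℕ) (p : ℝ≥0∞) : L2FL d p →ₗ[ℂ] L2 d × FL d p where
  toFun f := (f.toL2, f.toFL)
  map_add' f g := Prod.ext rfl (Subtype.ext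
    ((Lp.toTemperedDistributionCLM (E := Rd d) ℂ volume 2).map_add f.1 g.1))
  map_smul' c f := Prod.ext rfl (Subtype.ext
    ((Lp.toTemperedDistributionCLM (E := Rd d) ℂ volume 2).map_smul c f.1))

theorem L2FL.toProdₗ_injective (d : ℕ) (p : ℝ≥0∞) : Function.Injective (L2FL.toProdₗ d p) :=
  fun _ _ h => Subtype.ext (congrArg Prod.fst h)

/-- The norm of `L² ∩ L̂^p` is the maximum of the `L²` norm and the `L̂^p` norm. -/
instance (d : ℕ) (p : ℝ≥0∞) : NormedAddCommGroup (L2FL d p) :=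
  NormedAddCommGroup.induced (L2FL d p) (L2 d × FL d p) (L2FL.toProdₗ d p)
    (L2FL.toProdₗ_injective d p)

theorem L2FL.norm_def {d : ℕ} {p : ℝ≥0∞} (f : L2FL d p) : ‖f‖ = max ‖f.toL2‖ ‖f.toFL‖ := rfl

/-! ### The equations -/

/-- The symbol `exp (-i (2π)^α |ξ|^α t)` of `U_α(t) = exp (-i t (-Δ)^{α/2})`. -/
def symbol {d : ℕ} (α t : ℝ) (ξ : Rd d) : ℂ :=
  Complex.exp (-(((2 * Real.pi) ^ α * ‖ξ‖ ^ α * t : ℝ) : ℂ) * Complex.I)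

theorem memLp_symbol_mul {d : ℕ} (α t : ℝ) (g : L2 d) :
    MemLp (fun ξ => symbol α t ξ * g ξ) 2 volume := by
  have hm : Measurable (symbol (d := d) α t) := by
    unfold symbol
    fun_prop
  refine (Lp.memLp g).of_le (hm.aestronglyMeasurable.mul (Lp.aestronglyMeasurable g)) ?_
  filter_upwards with ξ
  have h : ‖symbol α t ξ‖ = 1 := by
    unfold symbol
    rw [← Complex.ofReal_neg, Complex.norm_exp_ofReal_mul_I]
  rw [norm_mul, h, one_mul]

/-- The fractional Schrödinger propagator `U_α(t) = exp (-i t (-Δ)^{α/2})` on `L²`, that is, the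
Fourier multiplier with symbol `exp (-i (2π)^α |ξ|^α t)`. -/
def propagator {d : ℕ} (α t : ℝ) (f : L2 d) : L2 d :=
  𝓕⁻ ((memLp_symbol_mul α t (𝓕 f)).toLp (fun ξ => symbol α t ξ * (𝓕 f : L2 d) ξ))

/-- The trilinear Hartree nonlinearity `(|·|^{-γ} ∗ (f ḡ)) h`. -/
def hartree {d : ℕ} (γ : ℝ) (f g h : Rd d → ℂ) (x : Rd d) : ℂ :=
  (∫ y, ((‖x - y‖ ^ (-γ) : ℝ) : ℂ) * (f y * conj (g y))) * h x

/-- The two systems: the Hartree-Fock equations and the reduced Hartree-Fock equations. -/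
inductive Model
  /-- The Hartree-Fock equations (with exchange term). -/
  | hartreeFock
  /-- The reduced Hartree-Fock equations (without exchange term). -/
  | reduced

/-- The Hartree-Fock equations are considered for at least two particles, the reduced ones
for at least one. -/
def Model.minParticles : Model → ℕ
  | .hartreeFock => 2
  | .reduced => 1

/-- The nonlinearity of the `k`-th equation, for the Coulomb type kernel `|x|^{-γ}`:
`κ ∑_l (|·|^{-γ} ∗ |ψ_l|²) ψ_k`, minus `κ ∑_l ψ_l (|·|^{-γ} ∗ (ψ̄_l ψ_k))` in the Hartree-Fock
case. -/
def nonlinearity {d N : ℕ} (m : Model) (κ γ : ℝ) (ψ : Fin N → Rd d → ℂ) (k : Fin N)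
    (x : Rd d) : ℂ :=
  match m with
  | .hartreeFock =>
      κ * ∑ l, hartree γ (ψ l) (ψ l) (ψ k) x - κ * ∑ l, hartree γ (ψ k) (ψ l) (ψ l) x
  | .reduced => κ * ∑ l, hartree γ (ψ l) (ψ l) (ψ k) x

/-- `ψ ∈ C([0, T], (L² ∩ L̂^p)^N)` is a solution on `[0, T]` of
`i ∂ₜ ψ_k - (-Δ)^{α/2} ψ_k + (nonlinearity)_k = 0`, `ψ_k(0) = ψ_{0,k}`, in the sense of Duhamel's
formula
`ψ_k(t) = U_α(t) ψ_{0,k} + i ∫_0^t U_α(t - s) (nonlinearity)_k(s) ds`,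
an identity (with a Bochner integral) in `L²`. -/
def IsSolution {d N : ℕ} {p : ℝ≥0∞} (m : Model) (κ γ α : ℝ) {T : ℝ} (ψ₀ : Fin N → L2FL d p)
    (ψ : C(Icc (0 : ℝ) T, Fin N → L2FL d p)) : Prop :=
  ∃ F : Fin N → ℝ → L2 d,
    (∀ k, ∀ s : Icc (0 : ℝ) T,
      F k s =ᵐ[volume] nonlinearity m κ γ (fun l => ((ψ s l).toL2 : Rd d → ℂ)) k) ∧
    ∀ k, ∀ t : Icc (0 : ℝ) T,
      IntervalIntegrable (fun s => propagator α (t - s) (F k s)) volume 0 t ∧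
      (ψ t k).toL2 = propagator α t (ψ₀ k).toL2 +
        Complex.I • ∫ s in (0 : ℝ)..t, propagator α (t - s) (F k s)

/-- The inclusion of `(L² ∩ L̂^p)^N` into `(L̂^p)^N`. -/
def toFLN {d N : ℕ} {p : ℝ≥0∞} (ψ : Fin N → L2FL d p) : Fin N → FL d p := fun k => (ψ k).toFL

end

end HartreeFock

open HartreeFock

namespace HartreeFock

/-! Everything happens on the Fourier side. There the free evolution is multiplication by a
unimodular symbol, and every cubic term is the convolution of one factor with `pot γ f g`, which at
ξ is a multiple of |ξ|^{γ-d} times the correlation of f and g at ξ. Let b = d(1 - 2/p), the upper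
bound for γ (`critExp`). Splitting |ξ|^{γ-d} at a radius R gives ‖pot γ f g‖_{L¹} ≤ C (R^γ ‖f‖₂‖g‖₂
+ R^{γ-b} ‖f‖_{p'}‖g‖_{p'}) for every R > 0 (`exists_norm_pot_le`). Convolution with an L¹ function
is bounded on L² ∩ L^{p'}, so R = 1 already makes the nonlinearity a bounded trilinear map. The flow
is isometric, hence Picard iteration and Grönwall's inequality in the interaction picture give
well-posedness (`exists_isSolution`, `IsSolution.unique`).

For ill-posedness, take data g in X near the centre of the ball and add to one component k₀, on the
Fourier side, δ times the indicator of a ball of radius R around the origin, normalized in L^{p'}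
(`bump`). The perturbation has size of order δ in L̂^p whatever R is, but its self-interaction has
an integral of order at least δ² R^{γ-b}, which blows up as R → 0 since γ < b
(`exists_le_norm_integral_pot_bump`). That potential lives on |ξ| ≤ 2R, so convolving with it is
nearly multiplication by its integral: the perturbation drives a component k₁ in the direction i
g_{k₁} at speed of order β², where β = δ R^{(γ-b)/2}. After the time τ = η/β², which tends to 0, the
component has moved by an amount of order η, while the solution with data g has hardly moved. In the
Hartree-Fock case k₁ ≠ k₀ is needed: for k₁ = k₀ the exchange term cancels the self-interaction,
whereas for k₁ ≠ k₀ it contributes only mixed interactions, of order β.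

The obstacle is that the perturbation is huge in L², of order δ R^{-b/2}. The solution is therefore
built as a pair, a regular part and a concentrated part, the latter measured in max(R^{b/2}‖·‖₂,
‖·‖_{p'}), where the bump has a norm independent of R. The equation lifts to pairs
(`merge_splitTri`) with a trilinear bound proportional to β² (`isTrilinearBounded_splitTri`), so
solutions of the lifted equation exist for times of order β⁻², exactly the scale needed. A first
order expansion on that scale (`norm_interaction_sub_drift_le`, `exists_isMildSol_near_drift`) has
errors that are small compared with η, and `exists_inflation` chooses the parameters. -/

noncomputable section

/-! ### Translations and unimodular multipliers on L^r -/

/-- Translation by `η` on `L^r`. -/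
def shift {d : ℕ} (r : ℝ≥0∞) [Fact (1 ≤ r)] (η : Rd d) :
    Lp (α := Rd d) ℂ r volume →ₗᵢ[ℂ] Lp (α := Rd d) ℂ r volume :=
  Lp.compMeasurePreservingₗᵢ ℂ (fun x => x - η) (measurePreserving_sub_right volume η)

theorem shift_ae {d : ℕ} {r : ℝ≥0∞} [Fact (1 ≤ r)] (η : Rd d) (f : Lp (α := Rd d) ℂ r volume) :
    shift r η f =ᵐ[volume] fun x => f (x - η) :=
  Lp.coeFn_compMeasurePreserving f (measurePreserving_sub_right volume η)

theorem continuous_shift {d : ℕ} {r : ℝ≥0∞} [Fact (1 ≤ r)] (hr : r ≠ ∞)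
    (f : Lp (α := Rd d) ℂ r volume) : Continuous fun η : Rd d => shift r η f := by
  have h : Continuous fun η : Rd d => (⟨fun x => x - η, by fun_prop⟩ : C(Rd d, Rd d)) :=
    ContinuousMap.continuous_of_continuous_uncurry _
      (by change Continuous fun z : Rd d × Rd d => z.2 - z.1; fun_prop)
  exact (continuous_const (y := f)).compMeasurePreservingLp h
    (fun η => measurePreserving_sub_right volume η) hr

theorem memLp_unimodular_mul {α : Type*} [MeasurableSpace α] {μ : Measure α} {m : α → ℂ}
    (hm : Measurable m) (h1 : ∀ x, ‖m x‖ = 1) {r : ℝ≥0∞} (f : Lp ℂ r μ) :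
    MemLp (fun x => m x * f x) r μ :=
  (Lp.memLp f).of_le (hm.aestronglyMeasurable.mul (Lp.aestronglyMeasurable f))
    (by filter_upwards with x; rw [norm_mul, h1, one_mul])

/-- Multiplication by a unimodular function on `L^r`. -/
def mulUnit {α : Type*} [MeasurableSpace α] {μ : Measure α} (m : α → ℂ)
    (hm : Measurable m) (h1 : ∀ x, ‖m x‖ = 1) (r : ℝ≥0∞) [Fact (1 ≤ r)] :
    Lp ℂ r μ →ₗᵢ[ℂ] Lp ℂ r μ where
  toFun f := (memLp_unimodular_mul hm h1 f).toLp _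
  map_add' f g := by
    rw [← MemLp.toLp_add]
    refine MemLp.toLp_congr _ _ ?_
    filter_upwards [Lp.coeFn_add f g] with x hx
    simp only [hx, Pi.add_apply, mul_add]
  map_smul' c f := by
    rw [RingHom.id_apply, ← MemLp.toLp_const_smul]
    refine MemLp.toLp_congr _ _ ?_
    filter_upwards [Lp.coeFn_smul c f] with x hx
    simp only [hx, Pi.smul_apply, smul_eq_mul]
    ring
  norm_map' f := by
    change ‖(memLp_unimodular_mul hm h1 f).toLp _‖ = ‖f‖
    rw [Lp.norm_toLp, Lp.norm_def]
    congr 1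
    exact eLpNorm_congr_norm_ae (by filter_upwards with x; rw [norm_mul, h1, one_mul])

theorem mulUnit_ae {α : Type*} [MeasurableSpace α] {μ : Measure α} {m : α → ℂ}
    (hm : Measurable m) (h1 : ∀ x, ‖m x‖ = 1) {r : ℝ≥0∞} [Fact (1 ≤ r)] (f : Lp ℂ r μ) :
    mulUnit m hm h1 r f =ᵐ[μ] fun x => m x * f x :=
  (memLp_unimodular_mul hm h1 f).coeFn_toLp

/-- Dominated convergence: two unimodular functions differ by at most 2, so 2|f| dominates. First
countability of the parameter space is what dominated convergence along its neighbourhood filters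
requires. -/
theorem continuous_mulUnit {α T : Type*} [MeasurableSpace α] {μ : Measure α} [TopologicalSpace T]
    [FirstCountableTopology T] {m : T → α → ℂ} (hm : ∀ t, Measurable (m t))
    (h1 : ∀ t x, ‖m t x‖ = 1) (hc : ∀ x, Continuous fun t => m t x)
    {r : ℝ≥0∞} [Fact (1 ≤ r)] (hr : r ≠ ∞) (f : Lp ℂ r μ) :
    Continuous fun t => mulUnit (m t) (hm t) (h1 t) r f := by
  have hr0 : r ≠ 0 := (zero_lt_one.trans_le (Fact.out : 1 ≤ r)).ne'
  have hrp : 0 < r.toReal := ENNReal.toReal_pos hr0 hr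
  rw [continuous_iff_continuousAt]
  intro t₀
  rw [ContinuousAt, Lp.tendsto_Lp_iff_tendsto_eLpNorm']
  have key : Filter.Tendsto (fun t => ∫⁻ x, ‖(m t x - m t₀ x) * f x‖ₑ ^ r.toReal ∂μ) (nhds t₀)
      (nhds (∫⁻ _, 0 ∂μ)) := by
    refine tendsto_lintegral_filter_of_dominated_convergence
      (fun x => (2 * ‖f x‖ₑ) ^ r.toReal) ?_ ?_ ?_ ?_
    · filter_upwards with t
      have := (Lp.stronglyMeasurable f).measurable
      have h2 := hm t
      have h3 := hm t₀
      fun_prop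
    · filter_upwards with t
      filter_upwards with x
      refine ENNReal.rpow_le_rpow ?_ hrp.le
      rw [enorm_mul]
      gcongr
      refine enorm_sub_le.trans ?_
      rw [← ofReal_norm, ← ofReal_norm, h1, h1, ENNReal.ofReal_one]
      norm_num
    · simp_rw [ENNReal.mul_rpow_of_nonneg _ _ hrp.le]
      rw [lintegral_const_mul' _ _ (by simp)]
      refine ENNReal.mul_ne_top (by simp) ?_
      have := (eLpNorm_lt_top_iff_lintegral_rpow_enorm_lt_top hr0 hr).1 (Lp.eLpNorm_lt_top f)
      exact this.ne
    · filter_upwards with x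
      have hx : Filter.Tendsto (fun t => ‖(m t x - m t₀ x) * f x‖ₑ ^ r.toReal) (nhds t₀)
          (nhds (‖(m t₀ x - m t₀ x) * f x‖ₑ ^ r.toReal)) := by
        refine (ENNReal.continuous_rpow_const.tendsto _).comp ?_
        exact ((((hc x).sub continuous_const).mul continuous_const).enorm).tendsto t₀
      simpa [hrp] using hx
  rw [lintegral_zero] at key
  have key2 := (ENNReal.continuous_rpow_const (y := 1 / r.toReal)).tendsto 0 |>.comp key
  rw [ENNReal.zero_rpow_of_pos (by positivity)] at key2
  refine key2.congr fun t => ?_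
  rw [eLpNorm_eq_lintegral_rpow_enorm_toReal hr0 hr]
  simp only [Function.comp]
  congr 1
  refine lintegral_congr_ae ?_
  filter_upwards [mulUnit_ae (hm t) (h1 t) f, mulUnit_ae (hm t₀) (h1 t₀) f] with x hx hx₀
  simp only [Pi.sub_apply, hx, hx₀, sub_mul]

/-- Used to know that p' is finite, including for p = ∞, so that translations and the free evolution
are strongly continuous on L^{p'}. -/
theorem conjExponent_lt_two {p : ℝ≥0∞} (hp : 2 < p) : p.conjExponent < 2 := by
  unfold ENNReal.conjExponent
  have h : (p - 1)⁻¹ < 1 := by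
    rw [ENNReal.inv_lt_one]
    exact lt_tsub_iff_right.2 (by rwa [one_add_one_eq_two])
  calc 1 + (p - 1)⁻¹ < 1 + 1 := ENNReal.add_lt_add_left (by simp) h
    _ = 2 := one_add_one_eq_two

/-! ### Weighted intersections of L² and L^{p'} -/

/-- The space `L¹(ℝ^d; ℂ)`. -/
abbrev L1 (d : ℕ) : Type := Lp (α := Rd d) ℂ 1 volume

/-- The pairs `(a, b) ∈ L² × L^{p'}` such that `a = s b` almost everywhere. For `s > 0` this is
`L² ∩ L^{p'}` with the norm `max (s ‖b‖_{L²}) ‖b‖_{L^{p'}}`. -/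
def weightedInter (d : ℕ) (p : ℝ≥0∞) (s : ℝ) : Submodule ℂ (L2 d × LpConj d p) where
  carrier := {z | z.1 =ᵐ[volume] fun ξ => (s : ℂ) * z.2 ξ}
  add_mem' {z w} hz hw := by
    simp only [mem_ofPred_eq, Prod.fst_add, Prod.snd_add] at *
    filter_upwards [hz, hw, Lp.coeFn_add z.1 w.1, Lp.coeFn_add z.2 w.2] with x h1 h2 h3 h4
    simp only [h3, h4, Pi.add_apply, h1, h2, mul_add]
  zero_mem' := by
    simp only [mem_ofPred_eq, Prod.fst_zero, Prod.snd_zero]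
    filter_upwards [Lp.coeFn_zero ℂ 2 (volume : Measure (Rd d)),
      Lp.coeFn_zero ℂ p.conjExponent (volume : Measure (Rd d))] with x h3 h4
    rw [h3, h4]
    exact (mul_zero _).symm
  smul_mem' c z hz := by
    simp only [mem_ofPred_eq, Prod.smul_fst, Prod.smul_snd] at *
    filter_upwards [hz, Lp.coeFn_smul c z.1, Lp.coeFn_smul c z.2] with x h1 h3 h4
    simp only [h3, h4, Pi.smul_apply, h1, smul_eq_mul]
    ring

theorem mem_weightedInter {d : ℕ} {p : ℝ≥0∞} {s : ℝ} {z : L2 d × LpConj d p} :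
    z ∈ weightedInter d p s ↔ z.1 =ᵐ[volume] fun ξ => (s : ℂ) * z.2 ξ := Iff.rfl

/-- Norm convergence in either space implies convergence in measure, whose limits are unique almost
everywhere, so the relation between the two coordinates survives. This makes `Y` complete. -/
theorem isClosed_weightedInter (d : ℕ) (p : ℝ≥0∞) (s : ℝ) :
    IsClosed (weightedInter d p s : Set (L2 d × LpConj d p)) := by
  refine IsSeqClosed.isClosed fun z a hz ha => ?_
  have h1 : Filter.Tendsto (fun n => (z n).1) Filter.atTop (nhds a.1) :=
    (continuous_fst.tendsto a).comp ha
  have h2 : Filter.Tendsto (fun n => (s : ℂ) • (z n).2) Filter.atTop (nhds ((s : ℂ) • a.2)) :=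
    ((continuous_snd.const_smul (s : ℂ)).tendsto a).comp ha
  have m1 := tendstoInMeasure_of_tendsto_Lp h1
  have m2 := tendstoInMeasure_of_tendsto_Lp h2
  have m3 := m2.congr_left (f' := fun n => (z n).1) fun n => by
    filter_upwards [mem_weightedInter.1 (hz n), Lp.coeFn_smul (s : ℂ) (z n).2] with x h3 h4
    rw [h3, h4, Pi.smul_apply, smul_eq_mul]
  refine mem_weightedInter.2 ?_
  filter_upwards [tendstoInMeasure_ae_unique m1 m3, Lp.coeFn_smul (s : ℂ) a.2] with x h3 h4
  rw [h3, h4, Pi.smul_apply, smul_eq_mul]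

/-- The space `L² ∩ L^{p'}` with the norm `max (s ‖·‖_{L²}) ‖·‖_{L^{p'}}`. -/
def Y (d : ℕ) (p : ℝ≥0∞) (s : ℝ) : Type := weightedInter d p s

instance (d : ℕ) (p : ℝ≥0∞) (s : ℝ) : NormedAddCommGroup (Y d p s) :=
  inferInstanceAs (NormedAddCommGroup (weightedInter d p s))

instance (d : ℕ) (p : ℝ≥0∞) (s : ℝ) : NormedSpace ℂ (Y d p s) :=
  inferInstanceAs (NormedSpace ℂ (weightedInter d p s))

instance (d : ℕ) (p : ℝ≥0∞) (s : ℝ) : CompleteSpace (Y d p s) :=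
  (isClosed_weightedInter d p s).completeSpace_coe

namespace Y

variable {d : ℕ} {p : ℝ≥0∞} {s : ℝ}

theorem ae_eq (y : Y d p s) : y.1.1 =ᵐ[volume] fun ξ => (s : ℂ) * y.1.2 ξ := y.2

theorem norm_def (y : Y d p s) : ‖y‖ = max ‖y.1.1‖ ‖y.1.2‖ := rfl

theorem norm_fst_le (y : Y d p s) : ‖y.1.1‖ ≤ ‖y‖ := le_max_left _ _

theorem norm_snd_le (y : Y d p s) : ‖y.1.2‖ ≤ ‖y‖ := le_max_right _ _

/-- A pair of compatible isometries of `L²` and `L^{p'}` acts on `Y`. -/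
def map (A : L2 d →ₗᵢ[ℂ] L2 d) (B : LpConj d p →ₗᵢ[ℂ] LpConj d p)
    (h : ∀ z ∈ weightedInter d p s, (A z.1, B z.2) ∈ weightedInter d p s) :
    Y d p s →ₗᵢ[ℂ] Y d p s where
  toFun y := ⟨(A y.1.1, B y.1.2), h y.1 y.2⟩
  map_add' y z := Subtype.ext (Prod.ext (A.map_add _ _) (B.map_add _ _))
  map_smul' c y := Subtype.ext (Prod.ext (A.map_smul c _) (B.map_smul c _))
  norm_map' y := by
    change max ‖A y.1.1‖ ‖B y.1.2‖ = max ‖y.1.1‖ ‖y.1.2‖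
    rw [A.norm_map, B.norm_map]

theorem shift_mem (η : Rd d) (z : L2 d × LpConj d p) (hz : z ∈ weightedInter d p s) :
    (HartreeFock.shift 2 η z.1, HartreeFock.shift p.conjExponent η z.2) ∈ weightedInter d p s := by
  rw [mem_weightedInter] at *
  filter_upwards [shift_ae η z.1, shift_ae η z.2,
    (measurePreserving_sub_right volume η).quasiMeasurePreserving.ae hz] with x h1 h2 h3
  rw [h1, h2, h3]

/-- Translation by `η` on `Y`. -/
def shift (η : Rd d) : Y d p s →ₗᵢ[ℂ] Y d p s := map _ _ (shift_mem η)

theorem continuous_shift (hp : 2 < p) (y : Y d p s) : Continuous fun η : Rd d => shift η y :=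
  ((HartreeFock.continuous_shift (by simp) y.1.1).prodMk
    (HartreeFock.continuous_shift ((conjExponent_lt_two hp).trans_le le_top).ne y.1.2)).subtype_mk _

end Y

/-! ### The free evolution on the Fourier side -/

theorem measurable_symbol {d : ℕ} (α t : ℝ) : Measurable (symbol (d := d) α t) := by
  unfold symbol
  fun_prop

theorem norm_symbol {d : ℕ} (α t : ℝ) (ξ : Rd d) : ‖symbol α t ξ‖ = 1 := by
  unfold symbol
  rw [← Complex.ofReal_neg, Complex.norm_exp_ofReal_mul_I]

theorem symbol_add {d : ℕ} (α t t' : ℝ) (ξ : Rd d) :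
    symbol α (t + t') ξ = symbol α t ξ * symbol α t' ξ := by
  unfold symbol
  rw [← Complex.exp_add]
  congr 1
  push_cast
  ring

theorem symbol_zero {d : ℕ} (α : ℝ) (ξ : Rd d) : symbol α 0 ξ = 1 := by
  simp [symbol]

theorem continuous_symbol {d : ℕ} (α : ℝ) (ξ : Rd d) : Continuous fun t => symbol α t ξ := by
  unfold symbol
  fun_prop

/-- Multiplication by the symbol on `L^r`. -/
abbrev symbolMul {d : ℕ} (α t : ℝ) (r : ℝ≥0∞) [Fact (1 ≤ r)] :
    Lp (α := Rd d) ℂ r volume →ₗᵢ[ℂ] Lp (α := Rd d) ℂ r volume :=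
  mulUnit (symbol α t) (measurable_symbol α t) (norm_symbol α t) r

theorem symbolMul_add {d : ℕ} (α t t' : ℝ) {r : ℝ≥0∞} [Fact (1 ≤ r)]
    (f : Lp (α := Rd d) ℂ r volume) :
    symbolMul α (t + t') r f = symbolMul α t r (symbolMul α t' r f) := by
  refine Lp.ext ?_
  filter_upwards [mulUnit_ae (measurable_symbol α (t + t')) (norm_symbol α (t + t')) f,
    mulUnit_ae (measurable_symbol α t') (norm_symbol α t') f,
    mulUnit_ae (measurable_symbol α t) (norm_symbol α t) (symbolMul α t' r f)] with x h1 h2 h3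
  rw [h1, h3, h2, symbol_add, mul_assoc]

theorem symbolMul_zero {d : ℕ} (α : ℝ) {r : ℝ≥0∞} [Fact (1 ≤ r)]
    (f : Lp (α := Rd d) ℂ r volume) : symbolMul α 0 r f = f := by
  refine Lp.ext ?_
  filter_upwards [mulUnit_ae (measurable_symbol α 0) (norm_symbol α 0) f] with x h1
  rw [h1, symbol_zero, one_mul]

namespace Y

variable {d : ℕ} {p : ℝ≥0∞} {s : ℝ}

theorem symbolMul_mem (α t : ℝ) (z : L2 d × LpConj d p) (hz : z ∈ weightedInter d p s) :
    (symbolMul α t 2 z.1, symbolMul α t p.conjExponent z.2) ∈ weightedInter d p s := by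
  rw [mem_weightedInter] at *
  filter_upwards [mulUnit_ae (measurable_symbol α t) (norm_symbol α t) z.1,
    mulUnit_ae (measurable_symbol α t) (norm_symbol α t) z.2, hz] with x h1 h2 h3
  rw [h1, h2, h3]
  ring

/-- The free evolution on the Fourier side. -/
def evol (α t : ℝ) : Y d p s →ₗᵢ[ℂ] Y d p s := map _ _ (symbolMul_mem α t)

theorem evol_add (α t t' : ℝ) (y : Y d p s) : evol α (t + t') y = evol α t (evol α t' y) :=
  Subtype.ext (Prod.ext (symbolMul_add α t t' _) (symbolMul_add α t t' _))

theorem evol_zero (α : ℝ) (y : Y d p s) : evol α 0 y = y :=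
  Subtype.ext (Prod.ext (symbolMul_zero α _) (symbolMul_zero α _))

theorem continuous_evol (hp : 2 < p) (α : ℝ) (y : Y d p s) : Continuous fun t => evol α t y :=
  ((continuous_mulUnit (measurable_symbol α) (norm_symbol α) (continuous_symbol α) (by simp)
      y.1.1).prodMk
    (continuous_mulUnit (measurable_symbol α) (norm_symbol α) (continuous_symbol α)
      ((conjExponent_lt_two hp).trans_le le_top).ne y.1.2)).subtype_mk _

/-! ### Convolution with an integrable function -/

instance : SecondCountableTopologyEither (Rd d) (Y d p s) :=
  secondCountableTopologyEither_of_left _ _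

theorem integrable_smul_shift (hp : 2 < p) (K : L1 d) (h : Y d p s) :
    Integrable (fun η => K η • shift η h) volume :=
  Integrable.smul_of_top_left (L1.integrable_coeFn K) (memLp_top_of_bound
    (continuous_shift hp h).aestronglyMeasurable ‖h‖
    (by filter_upwards with η; rw [LinearIsometry.norm_map]))

/-- The convolution `K ∗ h = ∫ K(η) h(· - η) dη`. -/
def conv (K : L1 d) (h : Y d p s) : Y d p s := ∫ η, K η • shift η h

theorem conv_add_left (hp : 2 < p) (K L : L1 d) (h : Y d p s) :
    conv (K + L) h = conv K h + conv L h := by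
  unfold conv
  rw [← integral_add (integrable_smul_shift hp K h) (integrable_smul_shift hp L h)]
  refine integral_congr_ae ?_
  filter_upwards [Lp.coeFn_add K L] with η hη
  simp only [hη, Pi.add_apply, add_smul]

theorem conv_smul_left (c : ℂ) (K : L1 d) (h : Y d p s) : conv (c • K) h = c • conv K h := by
  unfold conv
  rw [← integral_smul]
  refine integral_congr_ae ?_
  filter_upwards [Lp.coeFn_smul c K] with η hη
  simp only [hη, Pi.smul_apply, smul_smul, smul_eq_mul]

theorem conv_add_right (hp : 2 < p) (K : L1 d) (h g : Y d p s) :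
    conv K (h + g) = conv K h + conv K g := by
  unfold conv
  rw [← integral_add (integrable_smul_shift hp K h) (integrable_smul_shift hp K g)]
  simp only [map_add, smul_add]

theorem conv_smul_right (c : ℂ) (K : L1 d) (h : Y d p s) : conv K (c • h) = c • conv K h := by
  unfold conv
  rw [← integral_smul]
  simp only [map_smul, smul_comm c]

theorem conv_sub_left (hp : 2 < p) (K L : L1 d) (h : Y d p s) :
    conv (K - L) h = conv K h - conv L h := by
  rw [eq_sub_iff_add_eq, ← conv_add_left hp, sub_add_cancel]

theorem conv_sub_right (hp : 2 < p) (K : L1 d) (h g : Y d p s) :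
    conv K (h - g) = conv K h - conv K g := by
  rw [eq_sub_iff_add_eq, ← conv_add_right hp, sub_add_cancel]

/-- Young's inequality for the L² and the L^{p'} norm at once: translations are isometries of `Y`
and the convolution is a Bochner integral of them. -/
theorem norm_conv_le (K : L1 d) (h : Y d p s) : ‖conv K h‖ ≤ ‖K‖ * ‖h‖ := by
  unfold conv
  refine (norm_integral_le_integral_norm _).trans (le_of_eq ?_)
  simp only [norm_smul, LinearIsometry.norm_map]
  rw [integral_mul_const, L1.norm_eq_integral_norm]

end Y

/-! ### The space `L² ∩ L̂^p` on the Fourier side -/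

/-- Smooth compactly supported test functions are Schwartz functions and separate locally integrable
functions. Two exponents are allowed so that the L² Fourier transform can be compared with the
representative in L^{p'}. -/
theorem ae_eq_of_toTemperedDistribution_eq {d : ℕ} {r r' : ℝ≥0∞} [hr : Fact (1 ≤ r)]
    [hr' : Fact (1 ≤ r')]
    {f : Lp (α := Rd d) ℂ r volume} {g : Lp (α := Rd d) ℂ r' volume}
    (h : (Lp.toTemperedDistribution f : 𝓢'(Rd d, ℂ)) = Lp.toTemperedDistribution g) :
    f =ᵐ[volume] g := by
  refine ae_eq_of_integral_contDiff_smul_eq ((Lp.memLp f).locallyIntegrable hr.elim)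
    ((Lp.memLp g).locallyIntegrable hr'.elim) fun φ hφ hc => ?_
  have h1 : HasCompactSupport (Complex.ofRealCLM ∘ φ) := hc.comp_left rfl
  have h2 : ContDiff ℝ (⊤ : ℕ∞) (Complex.ofRealCLM ∘ φ) := Complex.ofRealCLM.contDiff.comp hφ
  have h3 := congrArg (fun T : 𝓢'(Rd d, ℂ) => T (h1.toSchwartzMap h2)) h
  simpa using h3

theorem toTemperedDistribution_eq_of_ae_eq {d : ℕ} {r r' : ℝ≥0∞} [Fact (1 ≤ r)] [Fact (1 ≤ r')]
    {f : Lp (α := Rd d) ℂ r volume} {g : Lp (α := Rd d) ℂ r' volume} (h : f =ᵐ[volume] g) :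
    (Lp.toTemperedDistribution f : 𝓢'(Rd d, ℂ)) = Lp.toTemperedDistribution g := by
  ext φ
  rw [Lp.toTemperedDistribution_apply, Lp.toTemperedDistribution_apply]
  refine integral_congr_ae ?_
  filter_upwards [h] with x hx
  rw [hx]

namespace L2FL

variable {d : ℕ} {p : ℝ≥0∞}

theorem fourier_ae_eq_hat (f : L2FL d p) :
    (𝓕 f.toL2 : L2 d) =ᵐ[volume] f.toFL.hat := by
  refine ae_eq_of_toTemperedDistribution_eq ?_
  exact (Lp.fourier_toTemperedDistribution_eq f.toL2).symm.trans (FL.hat_spec f.toFL).symm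

theorem mem_of_fourier_ae_eq {f : L2 d} {g : LpConj d p} (h : (𝓕 f : L2 d) =ᵐ[volume] g) :
    f ∈ l2InterSubmodule d p := by
  have h' : (Lp.toTemperedDistribution f : 𝓢'(Rd d, ℂ)) ∈ fourierLebesgueSubmodule d p := by
    refine mem_fourierLebesgueSubmodule.2 ⟨g, ?_⟩
    rw [← toTemperedDistribution_eq_of_ae_eq h, ← Lp.fourier_toTemperedDistribution_eq]
  unfold l2InterSubmodule
  rw [Submodule.mem_comap]
  exact h'

/-- The Fourier transform as a map from `L² ∩ L̂^p` to `L² ∩ L^{p'}`. -/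
def ft : L2FL d p →ₗ[ℂ] Y d p 1 where
  toFun f := ⟨(𝓕 f.toL2, f.toFL.hat), by
    simpa [mem_weightedInter] using fourier_ae_eq_hat f⟩
  map_add' f g := Subtype.ext (Prod.ext (FourierTransform.fourier_add f.toL2 g.toL2)
    ((congrArg FL.hat (congrArg Prod.snd ((L2FL.toProdₗ d p).map_add f g))).trans
      ((FL.hatₗ d p).map_add f.toFL g.toFL)))
  map_smul' c f := Subtype.ext (Prod.ext (FourierTransform.fourier_smul c f.toL2)
    ((congrArg FL.hat (congrArg Prod.snd ((L2FL.toProdₗ d p).map_smul c f))).trans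
      ((FL.hatₗ d p).map_smul c f.toFL)))

theorem ft_fst (f : L2FL d p) : (ft f).1.1 = 𝓕 f.toL2 := rfl

theorem ft_snd (f : L2FL d p) : (ft f).1.2 = f.toFL.hat := rfl

theorem norm_ft (f : L2FL d p) : ‖ft f‖ = ‖f‖ := by
  rw [Y.norm_def, norm_def, ft_fst, ft_snd, Lp.norm_fourier_eq, FL.norm_def]

/-- The inverse of `ft`. -/
def ofFt (y : Y d p 1) : L2FL d p :=
  ⟨𝓕⁻ y.1.1, mem_of_fourier_ae_eq (g := y.1.2) (by
    rw [FourierTransform.fourier_fourierInv_eq]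
    simpa using y.ae_eq)⟩

theorem toL2_ofFt (y : Y d p 1) : (ofFt y).toL2 = 𝓕⁻ y.1.1 := rfl

theorem ext_fst {s : ℝ} (hs : s ≠ 0) {y z : Y d p s} (h : y.1.1 = z.1.1) : y = z := by
  refine Subtype.ext (Prod.ext h (Lp.ext ?_))
  filter_upwards [y.ae_eq, z.ae_eq] with x h1 h2
  rw [h, h2] at h1
  exact (mul_left_cancel₀ (Complex.ofReal_ne_zero.2 hs) h1).symm

theorem ft_ofFt (y : Y d p 1) : ft (ofFt y) = y :=
  ext_fst one_ne_zero (by rw [ft_fst, toL2_ofFt, FourierTransform.fourier_fourierInv_eq])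

theorem ft_injective : Function.Injective (ft : L2FL d p → Y d p 1) := fun f g h => by
  have h' := congrArg (fun y : Y d p 1 => (𝓕⁻ y.1.1 : L2 d)) h
  simp only [ft_fst, FourierTransform.fourierInv_fourier_eq] at h'
  exact Subtype.ext h'

theorem ofFt_ft (f : L2FL d p) : ofFt (ft f) = f := ft_injective (ft_ofFt _)

theorem dist_ft (f g : L2FL d p) : dist (ft f) (ft g) = dist f g := by
  rw [dist_eq_norm, dist_eq_norm, ← map_sub, norm_ft]

theorem isometry_ft : Isometry (ft : L2FL d p → Y d p 1) := Isometry.of_dist_eq dist_ft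

theorem isometry_ofFt : Isometry (ofFt : Y d p 1 → L2FL d p) :=
  Isometry.of_dist_eq fun y z => by rw [← dist_ft, ft_ofFt, ft_ofFt]

end L2FL

/-! ### Radial integrals -/

theorem lintegral_ofReal_radial {d : ℕ} (hd : 0 < d) {φ : ℝ → ℝ} (h0 : ∀ y, 0 ≤ φ y)
    (hi : IntegrableOn (fun y : ℝ => y ^ (d - 1) * φ y) (Ioi 0)) :
    ∫⁻ ξ : Rd d, ENNReal.ofReal (φ ‖ξ‖) =
      ENNReal.ofReal (d * ((volume : Measure (Rd d)).real (Metric.ball 0 1) *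
        ∫ y in Ioi (0 : ℝ), y ^ (d - 1) * φ y)) := by
  have : Nonempty (Fin d) := ⟨⟨0, hd⟩⟩
  have hdim : Module.finrank ℝ (Rd d) = d := finrank_euclideanSpace_fin
  have h1 := (integrable_fun_norm_addHaar (volume : Measure (Rd d)) (f := φ)).2 (by
    simpa only [hdim, smul_eq_mul] using hi)
  have h2 := integral_fun_norm_addHaar (volume : Measure (Rd d)) φ
  rw [hdim] at h2
  rw [← ofReal_integral_eq_lintegral_ofReal h1 (by filter_upwards with x; exact h0 _), h2]
  simp

theorem pow_mul_indicator_rpow {d : ℕ} (hd : 0 < d) (S : Set ℝ) (a : ℝ) {y : ℝ} (hy : 0 < y) :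
    y ^ (d - 1) * S.indicator (fun y => y ^ (a - d)) y = S.indicator (fun y => y ^ (a - 1)) y := by
  by_cases h : y ∈ S
  · rw [indicator_of_mem h, indicator_of_mem h, ← Real.rpow_natCast, ← Real.rpow_add hy,
      Nat.cast_sub hd]
    congr 1
    push_cast
    ring
  · simp [indicator_of_notMem h]

theorem lintegral_ball_rpow {d : ℕ} (hd : 0 < d) {γ R : ℝ} (hγ : 0 < γ) (hR : 0 < R) :
    ∫⁻ ξ : Rd d, ENNReal.ofReal ((Ioc 0 R).indicator (fun y => y ^ (γ - d)) ‖ξ‖) =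
      ENNReal.ofReal (d * ((volume : Measure (Rd d)).real (Metric.ball 0 1) * (R ^ γ / γ))) := by
  have hc : EqOn (fun y : ℝ => y ^ (d - 1) * (Ioc 0 R).indicator (fun y => y ^ (γ - d)) y)
      ((Ioc 0 R).indicator (fun y => y ^ (γ - 1))) (Ioi 0) :=
    fun y hy => pow_mul_indicator_rpow hd _ _ hy
  have hi : IntegrableOn (fun y : ℝ => y ^ (γ - 1)) (Ioc 0 R) :=
    (intervalIntegrable_iff_integrableOn_Ioc_of_le hR.le).1
      (intervalIntegral.intervalIntegrable_rpow' (by linarith))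
  rw [lintegral_ofReal_radial hd, setIntegral_congr_fun measurableSet_Ioi hc,
    setIntegral_indicator measurableSet_Ioc, inter_eq_self_of_subset_right Ioc_subset_Ioi_self,
    ← intervalIntegral.integral_of_le hR.le, integral_rpow (Or.inl (by linarith))]
  · simp [Real.zero_rpow hγ.ne']
  · exact fun y => indicator_nonneg (fun y hy => Real.rpow_nonneg hy.1.le _) _
  · rw [integrableOn_congr_fun hc measurableSet_Ioi]
    exact ((integrable_indicator_iff measurableSet_Ioc).2 hi).integrableOn

theorem lintegral_compl_ball_rpow {d : ℕ} (hd : 0 < d) {ε R : ℝ} (hε : 0 < ε) (hR : 0 < R) :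
    ∫⁻ ξ : Rd d, ENNReal.ofReal ((Ioi R).indicator (fun y => y ^ (-ε - d)) ‖ξ‖) =
      ENNReal.ofReal (d * ((volume : Measure (Rd d)).real (Metric.ball 0 1) * (R ^ (-ε) / ε))) := by
  have hc : EqOn (fun y : ℝ => y ^ (d - 1) * (Ioi R).indicator (fun y => y ^ (-ε - d)) y)
      ((Ioi R).indicator (fun y => y ^ (-ε - 1))) (Ioi 0) :=
    fun y hy => pow_mul_indicator_rpow hd _ _ hy
  have hi : IntegrableOn (fun y : ℝ => y ^ (-ε - 1)) (Ioi R) :=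
    integrableOn_Ioi_rpow_of_lt (by linarith) hR
  rw [lintegral_ofReal_radial hd, setIntegral_congr_fun measurableSet_Ioi hc,
    setIntegral_indicator measurableSet_Ioi,
    inter_eq_self_of_subset_right (Ioi_subset_Ioi hR.le),
    integral_Ioi_rpow_of_lt (by linarith) hR, sub_add_cancel, neg_div_neg_eq]
  · exact fun y => indicator_nonneg (fun y hy => Real.rpow_nonneg (hR.trans hy).le _) _
  · rw [integrableOn_congr_fun hc measurableSet_Ioi]
    exact ((integrable_indicator_iff measurableSet_Ioi).2 hi).integrableOn

/-! ### A trilinear convolution inequality -/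

/-- Young's trilinear inequality. The integrand equals (AB)^{1-2ι} (JA)^ι (JB)^ι; Hölder's
inequality on the product space reduces it to three double integrals, each of which factorizes by
invariance of the measure. -/
theorem lintegral_mul_conv_le {G : Type*} [AddCommGroup G] [MeasurableSpace G] [MeasurableAdd₂ G]
    [MeasurableNeg G] {μ : Measure G} [SFinite μ] [μ.IsAddLeftInvariant] [μ.IsNegInvariant]
    {J A B : G → ℝ≥0∞} (hJ : Measurable J) (hA : Measurable A) (hB : Measurable B) {ι : ℝ}
    (h0 : 0 ≤ ι) (h1 : ι ≤ 1 / 2) :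
    ∫⁻ ξ, J ξ ^ (2 * ι) * ∫⁻ η, A η ^ (1 - ι) * B (η - ξ) ^ (1 - ι) ∂μ ∂μ ≤
      (∫⁻ ξ, J ξ ∂μ) ^ (2 * ι) * ((∫⁻ ξ, A ξ ∂μ) ^ (1 - ι) * (∫⁻ ξ, B ξ ∂μ) ^ (1 - ι)) := by
  have hB' : Measurable fun z : G × G => B (z.2 - z.1) := by fun_prop
  have key := ENNReal.lintegral_prod_norm_pow_le (μ := μ.prod μ) (Finset.univ : Finset (Fin 3))
    (f := ![fun z => A z.2 * B (z.2 - z.1), fun z => J z.1 * A z.2,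
      fun z => J z.1 * B (z.2 - z.1)])
    (by
      intro i _
      fin_cases i
      · exact ((hA.comp measurable_snd).mul hB').aemeasurable
      · exact ((hJ.comp measurable_fst).mul (hA.comp measurable_snd)).aemeasurable
      · exact ((hJ.comp measurable_fst).mul hB').aemeasurable)
    (p := ![1 - 2 * ι, ι, ι])
    (by simp only [Fin.sum_univ_three, Matrix.cons_val]; ring)
    (by
      intro i _
      fin_cases i
      · simpa using by linarith
      · exact h0
      · exact h0)
  simp only [Fin.prod_univ_three, Matrix.cons_val] at key
  have e1 : ∫⁻ z : G × G, A z.2 * B (z.2 - z.1) ∂μ.prod μ = (∫⁻ ξ, A ξ ∂μ) * ∫⁻ ξ, B ξ ∂μ := by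
    rw [lintegral_prod_symm' _ (by fun_prop),
      ← lintegral_mul_const _ hA]
    refine lintegral_congr fun η => ?_
    dsimp only
    rw [lintegral_const_mul _ (by fun_prop), lintegral_sub_left_eq_self]
  have e2 : ∫⁻ z : G × G, J z.1 * A z.2 ∂μ.prod μ = (∫⁻ ξ, J ξ ∂μ) * ∫⁻ ξ, A ξ ∂μ :=
    lintegral_prod_mul hJ.aemeasurable hA.aemeasurable
  have e3 : ∫⁻ z : G × G, J z.1 * B (z.2 - z.1) ∂μ.prod μ = (∫⁻ ξ, J ξ ∂μ) * ∫⁻ ξ, B ξ ∂μ := by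
    rw [lintegral_prod _ (by fun_prop),
      ← lintegral_mul_const _ hJ]
    refine lintegral_congr fun ξ => ?_
    dsimp only
    rw [lintegral_const_mul _ (by fun_prop), lintegral_sub_right_eq_self]
  rw [e1, e2, e3] at key
  have h3 : 0 ≤ 1 - 2 * ι := by linarith
  have comb : ∀ x y w : ℝ≥0∞, (x * y) ^ (1 - 2 * ι) * (w * x) ^ ι * (w * y) ^ ι =
      w ^ (2 * ι) * (x ^ (1 - ι) * y ^ (1 - ι)) := by
    intro x y w
    have a1 : ∀ v : ℝ≥0∞, v ^ (1 - ι) = v ^ (1 - 2 * ι) * v ^ ι := fun v => by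
      rw [← ENNReal.rpow_add_of_nonneg _ _ h3 h0]; congr 1; ring
    have a2 : w ^ (2 * ι) = w ^ ι * w ^ ι := by
      rw [← ENNReal.rpow_add_of_nonneg _ _ h0 h0]; congr 1; ring
    rw [a1, a1, a2, ENNReal.mul_rpow_of_nonneg _ _ h3, ENNReal.mul_rpow_of_nonneg _ _ h0,
      ENNReal.mul_rpow_of_nonneg _ _ h0]
    ring
  rw [comb] at key
  refine le_trans (le_of_eq ?_) key
  simp only [comb]
  rw [lintegral_prod _ (by fun_prop)]
  refine lintegral_congr fun ξ => ?_
  dsimp only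
  rw [lintegral_const_mul _ (by fun_prop)]

/-! ### The Hartree potential on the Fourier side -/

/-- The constant `c` such that `c |ξ|^{γ-d}` is the Fourier transform of `|x|^{-γ}`. -/
def rieszConst (d : ℕ) (γ : ℝ) : ℝ :=
  Real.pi ^ (γ / 2) / Real.Gamma (γ / 2) *
    (Real.pi ^ (-((d - γ) / 2)) * Real.Gamma ((d - γ) / 2))

theorem rieszConst_pos {d : ℕ} {γ : ℝ} (hγ : 0 < γ) (hγd : γ < d) : 0 < rieszConst d γ := by
  have := Real.Gamma_pos_of_pos (half_pos hγ)
  have := Real.Gamma_pos_of_pos (half_pos (sub_pos.2 hγd))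
  have := Real.pi_pos
  unfold rieszConst
  positivity

/-- The Fourier transform of `|·|^{-γ} ∗ (F ḡ)`, where `f`, `g` are the Fourier transforms of `F`
and `G`. -/
def potFun {d : ℕ} (γ : ℝ) (f g : L2 d) (ξ : Rd d) : ℂ :=
  ((rieszConst d γ * ‖ξ‖ ^ (γ - d) : ℝ) : ℂ) * inner ℂ (shift 2 ξ g) f

theorem potFun_add_left {d : ℕ} (γ : ℝ) (f f' g : L2 d) :
    potFun γ (f + f') g = potFun γ f g + potFun γ f' g := by
  ext ξ
  simp only [potFun, inner_add_right, mul_add, Pi.add_apply]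

theorem potFun_add_right {d : ℕ} (γ : ℝ) (f g g' : L2 d) :
    potFun γ f (g + g') = potFun γ f g + potFun γ f g' := by
  ext ξ
  simp only [potFun, map_add, inner_add_left, mul_add, Pi.add_apply]

theorem potFun_smul_left {d : ℕ} (γ : ℝ) (c : ℂ) (f g : L2 d) :
    potFun γ (c • f) g = c • potFun γ f g := by
  ext ξ
  simp only [potFun, inner_smul_right, Pi.smul_apply, smul_eq_mul]
  ring

theorem potFun_smul_right {d : ℕ} (γ : ℝ) (c : ℂ) (f g : L2 d) :
    potFun γ f (c • g) = conj c • potFun γ f g := by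
  ext ξ
  simp only [potFun, map_smul, inner_smul_left, Pi.smul_apply, smul_eq_mul]
  ring

theorem measurable_potFun {d : ℕ} (γ : ℝ) (f g : L2 d) : Measurable (potFun γ f g) := by
  unfold potFun
  refine Measurable.mul (by fun_prop) (Continuous.measurable ?_)
  exact (continuous_shift (by simp) g).inner continuous_const

theorem enorm_inner_shift_le {d : ℕ} (f g : L2 d) (ξ : Rd d) :
    ‖inner ℂ (shift 2 ξ g) f‖ₑ ≤ ∫⁻ η, ‖f η‖ₑ * ‖g (η - ξ)‖ₑ := by
  rw [L2.inner_def]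
  refine (enorm_integral_le_lintegral_enorm _).trans (le_of_eq (lintegral_congr_ae ?_))
  filter_upwards [shift_ae ξ g] with η hη
  rw [hη, RCLike.inner_apply, enorm_mul, RCLike.enorm_conj]

theorem conjExponent_toReal_inv {p : ℝ≥0∞} (hp : 2 < p) :
    p.conjExponent.toReal⁻¹ = 1 - (p⁻¹).toReal := by
  have h1 : 1 ≤ p := le_trans (by norm_num) hp.le
  have h := (ENNReal.HolderConjugate.conjExponent h1).inv_add_inv_eq_one
  have hp0 : p⁻¹ ≠ ∞ := ENNReal.inv_ne_top.2 (by rintro rfl; simp at hp)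
  have hq0 : p.conjExponent⁻¹ ≠ ∞ := ENNReal.inv_ne_top.2
    (zero_lt_one.trans_le (fact_one_le_conjExponent p).out).ne'
  have h2 := congrArg ENNReal.toReal h
  rw [ENNReal.toReal_add hp0 hq0, ENNReal.toReal_one, ENNReal.toReal_inv p.conjExponent] at h2
  linarith

theorem inv_toReal_lt_half {p : ℝ≥0∞} (hp : 2 < p) : (p⁻¹).toReal < 1 / 2 := by
  have h : p⁻¹ < 2⁻¹ := ENNReal.inv_lt_inv.2 hp
  have := ENNReal.toReal_strict_mono (by simp) h
  simpa using this

theorem lintegral_enorm_rpow_conjExponent {d : ℕ} {p : ℝ≥0∞} (hp : 2 < p) (f : LpConj d p) :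
    (∫⁻ ξ, ‖f ξ‖ₑ ^ p.conjExponent.toReal) ^ (1 - (p⁻¹).toReal) = ‖f‖ₑ := by
  have hq0 : p.conjExponent ≠ 0 := (zero_lt_one.trans_le (fact_one_le_conjExponent p).out).ne'
  have hq : p.conjExponent ≠ ∞ := ((conjExponent_lt_two hp).trans_le le_top).ne
  rw [Lp.enorm_def, eLpNorm_eq_lintegral_rpow_enorm_toReal hq0 hq, ← conjExponent_toReal_inv hp,
    one_div]

/-- The exponent `d (1 - 2 / p)`, the upper bound for `γ`. -/
def critExp (d : ℕ) (p : ℝ≥0∞) : ℝ := d * (1 - 2 * (p⁻¹).toReal)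

theorem critExp_le {d : ℕ} {p : ℝ≥0∞} : critExp d p ≤ d := by
  have : 0 ≤ (p⁻¹).toReal := ENNReal.toReal_nonneg
  have : (0 : ℝ) ≤ d := Nat.cast_nonneg d
  unfold critExp
  nlinarith

/-- Beyond R the power is written as a nonpositive power of x, bounded by its value at R, times the
power 2ι of the integrable tail x^{-ε-d}. This is the form that Young's inequality can absorb, and
it also covers ι = 0, that is p = ∞. -/
theorem ofReal_rpow_le_of_split {d : ℕ} {γ b ι ε R x : ℝ} (hγd : γ < d) (hx : 0 ≤ x) (hR : 0 < R)
    (hb : b = d * (1 - 2 * ι)) (hy : 0 ≤ b - γ - 2 * ι * ε) :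
    ENNReal.ofReal (x ^ (γ - d)) ≤
      ENNReal.ofReal ((Ioc 0 R).indicator (fun y => y ^ (γ - d)) x) +
        ENNReal.ofReal (R ^ (-(b - γ - 2 * ι * ε))) *
          ENNReal.ofReal ((Ioi R).indicator (fun y => y ^ (-ε - d)) x) ^ (2 * ι) := by
  rcases hx.eq_or_lt with rfl | hx
  · rw [Real.zero_rpow (by linarith)]
    simp
  rcases le_or_gt x R with h | h
  · rw [indicator_of_mem (show x ∈ Ioc 0 R from ⟨hx, h⟩)]
    exact le_self_add
  · rw [indicator_of_mem (show x ∈ Ioi R from h)]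
    refine le_trans ?_ le_add_self
    rw [ENNReal.ofReal_rpow_of_pos (Real.rpow_pos_of_pos hx _),
      ← ENNReal.ofReal_mul (Real.rpow_nonneg hR.le _)]
    refine ENNReal.ofReal_le_ofReal ?_
    rw [← Real.rpow_mul hx.le]
    have e : γ - d = -(b - γ - 2 * ι * ε) + (-ε - d) * (2 * ι) := by rw [hb]; ring
    rw [e, Real.rpow_add hx]
    refine mul_le_mul_of_nonneg_right ?_ (Real.rpow_nonneg hx.le _)
    exact Real.rpow_le_rpow_of_nonpos hR h.le (by linarith)

/-- On |ξ| ≤ R the correlation is bounded by Cauchy-Schwarz and |ξ|^{γ-d} has integral of order R^γ.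
On |ξ| > R Young's inequality uses only the L^{p'} norms. Keeping R free is essential: concentrated
functions need small R. -/
theorem exists_lintegral_potFun_le {d : ℕ} {p : ℝ≥0∞} {γ : ℝ} (hp : 2 < p) (hγ : 0 < γ)
    (hγp : γ < critExp d p) :
    ∃ C > 0, ∀ R > 0, ∀ (f g : L2 d) (f' g' : LpConj d p), f =ᵐ[volume] f' → g =ᵐ[volume] g' →
      ∫⁻ ξ, ‖potFun γ f g ξ‖ₑ ≤
        ENNReal.ofReal (C * (R ^ γ * (‖f‖ * ‖g‖) + R ^ (γ - critExp d p) * (‖f'‖ * ‖g'‖))) := by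
  have hγd : γ < d := hγp.trans_le critExp_le
  have hd : 0 < d := by
    have : (0 : ℝ) < d := hγ.trans hγd
    exact_mod_cast this
  set b := critExp d p with hb
  set ι := (p⁻¹).toReal
  have hι0 : 0 ≤ ι := ENNReal.toReal_nonneg
  have hι2 : ι < 1 / 2 := inv_toReal_lt_half hp
  -- Any ε > 0 with 2ιε ≤ b - γ would do; ε is the decay that makes the tail integrable.
  set ε := (b - γ) / 2 with hε
  have hε0 : 0 < ε := half_pos (sub_pos.2 hγp)
  set D := (d : ℝ) * (volume : Measure (Rd d)).real (Metric.ball 0 1) with hD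
  have hD0 : 0 ≤ D := by positivity
  have hc : 0 < rieszConst d γ := rieszConst_pos hγ hγd
  set c := rieszConst d γ
  have hy : 0 ≤ b - γ - 2 * ι * ε := by nlinarith
  refine ⟨c * (D / γ + (D / ε) ^ (2 * ι)) + 1, by positivity, fun R hR f g f' g' hf hg => ?_⟩
  set J : Rd d → ℝ≥0∞ := fun ξ => ENNReal.ofReal ((Ioi R).indicator (fun y => y ^ (-ε - d)) ‖ξ‖)
  set I : Rd d → ℝ≥0∞ := fun ξ => ENNReal.ofReal ((Ioc 0 R).indicator (fun y => y ^ (γ - d)) ‖ξ‖)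
  have hJ : Measurable J := by
    have : Measurable ((Ioi R).indicator (fun y : ℝ => y ^ (-ε - d))) :=
      (by fun_prop : Measurable fun y : ℝ => y ^ (-ε - d)).indicator measurableSet_Ioi
    fun_prop
  have hI : Measurable I := by
    have : Measurable ((Ioc 0 R).indicator (fun y : ℝ => y ^ (γ - d))) :=
      (by fun_prop : Measurable fun y : ℝ => y ^ (γ - d)).indicator measurableSet_Ioc
    fun_prop
  set A : Rd d → ℝ≥0∞ := fun ξ => ‖f' ξ‖ₑ ^ p.conjExponent.toReal
  set B : Rd d → ℝ≥0∞ := fun ξ => ‖g' ξ‖ₑ ^ p.conjExponent.toReal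
  have hA : Measurable A := by
    have := (Lp.stronglyMeasurable f').measurable
    fun_prop
  have hB : Measurable B := by
    have := (Lp.stronglyMeasurable g').measurable
    fun_prop
  -- Here 1 - ι = 1/p', so A^{1-ι} and B^{1-ι} give back |f'| and |g'|.
  have hpow : ∀ x : ℝ≥0∞, (x ^ p.conjExponent.toReal) ^ (1 - ι) = x := fun x => by
    rw [← ENNReal.rpow_mul, ← conjExponent_toReal_inv hp, mul_inv_cancel₀, ENNReal.rpow_one]
    intro h0
    have h1 := conjExponent_toReal_inv hp
    rw [h0, inv_zero] at h1
    linarith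
  have hpt : ∀ ξ, ‖potFun γ f g ξ‖ₑ ≤ ENNReal.ofReal c * (I ξ * (‖f‖ₑ * ‖g‖ₑ) +
      ENNReal.ofReal (R ^ (-(b - γ - 2 * ι * ε))) *
        (J ξ ^ (2 * ι) * ∫⁻ η, A η ^ (1 - ι) * B (η - ξ) ^ (1 - ι))) := by
    intro ξ
    have h1 : ‖inner ℂ (shift 2 ξ g) f‖ₑ ≤ ‖f‖ₑ * ‖g‖ₑ := by
      rw [← ofReal_norm, ← ofReal_norm, ← ofReal_norm, ← ENNReal.ofReal_mul (norm_nonneg _)]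
      refine ENNReal.ofReal_le_ofReal ((norm_inner_le_norm _ _).trans ?_)
      rw [LinearIsometry.norm_map, mul_comm]
    have h2 : ‖inner ℂ (shift 2 ξ g) f‖ₑ ≤ ∫⁻ η, A η ^ (1 - ι) * B (η - ξ) ^ (1 - ι) := by
      refine (enorm_inner_shift_le f g ξ).trans (le_of_eq (lintegral_congr_ae ?_))
      filter_upwards [hf, (measurePreserving_sub_right volume ξ).quasiMeasurePreserving.ae hg]
        with η h3 h4
      simp only [A, B, hpow, h3, h4]
    have h3 := ofReal_rpow_le_of_split hγd (norm_nonneg ξ) hR hb hy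
    rw [potFun, enorm_mul, ← ofReal_norm (_ : ℂ), Complex.norm_of_nonneg (by positivity),
      ENNReal.ofReal_mul hc.le, mul_assoc]
    gcongr
    calc _ ≤ (I ξ + ENNReal.ofReal (R ^ (-(b - γ - 2 * ι * ε))) * J ξ ^ (2 * ι)) *
          ‖inner ℂ (shift 2 ξ g) f‖ₑ := mul_le_mul_left h3 _
      _ = I ξ * ‖inner ℂ (shift 2 ξ g) f‖ₑ + ENNReal.ofReal (R ^ (-(b - γ - 2 * ι * ε))) *
          (J ξ ^ (2 * ι) * ‖inner ℂ (shift 2 ξ g) f‖ₑ) := by ring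
      _ ≤ _ := by gcongr
  have hI' : ∫⁻ ξ, I ξ = ENNReal.ofReal (D * (R ^ γ / γ)) := by
    rw [hD, mul_assoc]
    exact lintegral_ball_rpow hd hγ hR
  have hJ' : ∫⁻ ξ, J ξ = ENNReal.ofReal (D * (R ^ (-ε) / ε)) := by
    rw [hD, mul_assoc]
    exact lintegral_compl_ball_rpow hd hε0 hR
  have hconv := lintegral_mul_conv_le (μ := volume) hJ hA hB hι0 hι2.le
  rw [lintegral_enorm_rpow_conjExponent hp, lintegral_enorm_rpow_conjExponent hp, hJ'] at hconv
  have hm : Measurable fun ξ => J ξ ^ (2 * ι) * ∫⁻ η, A η ^ (1 - ι) * B (η - ξ) ^ (1 - ι) := by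
    refine (hJ.pow_const _).mul (Measurable.lintegral_prod_right' (f := fun z : Rd d × Rd d =>
      A z.2 ^ (1 - ι) * B (z.2 - z.1) ^ (1 - ι)) ?_)
    fun_prop
  calc ∫⁻ ξ, ‖potFun γ f g ξ‖ₑ
      ≤ ∫⁻ ξ, ENNReal.ofReal c * (I ξ * (‖f‖ₑ * ‖g‖ₑ) +
        ENNReal.ofReal (R ^ (-(b - γ - 2 * ι * ε))) *
          (J ξ ^ (2 * ι) * ∫⁻ η, A η ^ (1 - ι) * B (η - ξ) ^ (1 - ι))) := lintegral_mono hpt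
    _ ≤ ENNReal.ofReal c * (ENNReal.ofReal (D * (R ^ γ / γ)) * (‖f‖ₑ * ‖g‖ₑ) +
        ENNReal.ofReal (R ^ (-(b - γ - 2 * ι * ε))) *
          (ENNReal.ofReal (D * (R ^ (-ε) / ε)) ^ (2 * ι) * (‖f'‖ₑ * ‖g'‖ₑ))) := by
      rw [lintegral_const_mul _ (by fun_prop), lintegral_add_left (by fun_prop),
        lintegral_mul_const _ hI, lintegral_const_mul _ hm, hI']
      gcongr
    _ = ENNReal.ofReal (c * (D * (R ^ γ / γ) * (‖f‖ * ‖g‖) + R ^ (-(b - γ - 2 * ι * ε)) *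
          ((D * (R ^ (-ε) / ε)) ^ (2 * ι) * (‖f'‖ * ‖g'‖)))) := by
      rw [← ofReal_norm, ← ofReal_norm, ← ofReal_norm, ← ofReal_norm,
        ENNReal.ofReal_rpow_of_nonneg (by positivity) (by positivity),
        ← ENNReal.ofReal_mul (by positivity), ← ENNReal.ofReal_mul (by positivity),
        ← ENNReal.ofReal_mul (by positivity), ← ENNReal.ofReal_mul (by positivity),
        ← ENNReal.ofReal_mul (by positivity), ← ENNReal.ofReal_add (by positivity) (by positivity),
        ← ENNReal.ofReal_mul (by positivity)]
    _ ≤ _ := by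
      refine ENNReal.ofReal_le_ofReal ?_
      -- The auxiliary ε cancels in the exponent of R, leaving R^{γ-b}.
      have e : R ^ (-(b - γ - 2 * ι * ε)) * ((D * (R ^ (-ε) / ε)) ^ (2 * ι) * (‖f'‖ * ‖g'‖)) =
          (D / ε) ^ (2 * ι) * (R ^ (γ - b) * (‖f'‖ * ‖g'‖)) := by
        have e1 : D * (R ^ (-ε) / ε) = D / ε * R ^ (-ε) := by ring
        have e2 : γ - b = -(b - γ - 2 * ι * ε) + -ε * (2 * ι) := by ring
        rw [e1, Real.mul_rpow (by positivity) (by positivity), ← Real.rpow_mul hR.le, e2,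
          Real.rpow_add hR]
        ring
      rw [e]
      have n1 : 0 ≤ R ^ γ * (‖f‖ * ‖g‖) := by positivity
      have n2 : 0 ≤ R ^ (γ - b) * (‖f'‖ * ‖g'‖) := by positivity
      have n3 : 0 ≤ c * (D / γ) := by positivity
      have n4 : 0 ≤ c * (D / ε) ^ (2 * ι) := by positivity
      have e3 : D * (R ^ γ / γ) * (‖f‖ * ‖g‖) = D / γ * (R ^ γ * (‖f‖ * ‖g‖)) := by ring
      rw [e3]
      nlinarith [mul_nonneg n3 n2, mul_nonneg n4 n1]

theorem Y.ae_eq_one {d : ℕ} {p : ℝ≥0∞} (f : Y d p 1) : f.1.1 =ᵐ[volume] f.1.2 := by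
  filter_upwards [f.ae_eq] with x hx
  rw [hx, Complex.ofReal_one, one_mul]

open Classical in
/-- The potential `potFun` as an element of `L¹`. -/
def pot {d : ℕ} {p : ℝ≥0∞} (γ : ℝ) (f g : Y d p 1) : L1 d :=
  if h : MemLp (potFun γ f.1.1 g.1.1) 1 volume then h.toLp else 0

section

variable {d : ℕ} {p : ℝ≥0∞} {γ : ℝ} (hp : 2 < p) (hγ : 0 < γ) (hγp : γ < critExp d p)

include hp hγ hγp

theorem memLp_potFun (f g : Y d p 1) : MemLp (potFun γ f.1.1 g.1.1) 1 volume := by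
  obtain ⟨C, -, hC⟩ := exists_lintegral_potFun_le hp hγ hγp
  refine ⟨(measurable_potFun γ _ _).aestronglyMeasurable, ?_⟩
  rw [eLpNorm_one_eq_lintegral_enorm]
  exact (hC 1 one_pos _ _ _ _ f.ae_eq_one g.ae_eq_one).trans_lt ENNReal.ofReal_lt_top

theorem pot_eq (f g : Y d p 1) : pot γ f g = (memLp_potFun hp hγ hγp f g).toLp :=
  dif_pos _

theorem pot_ae (f g : Y d p 1) : pot γ f g =ᵐ[volume] potFun γ f.1.1 g.1.1 := by
  rw [pot_eq hp hγ hγp]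
  exact (memLp_potFun hp hγ hγp f g).coeFn_toLp

theorem pot_add_left (f f' g : Y d p 1) : pot γ (f + f') g = pot γ f g + pot γ f' g := by
  simp only [pot_eq hp hγ hγp]
  rw [← MemLp.toLp_add]
  exact MemLp.toLp_congr _ _ (ae_of_all _ (congrFun (potFun_add_left γ f.1.1 f'.1.1 g.1.1)))

theorem pot_add_right (f g g' : Y d p 1) : pot γ f (g + g') = pot γ f g + pot γ f g' := by
  simp only [pot_eq hp hγ hγp]
  rw [← MemLp.toLp_add]
  exact MemLp.toLp_congr _ _ (ae_of_all _ (congrFun (potFun_add_right γ f.1.1 g.1.1 g'.1.1)))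

theorem pot_smul_left (c : ℂ) (f g : Y d p 1) : pot γ (c • f) g = c • pot γ f g := by
  simp only [pot_eq hp hγ hγp]
  rw [← MemLp.toLp_const_smul]
  exact MemLp.toLp_congr _ _ (ae_of_all _ (congrFun (potFun_smul_left γ c f.1.1 g.1.1)))

theorem pot_smul_right (c : ℂ) (f g : Y d p 1) : pot γ f (c • g) = conj c • pot γ f g := by
  simp only [pot_eq hp hγ hγp]
  rw [← MemLp.toLp_const_smul]
  exact MemLp.toLp_congr _ _ (ae_of_all _ (congrFun (potFun_smul_right γ c f.1.1 g.1.1)))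

theorem pot_sub_left (f f' g : Y d p 1) : pot γ (f - f') g = pot γ f g - pot γ f' g := by
  rw [eq_sub_iff_add_eq, ← pot_add_left hp hγ hγp, sub_add_cancel]

theorem pot_sub_right (f g g' : Y d p 1) : pot γ f (g - g') = pot γ f g - pot γ f g' := by
  rw [eq_sub_iff_add_eq, ← pot_add_right hp hγ hγp, sub_add_cancel]

theorem exists_norm_pot_le : ∃ C > 0, ∀ R > 0, ∀ f g : Y d p 1,
    ‖pot γ f g‖ ≤ C * (R ^ γ * (‖f.1.1‖ * ‖g.1.1‖) +
      R ^ (γ - critExp d p) * (‖f.1.2‖ * ‖g.1.2‖)) := by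
  obtain ⟨C, hC0, hC⟩ := exists_lintegral_potFun_le hp hγ hγp
  refine ⟨C, hC0, fun R hR f g => ?_⟩
  rw [pot_eq hp hγ hγp, Lp.norm_toLp, eLpNorm_one_eq_lintegral_enorm]
  refine ENNReal.toReal_le_of_le_ofReal ?_ (hC R hR _ _ _ _ f.ae_eq_one g.ae_eq_one)
  positivity

end

/-! ### Inclusion of the weighted spaces -/

namespace Y

variable {d : ℕ} {p : ℝ≥0∞} {s : ℝ}

theorem incl_mem (hs : s ≠ 0) (y : Y d p s) :
    ((s : ℂ)⁻¹ • y.1.1, y.1.2) ∈ weightedInter d p 1 := by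
  rw [mem_weightedInter]
  filter_upwards [y.ae_eq, Lp.coeFn_smul (s : ℂ)⁻¹ y.1.1] with x h1 h2
  rw [h2, Pi.smul_apply, h1, smul_eq_mul, inv_mul_cancel_left₀ (Complex.ofReal_ne_zero.2 hs),
    Complex.ofReal_one, one_mul]

/-- The identity on functions, as a map between the differently normed spaces. -/
def incl (hs : s ≠ 0) : Y d p s →L[ℂ] Y d p 1 :=
  LinearMap.mkContinuous
    { toFun := fun y => ⟨((s : ℂ)⁻¹ • y.1.1, y.1.2), incl_mem hs y⟩
      map_add' := fun y z => Subtype.ext (Prod.ext (smul_add _ y.1.1 z.1.1) rfl)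
      map_smul' := fun c y => Subtype.ext (Prod.ext (smul_comm _ c y.1.1) rfl) }
    (max |s|⁻¹ 1) fun y => by
      change max ‖(s : ℂ)⁻¹ • y.1.1‖ ‖y.1.2‖ ≤ _
      rw [norm_smul, norm_inv, Complex.norm_real, Real.norm_eq_abs]
      refine max_le ?_ ?_
      · exact mul_le_mul (le_max_left _ _) y.norm_fst_le (norm_nonneg _)
          (le_max_of_le_right zero_le_one)
      · exact y.norm_snd_le.trans (le_mul_of_one_le_left (norm_nonneg _) (le_max_right _ _))

theorem incl_fst (hs : s ≠ 0) (y : Y d p s) : (incl hs y).1.1 = (s : ℂ)⁻¹ • y.1.1 := rfl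

theorem norm_incl_fst_le (hs : 0 < s) (y : Y d p s) : ‖(incl hs.ne' y).1.1‖ ≤ s⁻¹ * ‖y‖ := by
  rw [incl_fst, norm_smul, norm_inv, Complex.norm_real, Real.norm_eq_abs, abs_of_pos hs]
  exact mul_le_mul_of_nonneg_left y.norm_fst_le (by positivity)

theorem incl_shift (hs : s ≠ 0) (η : Rd d) (y : Y d p s) :
    incl hs (shift η y) = shift η (incl hs y) :=
  Subtype.ext (Prod.ext ((HartreeFock.shift 2 η).map_smul (s : ℂ)⁻¹ y.1.1).symm rfl)

theorem incl_evol (hs : s ≠ 0) (α t : ℝ) (y : Y d p s) :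
    incl hs (evol α t y) = evol α t (incl hs y) :=
  Subtype.ext (Prod.ext ((symbolMul α t 2).map_smul (s : ℂ)⁻¹ y.1.1).symm rfl)

theorem incl_conv (hp : 2 < p) (hs : s ≠ 0) (K : L1 d) (y : Y d p s) :
    incl hs (conv K y) = conv K (incl hs y) := by
  unfold conv
  rw [← ContinuousLinearMap.integral_comp_comm _ (integrable_smul_shift hp K y)]
  simp only [map_smul, incl_shift]

end Y

/-! ### Translation and modulation -/

/-- The character `exp (2 π i x · ξ)`. -/
def char {d : ℕ} (ξ x : Rd d) : ℂ := Complex.exp (((2 * Real.pi * inner ℝ x ξ : ℝ) : ℂ) * Complex.I)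

theorem norm_char {d : ℕ} (ξ x : Rd d) : ‖char ξ x‖ = 1 := Complex.norm_exp_ofReal_mul_I _

theorem continuous_char {d : ℕ} : Continuous fun z : Rd d × Rd d => char z.1 z.2 := by
  unfold char
  fun_prop

theorem measurable_char {d : ℕ} (ξ : Rd d) : Measurable (char ξ) :=
  (continuous_char.comp (by fun_prop : Continuous fun x => (ξ, x))).measurable

/-- Multiplication by the character with frequency `ξ` on `L²`. -/
def modulate {d : ℕ} (ξ : Rd d) : L2 d →ₗᵢ[ℂ] L2 d :=
  mulUnit (char ξ) (measurable_char ξ) (norm_char ξ) 2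

theorem modulate_ae {d : ℕ} (ξ : Rd d) (f : L2 d) :
    modulate ξ f =ᵐ[volume] fun x => char ξ x * f x := mulUnit_ae _ _ f

theorem fourierInv_comp_sub {d : ℕ} (f : Rd d → ℂ) (ξ x : Rd d) :
    𝓕⁻ (fun ζ => f (ζ - ξ)) x = char ξ x * 𝓕⁻ f x := by
  rw [Real.fourierInv_eq', Real.fourierInv_eq',
    ← integral_add_right_eq_self _ ξ, ← integral_const_mul]
  refine integral_congr_ae (ae_of_all _ fun ζ => ?_)
  simp only [add_sub_cancel_right, char, smul_eq_mul]
  rw [← mul_assoc, ← Complex.exp_add, real_inner_comm ξ x, inner_add_left]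
  congr 2
  push_cast
  ring

/-- Translation of a Schwartz function. -/
def schwartzShift {d : ℕ} (ξ : Rd d) (f : 𝓢(Rd d, ℂ)) : 𝓢(Rd d, ℂ) :=
  SchwartzMap.compCLMOfAntilipschitz (K := 1) ℂ (g := fun x : Rd d => x - ξ) (by fun_prop)
    (IsometryEquiv.subRight ξ).isometry.antilipschitz f

theorem schwartzShift_apply {d : ℕ} (ξ : Rd d) (f : 𝓢(Rd d, ℂ)) (x : Rd d) :
    schwartzShift ξ f x = f (x - ξ) := rfl

/-- Both sides are continuous in f, so it suffices to treat Schwartz functions, where the transform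
is an integral. -/
theorem fourierInv_shift {d : ℕ} (ξ : Rd d) (f : L2 d) :
    (𝓕⁻ (shift 2 ξ f) : L2 d) = modulate ξ (𝓕⁻ f) := by
  refine DenseRange.induction_on (p := fun f => (𝓕⁻ (shift 2 ξ f) : L2 d) = modulate ξ (𝓕⁻ f))
    (SchwartzMap.denseRange_toLpCLM (p := 2) ENNReal.ofNat_ne_top) f ?_ ?_
  · refine isClosed_eq ?_ ?_
    · exact (FourierTransform.continuous_fourierInv).comp (shift 2 ξ).continuous
    · exact (modulate ξ).continuous.comp FourierTransform.continuous_fourierInv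
  · intro φ
    change (𝓕⁻ (shift 2 ξ (φ.toLp 2)) : L2 d) = modulate ξ (𝓕⁻ (φ.toLp 2))
    have h1 : shift 2 ξ (φ.toLp 2) = (schwartzShift ξ φ).toLp 2 := by
      refine Lp.ext ?_
      filter_upwards [shift_ae ξ (φ.toLp 2 : L2 d), (schwartzShift ξ φ).coeFn_toLp 2 volume,
        (measurePreserving_sub_right volume ξ).quasiMeasurePreserving.ae
          (φ.coeFn_toLp 2 volume)] with x e1 e2 e3
      rw [e1, e2, e3, schwartzShift_apply]
    rw [h1, SchwartzMap.toLp_fourierInv_eq, SchwartzMap.toLp_fourierInv_eq]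
    refine Lp.ext ?_
    filter_upwards [modulate_ae ξ ((𝓕⁻ φ).toLp 2 : L2 d), (𝓕⁻ φ).coeFn_toLp 2 volume,
      (𝓕⁻ (schwartzShift ξ φ)).coeFn_toLp 2 volume] with x e1 e2 e3
    rw [e1, e2, e3, SchwartzMap.fourierInv_coe, SchwartzMap.fourierInv_coe]
    exact fourierInv_comp_sub φ ξ x

theorem fourier_modulate {d : ℕ} (ξ : Rd d) (f : L2 d) :
    (𝓕 (modulate ξ f) : L2 d) = shift 2 ξ (𝓕 f) := by
  have h := fourierInv_shift ξ (𝓕 f : L2 d)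
  rw [FourierTransform.fourierInv_fourier_eq] at h
  rw [← h, FourierTransform.fourier_fourierInv_eq]

/-- Plancherel: translating ĝ corresponds to modulating g, and the character inside the inner
product is the kernel of the Fourier integral. Hence the correlation in `potFun` is the transform of
the density f ḡ. -/
theorem inner_shift_fourier {d : ℕ} (f g : L2 d) (ξ : Rd d) :
    inner ℂ (shift 2 ξ (𝓕 g : L2 d)) (𝓕 f : L2 d) = 𝓕 (fun x => f x * conj (g x)) ξ := by
  rw [← fourier_modulate, Lp.inner_fourier_eq, L2.inner_def, Real.fourier_eq']
  refine integral_congr_ae ?_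
  filter_upwards [modulate_ae ξ g] with x hx
  rw [hx, RCLike.inner_apply, map_mul, char, ← Complex.exp_conj, smul_eq_mul, map_mul,
    Complex.conj_I, Complex.conj_ofReal]
  rw [show ((2 * Real.pi * inner ℝ x ξ : ℝ) : ℂ) * -Complex.I =
    ((-2 * Real.pi * inner ℝ x ξ : ℝ) : ℂ) * Complex.I by push_cast; ring]
  ring

/-! ### The inverse Fourier transform of a convolution -/

/-- The inverse Fourier transform of an integrable function, given by the integral. -/
def invFourierFun {d : ℕ} (K : L1 d) (x : Rd d) : ℂ := ∫ η, K η * char η x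

theorem norm_invFourierFun_le {d : ℕ} (K : L1 d) (x : Rd d) : ‖invFourierFun K x‖ ≤ ‖K‖ := by
  refine (norm_integral_le_integral_norm _).trans (le_of_eq ?_)
  rw [L1.norm_eq_integral_norm]
  simp only [norm_mul, norm_char, mul_one]

theorem measurable_invFourierFun {d : ℕ} (K : L1 d) : Measurable (invFourierFun K) := by
  refine StronglyMeasurable.measurable ?_
  refine StronglyMeasurable.integral_prod_right'
    (f := fun z : Rd d × Rd d => K z.2 * char z.2 z.1) ?_
  refine ((Lp.stronglyMeasurable K).comp_measurable measurable_snd).mul ?_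
  exact (continuous_char.comp continuous_swap).stronglyMeasurable

theorem memLp_invFourierFun_mul {d : ℕ} (K : L1 d) (f : L2 d) :
    MemLp (fun x => invFourierFun K x * f x) 2 volume :=
  (Lp.memLp f).of_le_mul (c := ‖K‖)
    ((measurable_invFourierFun K).aestronglyMeasurable.mul (Lp.aestronglyMeasurable f))
    (ae_of_all _ fun x => by
      rw [norm_mul]
      exact mul_le_mul_of_nonneg_right (norm_invFourierFun_le K x) (norm_nonneg _))

theorem continuous_modulate {d : ℕ} (f : L2 d) : Continuous fun ξ => modulate ξ f :=
  continuous_mulUnit measurable_char norm_char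
    (fun x => continuous_char.comp (by fun_prop : Continuous fun ξ => (ξ, x))) (by simp) f

theorem integrable_smul_modulate {d : ℕ} (K : L1 d) (f : L2 d) :
    Integrable (fun η => K η • modulate η f) volume :=
  Integrable.smul_of_top_left (L1.integrable_coeFn K) (memLp_top_of_bound
    (continuous_modulate f).aestronglyMeasurable ‖f‖
    (by filter_upwards with η; rw [LinearIsometry.norm_map]))

/-- A Bochner integral in L² has no pointwise values, so it is identified by pairing with an
arbitrary g and applying Fubini. -/
theorem integral_smul_modulate {d : ℕ} (K : L1 d) (f : L2 d) :
    ∫ η, K η • modulate η f = (memLp_invFourierFun_mul K f).toLp := by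
  refine ext_inner_left ℂ fun g => ?_
  have h1 := ContinuousLinearMap.integral_comp_comm (innerSL ℂ g) (integrable_smul_modulate K f)
  simp only [innerSL_apply_apply] at h1
  rw [← h1, L2.inner_def]
  have hgf : Integrable (fun x => inner ℂ (g x) (f x)) volume := L2.integrable_inner g f
  have hprod : Integrable (fun z : Rd d × Rd d => K z.1 * (char z.1 z.2 * inner ℂ (g z.2) (f z.2)))
      (volume.prod volume) := by
    have h2 := (L1.integrable_coeFn K).mul_prod hgf
    refine (h2.bdd_mul (c := 1) (f := fun z : Rd d × Rd d => char z.1 z.2)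
      continuous_char.aestronglyMeasurable
      (ae_of_all _ fun z => (norm_char _ _).le)).congr (ae_of_all _ fun z => ?_)
    simp only
    ring
  calc ∫ η, inner ℂ g (K η • modulate η f)
      = ∫ η, ∫ x, K η * (char η x * inner ℂ (g x) (f x)) := by
        refine integral_congr_ae (ae_of_all _ fun η => ?_)
        simp only
        rw [inner_smul_right, L2.inner_def, integral_const_mul]
        congr 1
        refine integral_congr_ae ?_
        filter_upwards [modulate_ae η f] with x hx
        rw [hx, RCLike.inner_apply, RCLike.inner_apply]
        ring
    _ = ∫ x, ∫ η, K η * (char η x * inner ℂ (g x) (f x)) := integral_integral_swap hprod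
    _ = _ := by
        refine integral_congr_ae ?_
        filter_upwards [(memLp_invFourierFun_mul K f).coeFn_toLp] with x hx
        rw [hx]
        simp only [RCLike.inner_apply]
        rw [invFourierFun, mul_assoc, ← integral_mul_const]
        refine integral_congr_ae (ae_of_all _ fun η => ?_)
        ring

/-- The projection of `Y` to `L²`. -/
def Y.fstL (d : ℕ) (p : ℝ≥0∞) (s : ℝ) : Y d p s →L[ℂ] L2 d :=
  LinearMap.mkContinuous
    { toFun := fun y => y.1.1
      map_add' := fun _ _ => rfl
      map_smul' := fun _ _ => rfl } 1 fun y => by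
      rw [one_mul]; exact y.norm_fst_le

theorem fourierInv_conv {d : ℕ} {p : ℝ≥0∞} {s : ℝ} (hp : 2 < p) (K : L1 d) (h : Y d p s) :
    (𝓕⁻ (Y.conv K h).1.1 : L2 d) =ᵐ[volume]
      fun x => invFourierFun K x * (𝓕⁻ h.1.1 : L2 d) x := by
  have e : (𝓕⁻ (Y.conv K h).1.1 : L2 d) =
      (memLp_invFourierFun_mul K (𝓕⁻ h.1.1 : L2 d)).toLp := by
    rw [← integral_smul_modulate]
    let Φ : Y d p s →L[ℂ] L2 d :=
      (FourierTransform.fourierInvCLM ℂ (L2 d)).comp (Y.fstL d p s)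
    have h1 := Φ.integral_comp_comm (Y.integrable_smul_shift hp K h)
    change Φ (∫ η, K η • Y.shift η h) = _
    rw [← h1]
    refine integral_congr_ae (ae_of_all _ fun η => ?_)
    simp only [map_smul]
    exact congrArg _ (fourierInv_shift η h.1.1)
  rw [e]
  exact (memLp_invFourierFun_mul K _).coeFn_toLp

/-! ### The Fourier transform of the Riesz kernel, by Gaussian subordination -/

/-- The substitution s ↦ 1/s in Euler's integral for the Gamma function. -/
theorem integral_rpow_mul_exp_neg_div {a r : ℝ} (ha : 0 < a) (hr : 0 < r) :
    ∫ s in Ioi (0 : ℝ), s ^ (-a - 1) * Real.exp (-(r / s)) = (1 / r) ^ a * Real.Gamma a := by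
  rw [← Real.integral_rpow_mul_exp_neg_mul_Ioi ha hr,
    ← integral_comp_rpow_Ioi (fun t => t ^ (a - 1) * Real.exp (-(r * t)))
      (p := -1) (by norm_num)]
  refine setIntegral_congr_fun measurableSet_Ioi fun s (hs : 0 < s) => ?_
  simp only [abs_neg, abs_one, one_mul, smul_eq_mul]
  rw [← mul_assoc, ← Real.rpow_mul hs.le, ← Real.rpow_add hs, Real.rpow_neg_one, div_eq_mul_inv]
  congr 2
  ring

theorem integrableOn_rpow_mul_exp_neg_mul {a r : ℝ} (ha : 0 < a) (hr : 0 < r) :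
    IntegrableOn (fun s : ℝ => s ^ (a - 1) * Real.exp (-(r * s))) (Ioi 0) := by
  -- The integral of a non-integrable function is 0 by convention, so its nonzero value proves
  -- integrability.
  refine Integrable.of_integral_ne_zero ?_
  rw [Real.integral_rpow_mul_exp_neg_mul_Ioi ha hr]
  have := Real.Gamma_pos_of_pos ha
  positivity

theorem integrableOn_rpow_mul_exp_neg_div {a r : ℝ} (ha : 0 < a) (hr : 0 < r) :
    IntegrableOn (fun s : ℝ => s ^ (-a - 1) * Real.exp (-(r / s))) (Ioi 0) := by
  refine Integrable.of_integral_ne_zero ?_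
  rw [integral_rpow_mul_exp_neg_div ha hr]
  have := Real.Gamma_pos_of_pos ha
  positivity

/-- The multiplication formula ∫ φ̂ ρ = ∫ φ ρ̂ for a Gaussian φ modulated by x, whose transform is a
Gaussian centred at x. -/
theorem integral_gaussian_mul {d : ℕ} {ρ : Rd d → ℂ} (hρ : Integrable ρ volume) {s : ℝ}
    (hs : 0 < s) (x : Rd d) :
    ∫ y, ((Real.exp (-(Real.pi * ‖x - y‖ ^ 2 * s)) : ℝ) : ℂ) * ρ y =
      ((s ^ (-(d / 2 : ℝ)) : ℝ) : ℂ) *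
        ∫ ξ, ((Real.exp (-(Real.pi * ‖ξ‖ ^ 2 / s)) : ℝ) : ℂ) * (char ξ x * 𝓕 ρ ξ) := by
  have hpi := Real.pi_pos
  set b : ℂ := ((Real.pi / s : ℝ) : ℂ) with hb
  have hbre : 0 < b.re := by rw [hb, Complex.ofReal_re]; positivity
  set φ : Rd d → ℂ := fun v => Complex.exp (-b * ‖v‖ ^ 2 + 2 * Real.pi * Complex.I * inner ℝ x v)
  have hφ : Integrable φ volume := GaussianFourier.integrable_cexp_neg_mul_sq_norm_add hbre _ _
  have h1 : ∫ y, 𝓕 φ y * ρ y = ∫ ξ, φ ξ * 𝓕 ρ ξ := by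
    have h := VectorFourier.integral_fourierIntegral_smul_eq_flip (L := innerₗ (Rd d))
      Real.continuous_fourierChar continuous_inner hφ hρ
    rw [flip_innerₗ] at h
    exact h
  have h2 : ∀ y, 𝓕 φ y = ((s ^ (d / 2 : ℝ) : ℝ) : ℂ) *
      ((Real.exp (-(Real.pi * ‖x - y‖ ^ 2 * s)) : ℝ) : ℂ) := by
    intro y
    rw [fourier_gaussian_innerProductSpace' hbre x y, finrank_euclideanSpace_fin]
    have e1 : (Real.pi : ℂ) / b = (s : ℂ) := by
      rw [hb, ← Complex.ofReal_div]
      congr 1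
      field_simp
    rw [e1, Complex.ofReal_exp, Complex.ofReal_cpow hs.le]
    congr 1
    · push_cast; rfl
    · congr 1
      rw [hb]
      have : (Real.pi : ℂ) ≠ 0 := Complex.ofReal_ne_zero.2 hpi.ne'
      have : (s : ℂ) ≠ 0 := Complex.ofReal_ne_zero.2 hs.ne'
      push_cast
      field_simp
  have h3 : ∀ ξ, φ ξ = ((Real.exp (-(Real.pi * ‖ξ‖ ^ 2 / s)) : ℝ) : ℂ) * char ξ x := by
    intro ξ
    simp only [φ, char, hb]
    rw [Complex.ofReal_exp, ← Complex.exp_add]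
    congr 1
    push_cast
    ring
  simp only [h2, h3, mul_assoc] at h1 ⊢
  rw [integral_const_mul] at h1
  rw [← h1, ← mul_assoc, ← Complex.ofReal_mul, ← Real.rpow_add hs, neg_add_cancel, Real.rpow_zero,
    Complex.ofReal_one, one_mul]

theorem integrable_prod_of_nonneg_kernel {X S : Type*} [MeasurableSpace X] [MeasurableSpace S]
    {μ : Measure X} {ν : Measure S} [SFinite μ] [SFinite ν] {k : X → S → ℝ} {F : X → ℂ}
    (hk : Measurable (Function.uncurry k)) (hF : Measurable F)
    (h0 : ∀ x, ∀ᵐ s ∂ν, 0 ≤ k x s) (hi : ∀ᵐ x ∂μ, Integrable (k x) ν)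
    (hm : Integrable (fun x => (∫ s, k x s ∂ν) * ‖F x‖) μ) :
    Integrable (Function.uncurry fun x s => ((k x s : ℝ) : ℂ) * F x) (μ.prod ν) := by
  refine (integrable_prod_iff ?_).2 ⟨?_, ?_⟩
  · refine Measurable.aestronglyMeasurable ?_
    exact (Complex.measurable_ofReal.comp hk).mul (hF.comp measurable_fst)
  · filter_upwards [hi] with x hx
    exact (Complex.ofRealCLM.integrable_comp hx).mul_const (F x)
  · refine hm.congr (ae_of_all _ fun x => ?_)
    simp only [Function.uncurry_apply_pair, norm_mul, Complex.norm_real]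
    rw [integral_mul_const]
    congr 1
    refine integral_congr_ae ?_
    filter_upwards [h0 x] with s hs
    exact (Real.norm_of_nonneg hs).symm

/-- The Fourier multiplier form of the convolution with `|·|^{-γ}`. -/
theorem integral_riesz_mul {d : ℕ} {γ : ℝ} (hγ : 0 < γ) (hγd : γ < d) {ρ : Rd d → ℂ}
    (hm : Measurable ρ) (hρ : Integrable ρ volume) {x : Rd d}
    (hx : Integrable (fun y => ‖x - y‖ ^ (-γ) * ‖ρ y‖) volume)
    (hk : Integrable (fun ξ => ‖ξ‖ ^ (γ - d) * ‖𝓕 ρ ξ‖) volume) :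
    ∫ y, ((‖x - y‖ ^ (-γ) : ℝ) : ℂ) * ρ y =
      ∫ ξ, ((rieszConst d γ * ‖ξ‖ ^ (γ - d) : ℝ) : ℂ) * 𝓕 ρ ξ * char ξ x := by
  have hpi := Real.pi_pos
  have hG1 := Real.Gamma_pos_of_pos (half_pos hγ)
  set a := ((d : ℝ) - γ) / 2 with ha
  have ha0 : 0 < a := half_pos (sub_pos.2 hγd)
  have hd : 0 < d := by
    have : (0 : ℝ) < d := hγ.trans hγd
    exact_mod_cast this
  have : Nonempty (Fin d) := ⟨⟨0, hd⟩⟩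
  set μ : Measure ℝ := volume.restrict (Ioi 0) with hμ
  have hcont : Continuous (𝓕 ρ) :=
    VectorFourier.fourierIntegral_continuous Real.continuous_fourierChar continuous_inner hρ
  -- the two double integrals
  set G : Rd d → ℝ → ℂ := fun y s =>
    ((s ^ (γ / 2 - 1) * Real.exp (-(Real.pi * ‖x - y‖ ^ 2 * s)) : ℝ) : ℂ) * ρ y
  set H : ℝ → Rd d → ℂ := fun s ξ =>
    ((s ^ (-a - 1) * Real.exp (-(Real.pi * ‖ξ‖ ^ 2 / s)) : ℝ) : ℂ) * (char ξ x * 𝓕 ρ ξ)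
  have hpow : ∀ c : ℝ, ∀ z : Rd d,
      (1 / (Real.pi * ‖z‖ ^ 2)) ^ c = Real.pi ^ (-c) * ‖z‖ ^ (-(2 * c)) := by
    intro c z
    rw [one_div, ← Real.rpow_neg_one, ← Real.rpow_mul (by positivity), Real.mul_rpow hpi.le
      (by positivity), ← Real.rpow_natCast, ← Real.rpow_mul (norm_nonneg _)]
    congr 2 <;> push_cast <;> ring
  have hFm : Measurable (𝓕 ρ) := hcont.measurable
  have hcm : Measurable fun ξ => char ξ x :=
    (continuous_char.comp (by fun_prop : Continuous fun ξ => (ξ, x))).measurable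
  have hne : ∀ᵐ y : Rd d, 0 < Real.pi * ‖x - y‖ ^ 2 := by
    filter_upwards [Measure.ae_ne volume x] with y hy
    have := norm_pos_iff.2 (sub_ne_zero.2 hy.symm)
    positivity
  have hne0 : ∀ᵐ ξ : Rd d, 0 < Real.pi * ‖ξ‖ ^ 2 := by
    filter_upwards [Measure.ae_ne volume (0 : Rd d)] with y hy
    have := norm_pos_iff.2 hy
    positivity
  -- Both |x|^{-γ} and |ξ|^{γ-d} are superpositions of Gaussians over the scale s. The formula for a
  -- single Gaussian is integrated in s, and Fubini is applied on both sides.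
  have g1 : ∀ᵐ y : Rd d, ∫ s, s ^ (γ / 2 - 1) * Real.exp (-(Real.pi * ‖x - y‖ ^ 2 * s)) ∂μ =
      Real.pi ^ (-(γ / 2)) * Real.Gamma (γ / 2) * ‖x - y‖ ^ (-γ) := by
    filter_upwards [hne] with y hy
    rw [Real.integral_rpow_mul_exp_neg_mul_Ioi (half_pos hγ) hy, hpow,
      mul_div_cancel₀ _ two_ne_zero]
    ring
  have g2 : ∀ᵐ ξ : Rd d, ∫ s, s ^ (-a - 1) * Real.exp (-(Real.pi * ‖ξ‖ ^ 2 / s)) ∂μ =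
      Real.pi ^ (-a) * Real.Gamma a * ‖ξ‖ ^ (γ - d) := by
    filter_upwards [hne0] with ξ hξ
    rw [integral_rpow_mul_exp_neg_div ha0 hξ, hpow, ha, mul_div_cancel₀ _ two_ne_zero, neg_sub]
    ring
  have hpos : ∀ᵐ s ∂μ, (0 : ℝ) < s := ae_restrict_mem measurableSet_Ioi
  have hGi : Integrable (Function.uncurry G) (volume.prod μ) := by
    refine integrable_prod_of_nonneg_kernel
      (k := fun y s => s ^ (γ / 2 - 1) * Real.exp (-(Real.pi * ‖x - y‖ ^ 2 * s))) (F := ρ)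
      (by fun_prop) hm (fun y => by filter_upwards [hpos] with s hs; positivity) ?_ ?_
    · filter_upwards [hne] with y hy
      exact integrableOn_rpow_mul_exp_neg_mul (half_pos hγ) hy
    · refine (hx.const_mul (Real.pi ^ (-(γ / 2)) * Real.Gamma (γ / 2))).congr ?_
      filter_upwards [g1] with y hy
      rw [hy]
      ring
  have hHi : Integrable (Function.uncurry fun ξ s => H s ξ) (volume.prod μ) := by
    refine integrable_prod_of_nonneg_kernel
      (k := fun ξ s => s ^ (-a - 1) * Real.exp (-(Real.pi * ‖ξ‖ ^ 2 / s)))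
      (F := fun ξ => char ξ x * 𝓕 ρ ξ)
      (by fun_prop) (hcm.mul hFm)
      (fun y => by filter_upwards [hpos] with s hs; positivity) ?_ ?_
    · filter_upwards [hne0] with y hy
      exact integrableOn_rpow_mul_exp_neg_div ha0 hy
    · refine (hk.const_mul (Real.pi ^ (-a) * Real.Gamma a)).congr ?_
      filter_upwards [g2] with y hy
      rw [hy, norm_mul, norm_char, one_mul]
      ring
  have e1 : ∀ᵐ y, ∫ s, G y s ∂μ = ((Real.pi ^ (-(γ / 2)) * Real.Gamma (γ / 2) : ℝ) : ℂ) *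
      (((‖x - y‖ ^ (-γ) : ℝ) : ℂ) * ρ y) := by
    filter_upwards [g1] with y hy
    simp only [G]
    rw [integral_mul_const, integral_complex_ofReal, hy, Complex.ofReal_mul, mul_assoc]
  have e2 : ∀ᵐ ξ, ∫ s, H s ξ ∂μ = ((Real.pi ^ (-a) * Real.Gamma a : ℝ) : ℂ) *
      (((‖ξ‖ ^ (γ - d) : ℝ) : ℂ) * 𝓕 ρ ξ * char ξ x) := by
    filter_upwards [g2] with y hy
    simp only [H]
    rw [integral_mul_const, integral_complex_ofReal, hy, Complex.ofReal_mul]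
    ring
  -- The Gaussian contributes s^{-d/2}, which turns the exponent γ/2 - 1 into -a - 1.
  have e3 : ∀ s ∈ Ioi (0 : ℝ), ∫ y, G y s = ∫ ξ, H s ξ := by
    intro s hs
    have h := integral_gaussian_mul hρ hs x
    simp only [mul_assoc] at h
    simp only [G, H, Complex.ofReal_mul, mul_assoc]
    rw [integral_const_mul, integral_const_mul, h, ← mul_assoc, ← Complex.ofReal_mul,
      ← Real.rpow_add hs]
    congr 3
    rw [ha]
    ring
  have h1 : ((Real.pi ^ (-(γ / 2)) * Real.Gamma (γ / 2) : ℝ) : ℂ) *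
      ∫ y, ((‖x - y‖ ^ (-γ) : ℝ) : ℂ) * ρ y = ((Real.pi ^ (-a) * Real.Gamma a : ℝ) : ℂ) *
      ∫ ξ, ((‖ξ‖ ^ (γ - d) : ℝ) : ℂ) * 𝓕 ρ ξ * char ξ x := by
    rw [← integral_const_mul, ← integral_const_mul, ← integral_congr_ae e1,
      ← integral_congr_ae e2, integral_integral_swap hGi, integral_integral_swap hHi]
    exact setIntegral_congr_fun measurableSet_Ioi e3
  have h2 : ((Real.pi ^ (γ / 2) / Real.Gamma (γ / 2) : ℝ) : ℂ) *
      ((Real.pi ^ (-(γ / 2)) * Real.Gamma (γ / 2) : ℝ) : ℂ) = 1 := by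
    rw [← Complex.ofReal_mul, ← Complex.ofReal_one, Real.rpow_neg hpi.le]
    congr 1
    have := Real.rpow_pos_of_pos hpi (γ / 2)
    field_simp
  rw [← one_mul (∫ y, ((‖x - y‖ ^ (-γ) : ℝ) : ℂ) * ρ y), ← h2, mul_assoc, h1, ← mul_assoc,
    ← Complex.ofReal_mul, ← integral_const_mul]
  refine integral_congr_ae (ae_of_all _ fun ξ => ?_)
  simp only [rieszConst, ← ha]
  push_cast
  ring

/-! ### The Hartree nonlinearity on the Fourier side -/

/-- Near the singularity the kernel is integrable because γ < d, so its convolution with an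
integrable density exists almost everywhere; away from it the kernel is at most 1. -/
theorem ae_integrable_riesz_mul {d : ℕ} {γ : ℝ} (hγ : 0 < γ) (hγd : γ < d) {ρ : Rd d → ℂ}
    (hρ : Integrable ρ volume) :
    ∀ᵐ x, Integrable (fun y => ‖x - y‖ ^ (-γ) * ‖ρ y‖) volume := by
  have hd : 1 ≤ Module.finrank ℝ (Rd d) := by
    have : (0 : ℝ) < d := hγ.trans hγd
    rw [finrank_euclideanSpace_fin]
    exact_mod_cast this
  have hball : IntegrableOn (fun z : Rd d => ‖z‖ ^ (-γ)) (Metric.ball 0 1) volume := by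
    refine integrableOn_ball_of_norm_le_rpow (C := 1) (α := γ) hd ?_ ?_ ?_
    · rwa [finrank_euclideanSpace_fin]
    · refine ae_of_all _ fun x => ?_
      rw [one_mul, Real.norm_of_nonneg (by positivity)]
    · exact (by fun_prop : Measurable fun z : Rd d => ‖z‖ ^ (-γ)).aestronglyMeasurable
  have h := hρ.norm.ae_convolution_exists (ContinuousLinearMap.mul ℝ ℝ)
    ((integrable_indicator_iff Metric.isOpen_ball.measurableSet).2 hball)
  filter_upwards [h] with x hx
  have hx' : Integrable (fun y => ‖ρ y‖ *
      (Metric.ball 0 1).indicator (fun z : Rd d => ‖z‖ ^ (-γ)) (x - y)) volume := hx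
  refine (hx'.add hρ.norm).mono' ?_ (ae_of_all _ fun y => ?_)
  · exact (by fun_prop : Measurable fun y : Rd d => ‖x - y‖ ^ (-γ)).aestronglyMeasurable.mul
      hρ.norm.aestronglyMeasurable
  · rw [Real.norm_of_nonneg (by positivity), Pi.add_apply]
    by_cases hy : x - y ∈ Metric.ball (0 : Rd d) 1
    · rw [indicator_of_mem hy, mul_comm]
      exact le_add_of_nonneg_right (norm_nonneg _)
    · rw [indicator_of_notMem hy, mul_zero, zero_add]
      rw [mem_ball_zero_iff, not_lt] at hy
      exact mul_le_of_le_one_left (norm_nonneg _)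
        (Real.rpow_le_one_of_one_le_of_nonpos hy (by linarith))

theorem integrable_mul_conj {d : ℕ} (f g : L2 d) :
    Integrable (fun x => f x * conj (g x)) volume :=
  (L2.integrable_inner (𝕜 := ℂ) g f).congr (ae_of_all _ fun _ => RCLike.inner_apply _ _)

/-- The bridge between the equation and the Fourier side. Integrability of |ξ|^{γ-d} ρ̂, required by
the Riesz kernel formula, is the L¹ bound on the potential. -/
theorem hartree_ae_eq {d : ℕ} {p : ℝ≥0∞} {γ : ℝ} (hp : 2 < p) (hγ : 0 < γ)
    (hγp : γ < critExp d p) (f g h : L2FL d p) :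
    hartree γ (f.toL2 : Rd d → ℂ) g.toL2 h.toL2 =ᵐ[volume]
      (L2FL.ofFt (Y.conv (pot γ f.ft g.ft) h.ft)).toL2 := by
  have hγd : γ < d := hγp.trans_le critExp_le
  set ρ : Rd d → ℂ := fun x => f.toL2 x * conj (g.toL2 x)
  have hρ : Integrable ρ volume := integrable_mul_conj _ _
  have hpot : ∀ ξ, potFun γ f.ft.1.1 g.ft.1.1 ξ =
      ((rieszConst d γ * ‖ξ‖ ^ (γ - d) : ℝ) : ℂ) * 𝓕 ρ ξ := fun ξ => by
    rw [potFun, L2FL.ft_fst, L2FL.ft_fst, inner_shift_fourier]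
  have hk : Integrable (fun ξ => ‖ξ‖ ^ (γ - d) * ‖𝓕 ρ ξ‖) volume := by
    have hc := rieszConst_pos hγ hγd
    have h1 := (memLp_one_iff_integrable.1 (memLp_potFun hp hγ hγp f.ft g.ft)).norm
    refine (h1.const_mul (rieszConst d γ)⁻¹).congr (ae_of_all _ fun ξ => ?_)
    simp only
    rw [hpot, norm_mul, Complex.norm_of_nonneg (by positivity), mul_assoc,
      inv_mul_cancel_left₀ hc.ne']
  have hm : Measurable ρ := (Lp.stronglyMeasurable f.toL2).measurable.mul
    (Complex.continuous_conj.measurable.comp (Lp.stronglyMeasurable g.toL2).measurable)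
  rw [L2FL.toL2_ofFt]
  filter_upwards [fourierInv_conv hp (pot γ f.ft g.ft) h.ft, ae_integrable_riesz_mul hγ hγd hρ]
    with x h1 h2
  rw [h1, hartree, integral_riesz_mul hγ hγd hm hρ h2 hk, L2FL.ft_fst,
    FourierTransform.fourierInv_fourier_eq, invFourierFun]
  congr 1
  refine integral_congr_ae ?_
  filter_upwards [pot_ae hp hγ hγp f.ft g.ft] with ξ hξ
  rw [hξ, hpot]

/-! ### Semilinear evolution equations with a locally Lipschitz nonlinearity -/

/-- A strongly continuous family of isometries fixing the origin. -/
structure IsIsometricFlow {E : Type*} [NormedAddCommGroup E] (U : ℝ → E → E) : Prop where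
  isometry : ∀ t, Isometry (U t)
  map_zero : ∀ t, U t 0 = 0
  continuous : ∀ x, Continuous fun t => U t x

/-- The nonlinearity in the interaction picture. -/
def interaction {E : Type*} (U : ℝ → E → E) (G : E → E) (t : ℝ) (x : E) : E := U (-t) (G (U t x))

section

variable {E : Type*} [NormedAddCommGroup E] {U : ℝ → E → E} {G : E → E}

theorem IsIsometricFlow.norm_map (hU : IsIsometricFlow U) (t : ℝ) (x : E) : ‖U t x‖ = ‖x‖ := by
  have h := (hU.isometry t).dist_eq x 0
  rwa [hU.map_zero, dist_zero_right, dist_zero_right] at h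

theorem IsIsometricFlow.continuous_uncurry (hU : IsIsometricFlow U) :
    Continuous (Function.uncurry U) :=
  continuous_prod_of_continuous_lipschitzWith' _ 1 (fun t => (hU.isometry t).lipschitz)
    hU.continuous

/-- Lipschitz continuity on each ball around the origin, with a constant depending on the
radius. -/
def LipschitzOnBalls {E : Type*} [NormedAddCommGroup E] (G : E → E) (L : ℝ → NNReal) : Prop :=
  ∀ M, LipschitzOnWith (L M) G (Metric.closedBall 0 M)

theorem LipschitzOnBalls.continuous {L : ℝ → NNReal} (hG : LipschitzOnBalls G L) :
    Continuous G := by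
  rw [continuous_iff_continuousAt]
  intro x
  refine (hG (‖x‖ + 1)).continuousOn.continuousAt ?_
  refine Filter.mem_of_superset (Metric.ball_mem_nhds x one_pos) fun y hy => ?_
  rw [mem_closedBall_zero_iff]
  have := norm_le_norm_add_norm_sub' y x
  rw [mem_ball_iff_norm] at hy
  linarith

/-- The flow is isometric and preserves balls around 0, so passing to the interaction picture costs
nothing and the constant is uniform in time. -/
theorem lipschitzOnWith_interaction (hU : IsIsometricFlow U) {L : ℝ → NNReal}
    (hG : LipschitzOnBalls G L) (t M : ℝ) :
    LipschitzOnWith (L M) (interaction U G t) (Metric.closedBall 0 M) := by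
  refine LipschitzOnWith.of_dist_le_mul fun x hx y hy => ?_
  unfold interaction
  rw [(hU.isometry _).dist_eq]
  refine ((hG M).dist_le_mul _ ?_ _ ?_).trans (by rw [(hU.isometry t).dist_eq])
  · rwa [mem_closedBall_zero_iff, hU.norm_map, ← mem_closedBall_zero_iff]
  · rwa [mem_closedBall_zero_iff, hU.norm_map, ← mem_closedBall_zero_iff]

theorem norm_interaction_le (hU : IsIsometricFlow U) {L : ℝ → NNReal} (hG : LipschitzOnBalls G L)
    (hG0 : G 0 = 0) (t : ℝ) {M : ℝ} {x : E} (hx : ‖x‖ ≤ M) : ‖interaction U G t x‖ ≤ L M * M := by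
  have h := (lipschitzOnWith_interaction hU hG t M).dist_le_mul x (by simpa using hx) 0
    (by simpa using (norm_nonneg x).trans hx)
  have h0 : interaction U G t 0 = 0 := by simp [interaction, hU.map_zero, hG0]
  rw [h0, dist_zero_right, dist_zero_right] at h
  exact h.trans (by gcongr)

theorem continuous_interaction (hU : IsIsometricFlow U) {L : ℝ → NNReal}
    (hG : LipschitzOnBalls G L) :
    Continuous (Function.uncurry (interaction U G)) := by
  have h1 : Continuous fun z : ℝ × E => (-z.1, G (U z.1 z.2)) :=
    (continuous_fst.neg).prodMk (hG.continuous.comp hU.continuous_uncurry)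
  exact hU.continuous_uncurry.comp h1

variable [NormedSpace ℝ E]

/-- `φ` solves the equation in the interaction picture on `[0, τ]`. -/
def IsMildSol (U : ℝ → E → E) (G : E → E) (τ : ℝ) (φ : ℝ → E) : Prop :=
  ∀ t ∈ Icc 0 τ, HasDerivWithinAt φ (interaction U G t (φ t)) (Icc 0 τ) t

theorem IsMildSol.continuousOn {τ : ℝ} {φ : ℝ → E} (h : IsMildSol U G τ φ) :
    ContinuousOn φ (Icc 0 τ) := fun t ht => (h t ht).continuousWithinAt

theorem IsMildSol.hasDerivWithinAt_Ici {τ : ℝ} {φ : ℝ → E} (h : IsMildSol U G τ φ) {t : ℝ}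
    (ht : t ∈ Ico 0 τ) : HasDerivWithinAt φ (interaction U G t (φ t)) (Ici t) t :=
  (h t (Ico_subset_Icc_self ht)).mono_of_mem_nhdsWithin
    (Filter.mem_of_superset (Icc_mem_nhdsGE ht.2) (Icc_subset_Icc_left ht.1))

theorem IsMildSol.mono {τ τ' : ℝ} {φ : ℝ → E} (h : IsMildSol U G τ φ) (hτ : τ' ≤ τ) :
    IsMildSol U G τ' φ := fun t ht =>
  (h t ⟨ht.1, ht.2.trans hτ⟩).mono (Icc_subset_Icc_right hτ)

/-- Picard-Lindelöf on the ball of radius 2M around 0. The lifespan depends on the data only through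
M, and the solution stays in that ball. -/
theorem exists_isMildSol [CompleteSpace E] (hU : IsIsometricFlow U) {L : ℝ → NNReal}
    (hG : LipschitzOnBalls G L) (hG0 : G 0 = 0) {M τ : ℝ} (hM : 0 ≤ M) (hτ : 0 ≤ τ)
    (h : 2 * L (2 * M) * τ ≤ 1) {x : E} (hx : ‖x‖ ≤ M) :
    ∃ φ : ℝ → E, φ 0 = x ∧ IsMildSol U G τ φ ∧ ∀ t ∈ Icc 0 τ, ‖φ t‖ ≤ 2 * M := by
  lift M to NNReal using hM
  have hP : IsPicardLindelof (interaction U G) (tmin := 0) (tmax := τ) ⟨0, le_refl 0, hτ⟩ 0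
      (2 * M) M (L (2 * M) * (2 * M)) (L (2 * M)) := by
    refine ⟨fun t _ => ?_, fun x _ => ?_, fun t _ x hx => ?_, ?_⟩
    · exact_mod_cast lipschitzOnWith_interaction hU hG t (2 * M)
    · exact ((continuous_interaction hU hG).comp
        (by fun_prop : Continuous fun t : ℝ => (t, x))).continuousOn
    · have := norm_interaction_le hU hG hG0 t (M := 2 * M) (x := x) (by simpa using hx)
      exact_mod_cast this
    · simp only [sub_zero, max_eq_left hτ, NNReal.coe_mul, NNReal.coe_ofNat]
      nlinarith [M.coe_nonneg]
  have hx' : x ∈ Metric.closedBall (0 : E) M := by simpa using hx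
  -- The fixed point itself is used, because membership in the function space carries the bound by
  -- 2M.
  obtain ⟨α, hα⟩ := ODE.FunSpace.exists_isFixedPt_next hP hx'
  refine ⟨α.compProj, ?_, fun t ht => ?_, fun t ht => ?_⟩
  · have : α.compProj ((⟨0, le_refl 0, hτ⟩ : Icc (0 : ℝ) τ) : ℝ) = x := by
      rw [ODE.FunSpace.compProj_val, ← hα, ODE.FunSpace.next_apply₀]
    exact this
  · refine (ODE.hasDerivWithinAt_picard_Icc (f := interaction U G) ⟨le_refl 0, hτ⟩
      hP.continuousOn_uncurry α.continuous_compProj.continuousOn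
      (fun _ _ => α.compProj_mem_closedBall hP.mul_max_le) x ht).congr_of_mem ?_ ht
    intro t' ht'
    nth_rw 1 [← hα]
    rw [ODE.FunSpace.compProj_of_mem ht', ODE.FunSpace.next_apply]
  · simpa using α.compProj_mem_closedBall hP.mul_max_le (t := t)

/-- Grönwall's inequality. It yields uniqueness on any interval, by compactness, and Lipschitz
dependence on bounded sets. -/
theorem IsMildSol.dist_le (hU : IsIsometricFlow U) {L : ℝ → NNReal} (hG : LipschitzOnBalls G L)
    {M τ : ℝ} {φ χ : ℝ → E} (hφ : IsMildSol U G τ φ) (hχ : IsMildSol U G τ χ)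
    (hφM : ∀ t ∈ Icc 0 τ, ‖φ t‖ ≤ M) (hχM : ∀ t ∈ Icc 0 τ, ‖χ t‖ ≤ M) {t : ℝ} (ht : t ∈ Icc 0 τ) :
    dist (φ t) (χ t) ≤ dist (φ 0) (χ 0) * Real.exp (L M * t) := by
  have := dist_le_of_trajectories_ODE_of_mem (v := interaction U G) (K := L M)
    (s := fun _ => Metric.closedBall 0 M)
    (fun t _ => lipschitzOnWith_interaction hU hG t M)
    hφ.continuousOn (fun t ht => hφ.hasDerivWithinAt_Ici ht)
    (fun t ht => by simpa using hφM t (Ico_subset_Icc_self ht))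
    hχ.continuousOn (fun t ht => hχ.hasDerivWithinAt_Ici ht)
    (fun t ht => by simpa using hχM t (Ico_subset_Icc_self ht)) le_rfl t ht
  simpa using this

theorem IsMildSol.eqOn (hU : IsIsometricFlow U) {L : ℝ → NNReal} (hG : LipschitzOnBalls G L)
    {τ : ℝ} {φ χ : ℝ → E} (hφ : IsMildSol U G τ φ) (hχ : IsMildSol U G τ χ) (h0 : φ 0 = χ 0) :
    EqOn φ χ (Icc 0 τ) := by
  intro t ht
  obtain ⟨M₁, h₁⟩ := isCompact_Icc.exists_bound_of_continuousOn hφ.continuousOn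
  obtain ⟨M₂, h₂⟩ := isCompact_Icc.exists_bound_of_continuousOn hχ.continuousOn
  have := hφ.dist_le hU hG hχ (M := max M₁ M₂) (fun t ht => (h₁ t ht).trans (le_max_left _ _))
    (fun t ht => (h₂ t ht).trans (le_max_right _ _)) ht
  rw [h0, dist_self, zero_mul] at this
  exact dist_le_zero.1 this

theorem IsMildSol.norm_sub_le (hU : IsIsometricFlow U) {L : ℝ → NNReal}
    (hG : LipschitzOnBalls G L) (hG0 : G 0 = 0) {M τ : ℝ} {φ : ℝ → E} (hφ : IsMildSol U G τ φ)
    (hφM : ∀ t ∈ Icc 0 τ, ‖φ t‖ ≤ M) {t : ℝ} (ht : t ∈ Icc 0 τ) :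
    ‖φ t - φ 0‖ ≤ L M * M * t := by
  have := norm_image_sub_le_of_norm_deriv_le_segment' hφ
    (fun s hs => norm_interaction_le hU hG hG0 s (hφM s (Ico_subset_Icc_self hs))) t ht
  simpa using this

/-- First order expansion of a solution, in a component. -/
theorem IsMildSol.norm_sub_sub_le {F : Type*} [NormedAddCommGroup F] [NormedSpace ℝ F]
    (hU : IsIsometricFlow U) {L : ℝ → NNReal} (hG : LipschitzOnBalls G L) (hG0 : G 0 = 0)
    {M τ θ : ℝ} {φ : ℝ → E} (hφ : IsMildSol U G τ φ) (hφM : ∀ t ∈ Icc 0 τ, ‖φ t‖ ≤ M)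
    (hτ : 0 ≤ τ) (π : E →L[ℝ] F) (hπ : ∀ y, ‖π y‖ ≤ ‖y‖) (v : F)
    (hv : ∀ t ∈ Icc 0 τ, ‖π (interaction U G t (φ 0)) - v‖ ≤ θ) :
    ‖π (φ τ) - π (φ 0) - τ • v‖ ≤ (L M * (L M * M * τ) + θ) * τ := by
  have hd : ∀ t ∈ Icc 0 τ, HasDerivWithinAt (fun t => π (φ t) - t • v)
      (π (interaction U G t (φ t)) - (1 : ℝ) • v) (Icc 0 τ) t := fun t ht =>
    (π.hasFDerivAt.comp_hasDerivWithinAt t (hφ t ht)).sub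
      ((hasDerivWithinAt_id t _).smul_const v)
  have h0 : (0 : ℝ) ∈ Icc 0 τ := ⟨le_rfl, hτ⟩
  -- After subtracting t v the derivative is the change of the vector field along the solution, of
  -- order L · L M τ, plus the deviation θ of the frozen field from v.
  have := norm_image_sub_le_of_norm_deriv_le_segment' hd
    (C := L M * (L M * M * τ) + θ) (fun t ht => ?_) τ ⟨hτ, le_rfl⟩
  · simp only [zero_smul, sub_zero] at this
    rwa [sub_right_comm]
  · have ht' := Ico_subset_Icc_self ht
    have e : π (interaction U G t (φ t)) - (1 : ℝ) • v =
        π (interaction U G t (φ t) - interaction U G t (φ 0)) +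
          (π (interaction U G t (φ 0)) - v) := by
      rw [map_sub, one_smul]; abel
    rw [e]
    refine (norm_add_le _ _).trans (add_le_add ((hπ _).trans ?_) (hv t ht'))
    have h1 := (lipschitzOnWith_interaction hU hG t M).dist_le_mul (φ t)
      (by simpa using hφM t ht') (φ 0) (by simpa using hφM 0 h0)
    rw [dist_eq_norm, dist_eq_norm] at h1
    refine h1.trans (mul_le_mul_of_nonneg_left ?_ (L M).coe_nonneg)
    refine (hφ.norm_sub_le hU hG hG0 hφM ht').trans ?_
    have hM : 0 ≤ M := (norm_nonneg _).trans (hφM 0 h0)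
    have := ht'.2
    gcongr

end

/-! ### Cubic nonlinearities -/

/-- `T` is additive in each argument and bounded by `K`. -/
structure IsTrilinearBounded {A : Type*} [NormedAddCommGroup A] (T : A → A → A → A) (K : ℝ) :
    Prop where
  sub_left : ∀ a a' b c, T (a - a') b c = T a b c - T a' b c
  sub_mid : ∀ a b b' c, T a (b - b') c = T a b c - T a b' c
  sub_right : ∀ a b c c', T a b (c - c') = T a b c - T a b c'
  norm_le : ∀ a b c, ‖T a b c‖ ≤ K * (‖a‖ * ‖b‖ * ‖c‖)

/-- The nonlinearity of the two systems for an arbitrary trilinear map. -/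
def system {A : Type*} [NormedAddCommGroup A] [NormedSpace ℂ A] {N : ℕ} (m : Model) (κ : ℝ)
    (T : A → A → A → A) (z : Fin N → A) (k : Fin N) : A :=
  match m with
  | .hartreeFock => (κ : ℂ) • ∑ l, T (z l) (z l) (z k) - (κ : ℂ) • ∑ l, T (z k) (z l) (z l)
  | .reduced => (κ : ℂ) • ∑ l, T (z l) (z l) (z k)

section

variable {A : Type*} [NormedAddCommGroup A] {T : A → A → A → A} {K : ℝ}

theorem IsTrilinearBounded.norm_sub_le (hT : IsTrilinearBounded T K) (hK : 0 ≤ K) {M D : ℝ}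
    {a b c a' b' c' : A}
    (ha' : ‖a'‖ ≤ M) (hb : ‖b‖ ≤ M) (hb' : ‖b'‖ ≤ M) (hc : ‖c‖ ≤ M)
    (hda : ‖a - a'‖ ≤ D) (hdb : ‖b - b'‖ ≤ D) (hdc : ‖c - c'‖ ≤ D) :
    ‖T a b c - T a' b' c'‖ ≤ 3 * K * M ^ 2 * D := by
  have hM : 0 ≤ M := (norm_nonneg _).trans hb
  have hD : 0 ≤ D := (norm_nonneg _).trans hda
  have e : T a b c - T a' b' c' = T (a - a') b c + T a' (b - b') c + T a' b' (c - c') := by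
    rw [hT.sub_left, hT.sub_mid, hT.sub_right]; abel
  rw [e]
  have h1 := hT.norm_le (a - a') b c
  have h2 := hT.norm_le a' (b - b') c
  have h3 := hT.norm_le a' b' (c - c')
  have i1 : ‖a - a'‖ * ‖b‖ * ‖c‖ ≤ D * M * M := by gcongr
  have i2 : ‖a'‖ * ‖b - b'‖ * ‖c‖ ≤ M * D * M := by gcongr
  have i3 : ‖a'‖ * ‖b'‖ * ‖c - c'‖ ≤ M * M * D := by gcongr
  calc _ ≤ ‖T (a - a') b c‖ + ‖T a' (b - b') c‖ + ‖T a' b' (c - c')‖ := norm_add₃_le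
    _ ≤ K * (D * M * M) + K * (M * D * M) + K * (M * M * D) := by
        gcongr
        · exact h1.trans (by gcongr)
        · exact h2.trans (by gcongr)
        · exact h3.trans (by gcongr)
    _ = 3 * K * M ^ 2 * D := by ring

theorem IsTrilinearBounded.zero_right (hT : IsTrilinearBounded T K) (a b : A) : T a b 0 = 0 := by
  have := hT.sub_right a b 0 0
  simpa using this

theorem isIsometricFlow_pi {U : ℝ → A → A} (hU : IsIsometricFlow U) (N : ℕ) :
    IsIsometricFlow fun t (z : Fin N → A) k => U t (z k) where
  isometry t := Isometry.piMap (fun _ => U t) fun _ => hU.isometry t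
  map_zero t := funext fun _ => hU.map_zero t
  continuous z := continuous_pi fun k => hU.continuous (z k)

variable [NormedSpace ℂ A] {N : ℕ}

/-- The factor 2N counts N direct and N exchange terms; for the reduced system it is generous by a
factor 2. -/
theorem norm_system_sub_le (hT : IsTrilinearBounded T K) (hK : 0 ≤ K) (m : Model) (κ : ℝ) {M : ℝ}
    {z z' : Fin N → A} (hz : ‖z‖ ≤ M) (hz' : ‖z'‖ ≤ M) (k : Fin N) :
    ‖system m κ T z k - system m κ T z' k‖ ≤ |κ| * (2 * N) * (3 * K * M ^ 2) * ‖z - z'‖ := by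
  have hM : 0 ≤ M := (norm_nonneg _).trans hz
  have n1 : ∀ l, ‖z l‖ ≤ M := fun l => (norm_le_pi_norm z l).trans hz
  have n2 : ∀ l, ‖z' l‖ ≤ M := fun l => (norm_le_pi_norm z' l).trans hz'
  have n3 : ∀ l, ‖z l - z' l‖ ≤ ‖z - z'‖ := fun l => norm_le_pi_norm (z - z') l
  set D := 3 * K * M ^ 2 * ‖z - z'‖ with hD
  have hD0 : 0 ≤ D := by positivity
  have s1 : ‖(κ : ℂ) • ∑ l, T (z l) (z l) (z k) - (κ : ℂ) • ∑ l, T (z' l) (z' l) (z' k)‖ ≤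
      |κ| * (N * D) := by
    rw [← smul_sub, ← Finset.sum_sub_distrib, norm_smul, Complex.norm_real, Real.norm_eq_abs]
    gcongr
    refine (norm_sum_le_of_le _ fun l _ => hT.norm_sub_le hK (n2 l) (n1 l) (n2 l) (n1 k)
      (n3 l) (n3 l) (n3 k)).trans (le_of_eq ?_)
    simp [hD]
  have s2 : ‖(κ : ℂ) • ∑ l, T (z k) (z l) (z l) - (κ : ℂ) • ∑ l, T (z' k) (z' l) (z' l)‖ ≤
      |κ| * (N * D) := by
    rw [← smul_sub, ← Finset.sum_sub_distrib, norm_smul, Complex.norm_real, Real.norm_eq_abs]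
    gcongr
    refine (norm_sum_le_of_le _ fun l _ => hT.norm_sub_le hK (n2 k) (n1 l) (n2 l) (n1 l)
      (n3 k) (n3 l) (n3 l)).trans (le_of_eq ?_)
    simp [hD]
  have e : |κ| * (2 * N) * (3 * K * M ^ 2) * ‖z - z'‖ = |κ| * (N * D) + |κ| * (N * D) := by
    rw [hD]; ring
  rw [e]
  cases m with
  | hartreeFock =>
    simp only [system]
    rw [sub_sub_sub_comm]
    exact (norm_sub_le _ _).trans (add_le_add s1 s2)
  | reduced =>
    simp only [system]
    exact s1.trans (le_add_of_nonneg_right (by positivity))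

theorem system_zero (hT : IsTrilinearBounded T K) (m : Model) (κ : ℝ) (k : Fin N) :
    system m κ T (0 : Fin N → A) k = 0 := by
  cases m <;> simp [system, hT.zero_right]

theorem system_map {A' : Type*} [NormedAddCommGroup A'] [NormedSpace ℂ A'] {T' : A' → A' → A' → A'}
    (Φ : A →ₗ[ℂ] A') (h : ∀ a b c, Φ (T a b c) = T' (Φ a) (Φ b) (Φ c)) (m : Model) (κ : ℝ)
    (z : Fin N → A) (k : Fin N) :
    system m κ T' (fun l => Φ (z l)) k = Φ (system m κ T z k) := by
  cases m <;> simp [system, h]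

/-- The right hand side of the evolution equation. -/
def rhs (m : Model) (κ : ℝ) (T : A → A → A → A) (z : Fin N → A) : Fin N → A :=
  fun k => Complex.I • system m κ T z k

/-- The Lipschitz constant of `rhs` on the ball of radius `M`. -/
def lipConst (N : ℕ) (κ K M : ℝ) : NNReal := Real.toNNReal (|κ| * (2 * N) * (3 * K * M ^ 2))

theorem coe_lipConst {κ K M : ℝ} (hK : 0 ≤ K) :
    (lipConst N κ K M : ℝ) = |κ| * (2 * N) * (3 * K * M ^ 2) :=
  Real.coe_toNNReal _ (by positivity)

theorem lipschitzOnBalls_rhs (hT : IsTrilinearBounded T K) (hK : 0 ≤ K) (m : Model) (κ : ℝ) :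
    LipschitzOnBalls (rhs (N := N) m κ T) (lipConst N κ K) := by
  refine fun M => LipschitzOnWith.of_dist_le_mul fun z hz z' hz' => ?_
  rw [mem_closedBall_zero_iff] at hz hz'
  rw [coe_lipConst hK, dist_eq_norm, dist_eq_norm, pi_norm_le_iff_of_nonneg (by positivity)]
  intro k
  simp only [rhs, Pi.sub_apply]
  rw [← smul_sub, norm_smul, Complex.norm_I, one_mul]
  exact norm_system_sub_le hT hK m κ hz hz' k

theorem rhs_zero (hT : IsTrilinearBounded T K) (m : Model) (κ : ℝ) :
    rhs m κ T (0 : Fin N → A) = 0 := by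
  ext k
  simp [rhs, system_zero hT]

end

/-! ### Duhamel's formula and the interaction picture -/

/-- The Hartree nonlinearity on the Fourier side. -/
def tri {d : ℕ} {p : ℝ≥0∞} (γ : ℝ) (a b c : Y d p 1) : Y d p 1 := Y.conv (pot γ a b) c

/-- The evolution of `N` particles on the Fourier side. -/
def flow {d : ℕ} {p : ℝ≥0∞} {N : ℕ} (α t : ℝ) (z : Fin N → Y d p 1) : Fin N → Y d p 1 :=
  fun k => Y.evol α t (z k)

/-- The inverse Fourier transform with values in `L²`. -/
def invL (d : ℕ) (p : ℝ≥0∞) : Y d p 1 →L[ℂ] L2 d :=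
  (FourierTransform.fourierInvCLM ℂ (L2 d)).comp (Y.fstL d p 1)

section

variable {d : ℕ} {p : ℝ≥0∞} {γ : ℝ}

theorem invL_apply (y : Y d p 1) : invL d p y = (L2FL.ofFt y).toL2 := rfl

theorem invL_ft (f : L2FL d p) : invL d p f.ft = f.toL2 := by rw [invL_apply, L2FL.ofFt_ft]

theorem invL_injective : Function.Injective (invL d p) := fun y z h => by
  rw [← L2FL.ft_ofFt y, ← L2FL.ft_ofFt z]
  exact congrArg L2FL.ft (Subtype.ext h)

theorem propagator_invL (α t : ℝ) (y : Y d p 1) :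
    propagator α t (invL d p y) = invL d p (Y.evol α t y) := by
  have h : (𝓕 (invL d p y) : L2 d) = y.1.1 := FourierTransform.fourier_fourierInv_eq y.1.1
  unfold propagator
  refine congrArg (fun f : L2 d => (𝓕⁻ f : L2 d)) (Lp.ext ?_)
  refine (MemLp.coeFn_toLp _).trans ?_
  rw [h]
  exact (mulUnit_ae (measurable_symbol α t) (norm_symbol α t) y.1.1).symm

theorem isIsometricFlow_evol (hp : 2 < p) (α s : ℝ) :
    IsIsometricFlow fun t (y : Y d p s) => Y.evol α t y where
  isometry t := (Y.evol α t).isometry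
  map_zero _ := map_zero _
  continuous y := Y.continuous_evol hp α y

theorem isIsometricFlow_flow (hp : 2 < p) (α : ℝ) (N : ℕ) :
    IsIsometricFlow (flow (d := d) (p := p) (N := N) α) :=
  isIsometricFlow_pi (isIsometricFlow_evol hp α 1) N

theorem flow_add {N : ℕ} (α t t' : ℝ) (z : Fin N → Y d p 1) :
    flow α (t + t') z = flow α t (flow α t' z) := funext fun _ => Y.evol_add _ _ _ _

theorem flow_zero {N : ℕ} (α : ℝ) (z : Fin N → Y d p 1) : flow α 0 z = z :=
  funext fun _ => Y.evol_zero _ _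

theorem flow_flow_neg {N : ℕ} (α t : ℝ) (z : Fin N → Y d p 1) : flow α t (flow α (-t) z) = z := by
  rw [← flow_add, add_neg_cancel, flow_zero]

/-- The splitting radius 1 suffices here, as both norms are controlled. -/
theorem exists_isTrilinearBounded_tri (hp : 2 < p) (hγ : 0 < γ) (hγp : γ < critExp d p) :
    ∃ K, 0 ≤ K ∧ IsTrilinearBounded (tri (d := d) (p := p) γ) K := by
  obtain ⟨C, hC, h⟩ := exists_norm_pot_le hp hγ hγp
  refine ⟨2 * C, by positivity, ⟨fun a a' b c => ?_, fun a b b' c => ?_, fun a b c c' => ?_,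
    fun a b c => ?_⟩⟩
  · rw [tri, pot_sub_left hp hγ hγp, Y.conv_sub_left hp]; rfl
  · rw [tri, pot_sub_right hp hγ hγp, Y.conv_sub_left hp]; rfl
  · exact Y.conv_sub_right hp _ _ _
  · have h1 := h 1 one_pos a b
    rw [Real.one_rpow, Real.one_rpow, one_mul, one_mul] at h1
    calc ‖tri γ a b c‖ ≤ ‖pot γ a b‖ * ‖c‖ := Y.norm_conv_le _ _
      _ ≤ C * (‖a‖ * ‖b‖ + ‖a‖ * ‖b‖) * ‖c‖ := by
          gcongr
          refine h1.trans ?_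
          have := a.norm_fst_le; have := b.norm_fst_le
          have := a.norm_snd_le; have := b.norm_snd_le
          gcongr
      _ = 2 * C * (‖a‖ * ‖b‖ * ‖c‖) := by ring

theorem nonlinearity_ae_eq (hp : 2 < p) (hγ : 0 < γ) (hγp : γ < critExp d p) {N : ℕ} (m : Model)
    (κ : ℝ) (ψ : Fin N → L2FL d p) (k : Fin N) :
    nonlinearity m κ γ (fun l => ((ψ l).toL2 : Rd d → ℂ)) k =ᵐ[volume]
      invL d p (system m κ (tri γ) (fun l => (ψ l).ft) k) := by
  have h1 : ∀ a b c : Fin N → Fin N,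
      (fun x => (κ : ℂ) * ∑ l, hartree γ (ψ (a l)).toL2 (ψ (b l)).toL2 (ψ (c l)).toL2 x)
        =ᵐ[volume] invL d p ((κ : ℂ) • ∑ l, tri γ (ψ (a l)).ft (ψ (b l)).ft (ψ (c l)).ft) := by
    intro a b c
    rw [map_smul, map_sum]
    have h2 : ∀ᵐ x, ∀ l, hartree γ (ψ (a l)).toL2 (ψ (b l)).toL2 (ψ (c l)).toL2 x =
        invL d p (tri γ (ψ (a l)).ft (ψ (b l)).ft (ψ (c l)).ft) x :=
      ae_all_iff.2 fun l => hartree_ae_eq hp hγ hγp (ψ (a l)) (ψ (b l)) (ψ (c l))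
    filter_upwards [h2, Lp.coeFn_smul (κ : ℂ)
      (∑ l, invL d p (tri γ (ψ (a l)).ft (ψ (b l)).ft (ψ (c l)).ft)),
      Lp.coeFn_fun_finsetSum Finset.univ
        fun l => invL d p (tri γ (ψ (a l)).ft (ψ (b l)).ft (ψ (c l)).ft)] with x e1 e2 e3
    rw [e2, Pi.smul_apply, e3, smul_eq_mul]
    simp only [e1]
  cases m with
  | reduced => exact h1 id id fun _ => k
  | hartreeFock =>
    simp only [system]
    rw [map_sub]
    filter_upwards [h1 id id fun _ => k, h1 (fun _ => k) id id, Lp.coeFn_sub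
      (invL d p ((κ : ℂ) • ∑ l, tri γ (ψ l).ft (ψ l).ft (ψ k).ft))
      (invL d p ((κ : ℂ) • ∑ l, tri γ (ψ k).ft (ψ l).ft (ψ l).ft))] with x e1 e2 e3
    rw [e3, Pi.sub_apply]
    exact congrArg₂ (· - ·) e1 e2

/-- The interaction picture of a trajectory. -/
def profile {N : ℕ} {T : ℝ} (hT : 0 ≤ T) (α : ℝ) (ψ : C(Icc (0 : ℝ) T, Fin N → L2FL d p)) (t : ℝ) :
    Fin N → Y d p 1 :=
  flow α (-t) fun k => (ψ (projIcc 0 T hT t) k).ft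

theorem flow_profile {N : ℕ} {T : ℝ} (hT : 0 ≤ T) (α : ℝ)
    (ψ : C(Icc (0 : ℝ) T, Fin N → L2FL d p)) (t : ℝ) :
    flow α t (profile hT α ψ t) = fun k => (ψ (projIcc 0 T hT t) k).ft := flow_flow_neg _ _ _

theorem continuous_profile (hp : 2 < p) {N : ℕ} {T : ℝ} (hT : 0 ≤ T) (α : ℝ)
    (ψ : C(Icc (0 : ℝ) T, Fin N → L2FL d p)) : Continuous (profile hT α ψ) := by
  have h1 : Continuous fun t => fun k => (ψ (projIcc 0 T hT t) k).ft :=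
    continuous_pi fun k => by
      have h0 : Continuous fun t => ψ (projIcc 0 T hT t) := ψ.continuous.comp continuous_projIcc
      exact L2FL.isometry_ft.continuous.comp (continuous_pi_iff.1 h0 k)
  have h2 := (isIsometricFlow_flow (d := d) hp α N).continuous_uncurry.comp
    (continuous_neg.prodMk h1)
  exact h2

/-- The integrand of Duhamel's formula in terms of the interaction picture. -/
theorem smul_propagator_invL {N : ℕ} (m : Model) (κ α t s : ℝ) (z : Fin N → Y d p 1) (k : Fin N) :
    Complex.I • propagator α (t - s) (invL d p (system m κ (tri γ) (flow α s z) k)) =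
      invL d p (Y.evol α t (interaction (flow α) (rhs m κ (tri γ)) s z k)) := by
  rw [propagator_invL, interaction, flow, rhs, ← Y.evol_add, sub_eq_add_neg, map_smul, map_smul]

theorem continuous_interaction_flow (hp : 2 < p) (hγ : 0 < γ) (hγp : γ < critExp d p) {N : ℕ}
    (m : Model) (κ α : ℝ) :
    Continuous (Function.uncurry
      (interaction (flow (N := N) α) (rhs m κ (tri (d := d) (p := p) γ)))) := by
  obtain ⟨K, hK, hT⟩ := exists_isTrilinearBounded_tri hp hγ hγp
  exact continuous_interaction (isIsometricFlow_flow hp α N) (lipschitzOnBalls_rhs hT hK m κ)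

/-- Duhamel's formula holds only in L². Since the integrand is continuous with values in `Y`, its
integral exists there, and injectivity of `invL` upgrades the identity. -/
theorem IsSolution.isMildSol (hp : 2 < p) (hγ : 0 < γ) (hγp : γ < critExp d p) {N : ℕ} {m : Model}
    {κ α T : ℝ} (hT : 0 ≤ T) {ψ₀ : Fin N → L2FL d p} {ψ : C(Icc (0 : ℝ) T, Fin N → L2FL d p)}
    (h : IsSolution m κ γ α ψ₀ ψ) :
    IsMildSol (flow α) (rhs m κ (tri γ)) T (profile hT α ψ) ∧
      profile hT α ψ 0 = fun k => (ψ₀ k).ft := by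
  obtain ⟨F, hF, hψ⟩ := h
  set φ := profile hT α ψ with hφ
  set g : ℝ → Fin N → Y d p 1 := fun s => interaction (flow α) (rhs m κ (tri γ)) s (φ s) with hg
  have hgc : Continuous g := by
    have h := (continuous_interaction_flow (N := N) hp hγ hγp m κ α).comp
      (continuous_id.prodMk (continuous_profile hp hT α ψ))
    exact h
  have hgk : ∀ k, Continuous fun s => g s k := continuous_pi_iff.1 hgc
  have hFs : ∀ k, ∀ s ∈ Icc 0 T, F k s = invL d p (system m κ (tri γ) (flow α s (φ s)) k) := by
    intro k s hs
    refine Lp.ext ((hF k ⟨s, hs⟩).trans ?_)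
    rw [hφ, flow_profile, projIcc_of_mem hT hs]
    exact nonlinearity_ae_eq hp hγ hγp m κ (ψ ⟨s, hs⟩) k
  have key : ∀ k, ∀ t ∈ Icc 0 T, φ t k = (ψ₀ k).ft + ∫ s in (0 : ℝ)..t, g s k := by
    intro k t ht
    have h1 := (hψ k ⟨t, ht⟩).2
    -- The propagator over t - s factors as evolution by -s followed by evolution by t; the latter
    -- is a bounded operator and leaves the integral.
    have h2 : (∫ s in (0 : ℝ)..t, Complex.I • propagator α (t - s) (F k s)) =
        ∫ s in (0 : ℝ)..t, ((invL d p).comp (Y.evol α t).toContinuousLinearMap) (g s k) := by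
      refine intervalIntegral.integral_congr fun s hs => ?_
      rw [uIcc_of_le ht.1] at hs
      rw [hFs k s ⟨hs.1, hs.2.trans ht.2⟩, smul_propagator_invL]
      rfl
    rw [intervalIntegral.integral_smul, ContinuousLinearMap.intervalIntegral_comp_comm _
      ((hgk k).intervalIntegrable _ _)] at h2
    simp only at h1
    rw [h2, ← invL_ft (ψ ⟨t, ht⟩ k), ← invL_ft (ψ₀ k), propagator_invL] at h1
    have h3 : (ψ ⟨t, ht⟩ k).ft = Y.evol α t ((ψ₀ k).ft + ∫ s in (0 : ℝ)..t, g s k) := by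
      refine invL_injective ?_
      rw [h1, map_add, map_add]
      rfl
    have h4 : φ t k = Y.evol α (-t) (ψ ⟨t, ht⟩ k).ft := by
      rw [hφ, profile, projIcc_of_mem hT ht]
      rfl
    rw [h4, h3, ← Y.evol_add, neg_add_cancel, Y.evol_zero]
  refine ⟨fun t ht => ?_, ?_⟩
  · refine hasDerivWithinAt_pi.2 fun k => ?_
    -- The profile is defined for all real times by clamping to [0, T], so g is continuous on the
    -- line and no endpoint needs separate treatment.
    have hd : HasDerivAt (fun t => (ψ₀ k).ft + ∫ s in (0 : ℝ)..t, g s k) (g t k) t :=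
      ((hgk k).integral_hasStrictDerivAt 0 t).hasDerivAt.const_add _
    exact hd.hasDerivWithinAt.congr_of_mem (fun t ht => key k t ht) ht
  · funext k
    rw [key k 0 ⟨le_rfl, hT⟩, intervalIntegral.integral_same, add_zero]

/-- The trajectory with a given interaction picture. -/
def trajectory (hp : 2 < p) {N : ℕ} {τ : ℝ} (α : ℝ) {φ : ℝ → Fin N → Y d p 1}
    (hφ : ContinuousOn φ (Icc 0 τ)) : C(Icc (0 : ℝ) τ, Fin N → L2FL d p) where
  toFun t k := L2FL.ofFt (flow α t (φ t) k)
  continuous_toFun := by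
    have h := (isIsometricFlow_flow (d := d) hp α N).continuous_uncurry.comp
      (continuous_subtype_val.prodMk (continuousOn_iff_continuous_domRestrict.1 hφ))
    exact continuous_pi fun k => L2FL.isometry_ofFt.continuous.comp (continuous_pi_iff.1 h k)

theorem trajectory_apply (hp : 2 < p) {N : ℕ} {τ : ℝ} (α : ℝ) {φ : ℝ → Fin N → Y d p 1}
    (hφ : ContinuousOn φ (Icc 0 τ)) (t : Icc (0 : ℝ) τ) (k : Fin N) :
    trajectory hp α hφ t k = L2FL.ofFt (flow α t (φ t) k) := rfl

theorem IsMildSol.isSolution (hp : 2 < p) (hγ : 0 < γ) (hγp : γ < critExp d p) {N : ℕ} {m : Model}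
    {κ α τ : ℝ} {φ : ℝ → Fin N → Y d p 1} (h : IsMildSol (flow α) (rhs m κ (tri γ)) τ φ) :
    IsSolution m κ γ α (fun k => L2FL.ofFt (φ 0 k)) (trajectory hp α h.continuousOn) := by
  set g : ℝ → Fin N → Y d p 1 := fun s => interaction (flow α) (rhs m κ (tri γ)) s (φ s) with hg
  have hgc : ContinuousOn g (Icc 0 τ) := by
    have h' := (continuous_interaction_flow (N := N) hp hγ hγp m κ α).comp_continuousOn
      (continuousOn_id.prodMk h.continuousOn)
    exact h'
  refine ⟨fun k s => invL d p (system m κ (tri γ) (flow α s (φ s)) k), fun k s => ?_,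
    fun k t => ?_⟩
  · have := nonlinearity_ae_eq hp hγ hγp m κ (trajectory hp α h.continuousOn s) k
    simp only [trajectory_apply, L2FL.ft_ofFt] at this
    exact this.symm
  · obtain ⟨t, ht⟩ := t
    have hsub : uIcc 0 t ⊆ Icc 0 τ := by
      rw [uIcc_of_le ht.1]; exact Icc_subset_Icc_right ht.2
    set Φ := (invL d p).comp (Y.evol (d := d) (p := p) (s := 1) α t).toContinuousLinearMap with hΦ
    have e : ∀ s, propagator α (t - s) (invL d p (system m κ (tri γ) (flow α s (φ s)) k)) =
        -Complex.I • Φ (g s k) := fun s => by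
      have := smul_propagator_invL (γ := γ) m κ α t s (φ s) k
      change _ = Φ (g s k) at this
      rw [← this, smul_smul, neg_mul, Complex.I_mul_I, neg_neg, one_smul]
    have hgk : ContinuousOn (fun s => g s k) (uIcc 0 t) :=
      (continuous_apply k).comp_continuousOn (hgc.mono hsub)
    have hint : ∫ s in (0 : ℝ)..t, g s k = φ t k - φ 0 k := by
      refine intervalIntegral.integral_eq_sub_of_hasDeriv_right
        ((continuous_apply k).comp_continuousOn (h.continuousOn.mono hsub)) (fun s hs => ?_)
        hgk.intervalIntegrable
      rw [min_eq_left ht.1, max_eq_right ht.1] at hs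
      exact (hasDerivWithinAt_pi.1 (h.hasDerivWithinAt_Ici ⟨hs.1.le, hs.2.trans_le ht.2⟩) k).mono
        Ioi_subset_Ici_self
    simp only [e]
    have hΦg : ContinuousOn (fun s => -Complex.I • Φ (g s k)) (uIcc 0 t) :=
      (Φ.continuous.comp_continuousOn hgk).const_smul (-Complex.I)
    refine ⟨hΦg.intervalIntegrable, ?_⟩
    rw [intervalIntegral.integral_smul, Φ.intervalIntegral_comp_comm hgk.intervalIntegrable, hint,
      smul_smul, mul_neg, Complex.I_mul_I, neg_neg, one_smul, map_sub, trajectory_apply,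
      ← invL_apply, ← invL_apply, propagator_invL, hΦ]
    simp only [ContinuousLinearMap.comp_apply]
    exact (add_sub_cancel _ _).symm

theorem IsSolution.unique (hp : 2 < p) (hγ : 0 < γ) (hγp : γ < critExp d p) {N : ℕ} {m : Model}
    {κ α T : ℝ} {ψ₀ : Fin N → L2FL d p} {ψ φ : C(Icc (0 : ℝ) T, Fin N → L2FL d p)}
    (hψ : IsSolution m κ γ α ψ₀ ψ) (hφ : IsSolution m κ γ α ψ₀ φ) : ψ = φ := by
  ext1 ⟨t, ht⟩
  have hT : 0 ≤ T := ht.1.trans ht.2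
  obtain ⟨K, hK, hB⟩ := exists_isTrilinearBounded_tri hp hγ hγp
  obtain ⟨h1, h1'⟩ := hψ.isMildSol hp hγ hγp hT
  obtain ⟨h2, h2'⟩ := hφ.isMildSol hp hγ hγp hT
  have h3 := h1.eqOn (isIsometricFlow_flow hp α N) (lipschitzOnBalls_rhs hB hK m κ) h2
    (h1'.trans h2'.symm) ht
  have h4 := congrArg (flow α t) h3
  rw [flow_profile, flow_profile, projIcc_of_mem hT ht] at h4
  funext k
  exact L2FL.ft_injective (congrFun h4 k)

theorem exists_isSolution (hp : 2 < p) (hγ : 0 < γ) (hγp : γ < critExp d p) {N : ℕ} (m : Model)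
    (κ α : ℝ) {B : Set (Fin N → L2FL d p)} (hB : Bornology.IsBounded B) :
    ∃ T > 0, ∃ S : B → C(Icc (0 : ℝ) T, Fin N → L2FL d p),
      (∀ ψ₀ : B, IsSolution m κ γ α ψ₀.1 (S ψ₀)) ∧ UniformContinuous S := by
  obtain ⟨K, hK, hT⟩ := exists_isTrilinearBounded_tri hp hγ hγp
  obtain ⟨M, hM0, hM⟩ := hB.exists_pos_norm_le
  have hU := isIsometricFlow_flow (d := d) hp α N
  have hL := lipschitzOnBalls_rhs (N := N) hT hK m κ
  set L := lipConst N κ K (2 * M) with hLdef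
  -- The added 1 keeps τ finite when L = 0.
  set τ : ℝ := (2 * L + 1)⁻¹ with hτ
  have hτ0 : 0 < τ := by positivity
  have hsmall : 2 * L * τ ≤ 1 := by
    rw [hτ, ← div_eq_mul_inv, div_le_one (by positivity)]
    linarith
  have hft : ∀ f g : Fin N → L2FL d p,
      dist (fun k => (f k).ft) (fun k => (g k).ft) = dist f g := fun f g => by
    simp only [dist_pi_def, nndist_dist, L2FL.dist_ft]
  have hex : ∀ ψ₀ : B, ∃ φ : ℝ → Fin N → Y d p 1, φ 0 = (fun k => (ψ₀.1 k).ft) ∧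
      IsMildSol (flow α) (rhs m κ (tri γ)) τ φ ∧ ∀ t ∈ Icc 0 τ, ‖φ t‖ ≤ 2 * M := fun ψ₀ => by
    refine exists_isMildSol hU hL (rhs_zero hT m κ) hM0.le hτ0.le hsmall ?_
    have h1 := hft ψ₀.1 0
    simp only [Pi.zero_apply, map_zero] at h1
    have h2 : (fun _ : Fin N => (0 : Y d p 1)) = 0 := rfl
    rw [h2, dist_zero_right, dist_zero_right] at h1
    exact h1.le.trans (hM _ ψ₀.2)
  choose φ hφ0 hφ hφM using hex
  refine ⟨τ, hτ0, fun ψ₀ => trajectory hp α (hφ ψ₀).continuousOn, fun ψ₀ => ?_, ?_⟩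
  · have := (hφ ψ₀).isSolution hp hγ hγp
    rw [hφ0] at this
    simpa only [L2FL.ofFt_ft] using this
  · refine LipschitzWith.uniformContinuous (K := Real.toNNReal (Real.exp (L * τ)))
      (LipschitzWith.of_dist_le_mul fun ψ₀ ψ₁ => ?_)
    rw [Real.coe_toNNReal _ (Real.exp_pos _).le, ContinuousMap.dist_le (by positivity)]
    intro t
    have h1 := (hφ ψ₀).dist_le hU hL (hφ ψ₁) (hφM ψ₀) (hφM ψ₁) t.2
    rw [hφ0, hφ0, hft] at h1
    have h2 : dist (trajectory hp α (hφ ψ₀).continuousOn t)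
        (trajectory hp α (hφ ψ₁).continuousOn t) = dist (φ ψ₀ t) (φ ψ₁ t) := by
      rw [← hft, ← (hU.isometry t).dist_eq (φ ψ₀ t)]
      simp only [trajectory_apply, L2FL.ft_ofFt]
    rw [h2]
    refine h1.trans ?_
    rw [mul_comm]
    have := t.2.2
    gcongr
    exact le_rfl

end

/-! ### Concentrated data -/

/-- The projection of `Y` to `L^{p'}`. -/
def Y.sndL (d : ℕ) (p : ℝ≥0∞) (s : ℝ) : Y d p s →L[ℂ] LpConj d p :=
  LinearMap.mkContinuous
    { toFun := fun y => y.1.2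
      map_add' := fun _ _ => rfl
      map_smul' := fun _ _ => rfl } 1 fun y => by
      rw [one_mul]; exact y.norm_snd_le

/-- Simple functions are dense in L^{p'} and, having support of finite measure, also lie in L². -/
theorem denseRange_sndL {d : ℕ} {p : ℝ≥0∞} (hp : 2 < p) : DenseRange (Y.sndL d p 1) := by
  have hq0 : p.conjExponent ≠ 0 := (zero_lt_one.trans_le (fact_one_le_conjExponent p).out).ne'
  have hq : p.conjExponent ≠ ∞ := ((conjExponent_lt_two hp).trans_le le_top).ne
  refine Metric.denseRange_iff.2 fun f r hr => ?_
  obtain ⟨g, hg, hgq⟩ := (Lp.memLp f).exists_simpleFunc_eLpNorm_sub_lt hq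
    (ENNReal.ofReal_pos.2 hr).ne'
  have hg2 : MemLp g 2 (volume : Measure (Rd d)) :=
    (SimpleFunc.memLp_iff (by simp) (by simp)).2 ((SimpleFunc.memLp_iff hq0 hq).1 hgq)
  refine ⟨⟨(hg2.toLp, hgq.toLp), ?_⟩, ?_⟩
  · rw [mem_weightedInter]
    filter_upwards [hg2.coeFn_toLp, hgq.coeFn_toLp] with x h1 h2
    rw [h1, h2, Complex.ofReal_one, one_mul]
  · change dist f (hgq.toLp) < r
    rw [Lp.dist_def]
    refine ENNReal.toReal_lt_of_lt_ofReal ((eLpNorm_congr_ae ?_).trans_lt hg)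
    filter_upwards [hgq.coeFn_toLp] with x h1
    simp only [Pi.sub_apply, h1]

theorem nontrivial_LpConj {d : ℕ} {p : ℝ≥0∞} (hp : 2 < p) : Nontrivial (LpConj d p) := by
  have hq0 : p.conjExponent ≠ 0 := (zero_lt_one.trans_le (fact_one_le_conjExponent p).out).ne'
  have hq : p.conjExponent ≠ ∞ := ((conjExponent_lt_two hp).trans_le le_top).ne
  refine ⟨indicatorConstLp p.conjExponent (measurableSet_ball (x := (0 : Rd d)) (ε := 1))
    measure_ball_lt_top.ne 1, 0, fun h => ?_⟩
  have h1 := congrArg norm h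
  rw [norm_indicatorConstLp hq0 hq, norm_one, one_mul, norm_zero] at h1
  have h2 : 0 < volume.real (Metric.ball (0 : Rd d) 1) :=
    ENNReal.toReal_pos (Metric.measure_ball_pos _ _ one_pos).ne' measure_ball_lt_top.ne
  exact (Real.rpow_pos_of_pos h2 _).ne' h1

/-- The centre of a ball need not lie in X, and may vanish. The components are made nonzero because
the drift produced by a bump is a multiple of the component it acts on. -/
theorem exists_snd_near {d N : ℕ} {p : ℝ≥0∞} (hp : 2 < p) (c : Fin N → LpConj d p) {r : ℝ}
    (hr : 0 < r) : ∃ g : Fin N → Y d p 1, ∀ k, dist (g k).1.2 (c k) < r ∧ (g k).1.2 ≠ 0 := by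
  have := nontrivial_LpConj (d := d) hp
  have := Module.punctured_nhds_neBot ℂ (LpConj d p) 0
  have h : ∀ k, ∃ y : Y d p 1, Y.sndL d p 1 y ∈ Metric.ball (c k) r ∩ {0}ᶜ := fun k =>
    (denseRange_sndL hp).exists_mem_open (Metric.isOpen_ball.inter isOpen_compl_singleton)
      ((dense_compl_singleton (0 : LpConj d p)).inter_open_nonempty _ Metric.isOpen_ball
        ⟨c k, Metric.mem_ball_self hr⟩)
  choose g hg using h
  exact ⟨g, fun k => hg k⟩

theorem norm_symbol_sub_one_le {d : ℕ} {α : ℝ} (hα : 0 < α) (t : ℝ) {R : ℝ} {ξ : Rd d}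
    (hξ : ‖ξ‖ ≤ R) : ‖symbol α t ξ - 1‖ ≤ (2 * Real.pi) ^ α * R ^ α * |t| := by
  have h : symbol α t ξ =
      Complex.exp (Complex.I * ((-((2 * Real.pi) ^ α * ‖ξ‖ ^ α * t) : ℝ) : ℂ)) := by
    rw [symbol, mul_comm, Complex.ofReal_neg]
  rw [h]
  refine (Real.norm_exp_I_mul_ofReal_sub_one_le).trans ?_
  rw [Real.norm_eq_abs, abs_neg, abs_mul, abs_of_nonneg (by positivity)]
  gcongr

theorem norm_symbolMul_sub_le {d : ℕ} {r : ℝ≥0∞} [Fact (1 ≤ r)] {α : ℝ} (hα : 0 < α) (t : ℝ) {R : ℝ}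
    {f : Lp (α := Rd d) ℂ r volume} (hf : ∀ᵐ ξ, R < ‖ξ‖ → f ξ = 0) :
    ‖symbolMul α t r f - f‖ ≤ (2 * Real.pi) ^ α * R ^ α * |t| * ‖f‖ := by
  refine Lp.norm_le_mul_norm_of_ae_le_mul ?_
  filter_upwards [hf, Lp.coeFn_sub (symbolMul α t r f) f,
    mulUnit_ae (measurable_symbol α t) (norm_symbol α t) f] with ξ h1 h2 h3
  rw [h2, Pi.sub_apply, h3]
  rcases le_or_gt ‖ξ‖ R with h | h
  · have e : symbol α t ξ * f ξ - f ξ = (symbol α t ξ - 1) * f ξ := by ring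
    rw [e, norm_mul]
    exact mul_le_mul_of_nonneg_right (norm_symbol_sub_one_le hα t h) (norm_nonneg _)
  · rw [h1 h]
    simp

/-- The phase is at most (2π)^α R^α |t| on the support, so low frequencies hardly evolve. -/
theorem Y.norm_evol_sub_le {d : ℕ} {p : ℝ≥0∞} {s : ℝ} {α : ℝ} (hα : 0 < α) (t : ℝ) {R : ℝ}
    (hR : 0 ≤ R) {y : Y d p s} (hy : ∀ᵐ ξ, R < ‖ξ‖ → y.1.2 ξ = 0) :
    ‖Y.evol α t y - y‖ ≤ (2 * Real.pi) ^ α * R ^ α * |t| * ‖y‖ := by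
  have hy1 : ∀ᵐ ξ, R < ‖ξ‖ → y.1.1 ξ = 0 := by
    filter_upwards [hy, y.ae_eq] with ξ h1 h2 h
    rw [h2, h1 h, mul_zero]
  refine max_le ((norm_symbolMul_sub_le hα t hy1).trans ?_)
    ((norm_symbolMul_sub_le hα t hy).trans ?_)
  · exact mul_le_mul_of_nonneg_left y.norm_fst_le (by positivity)
  · exact mul_le_mul_of_nonneg_left y.norm_snd_le (by positivity)

/-- The exponent of the amplitude for which balls have normalized indicators in `L^{p'}`. -/
def ampExp (d : ℕ) (p : ℝ≥0∞) : ℝ := d * (1 - (p⁻¹).toReal)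

/-- A multiple of the indicator function of a ball around the origin. -/
def ballInd (d : ℕ) (r : ℝ≥0∞) (R : ℝ) (c : ℂ) : Lp (α := Rd d) ℂ r volume :=
  indicatorConstLp r (measurableSet_ball (x := (0 : Rd d)) (ε := R)) measure_ball_lt_top.ne c

theorem ballInd_ae (d : ℕ) (r : ℝ≥0∞) (R : ℝ) (c : ℂ) :
    ballInd d r R c =ᵐ[volume] (Metric.ball (0 : Rd d) R).indicator fun _ => c :=
  indicatorConstLp_coeFn

theorem norm_ballInd (d : ℕ) {r : ℝ≥0∞} (h0 : r ≠ 0) (h : r ≠ ∞) (R : ℝ) (c : ℂ) :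
    ‖ballInd d r R c‖ = ‖c‖ * volume.real (Metric.ball (0 : Rd d) R) ^ r.toReal⁻¹ := by
  rw [← one_div]
  exact norm_indicatorConstLp h0 h

/-- The indicator function of a ball, normalized in `L^{p'}`, as an element of `Y`. -/
def bump (d : ℕ) (p : ℝ≥0∞) (R : ℝ) : Y d p (R ^ (critExp d p / 2)) :=
  ⟨(ballInd d 2 R ((R ^ (critExp d p / 2) * R ^ (-ampExp d p) : ℝ) : ℂ),
    ballInd d p.conjExponent R ((R ^ (-ampExp d p) : ℝ) : ℂ)), by
    rw [mem_weightedInter]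
    filter_upwards [ballInd_ae d 2 R ((R ^ (critExp d p / 2) * R ^ (-ampExp d p) : ℝ) : ℂ),
      ballInd_ae d p.conjExponent R ((R ^ (-ampExp d p) : ℝ) : ℂ)] with ξ h h'
    rw [h, h']
    by_cases hξ : ξ ∈ Metric.ball (0 : Rd d) R <;> simp [hξ]⟩

theorem bump_snd_ae (d : ℕ) (p : ℝ≥0∞) (R : ℝ) : (bump d p R).1.2 =ᵐ[volume]
    (Metric.ball (0 : Rd d) R).indicator fun _ => ((R ^ (-ampExp d p) : ℝ) : ℂ) :=
  ballInd_ae d _ R _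

theorem incl_bump_fst_ae (d : ℕ) (p : ℝ≥0∞) {R : ℝ} (hs : R ^ (critExp d p / 2) ≠ 0) :
    (Y.incl hs (bump d p R)).1.1 =ᵐ[volume]
    (Metric.ball (0 : Rd d) R).indicator fun _ => ((R ^ (-ampExp d p) : ℝ) : ℂ) :=
  (Y.ae_eq_one _).trans (bump_snd_ae d p R)

theorem measureReal_ball {d : ℕ} (x : Rd d) {R : ℝ} (hR : 0 < R) :
    volume.real (Metric.ball x R) = R ^ (d : ℝ) * volume.real (Metric.ball (0 : Rd d) 1) := by
  rw [measureReal_def, Measure.addHaar_ball_of_pos _ _ hR, ENNReal.toReal_mul,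
    ENNReal.toReal_ofReal (by positivity), finrank_euclideanSpace_fin, Real.rpow_natCast,
    measureReal_def]

theorem measureReal_ball_one_pos (d : ℕ) : 0 < volume.real (Metric.ball (0 : Rd d) 1) :=
  ENNReal.toReal_pos (Metric.measure_ball_pos _ _ one_pos).ne' measure_ball_lt_top.ne

/-- The point is that the value does not depend on R: the weight R^{b/2} compensates the growth of
the L² norm exactly. -/
theorem norm_bump {d : ℕ} {p : ℝ≥0∞} (hp : 2 < p) {R : ℝ} (hR : 0 < R) : ‖bump d p R‖ =
    max (volume.real (Metric.ball (0 : Rd d) 1) ^ (1 / 2 : ℝ))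
      (volume.real (Metric.ball (0 : Rd d) 1) ^ (1 - (p⁻¹).toReal)) := by
  have hq0 : p.conjExponent ≠ 0 := (zero_lt_one.trans_le (fact_one_le_conjExponent p).out).ne'
  have hq : p.conjExponent ≠ ∞ := ((conjExponent_lt_two hp).trans_le le_top).ne
  have hω := measureReal_ball_one_pos d
  have h1 : ‖(bump d p R).1.1‖ = volume.real (Metric.ball (0 : Rd d) 1) ^ (1 / 2 : ℝ) := by
    refine (norm_ballInd d (by simp) (by simp) R _).trans ?_
    rw [measureReal_ball _ hR, Complex.norm_of_nonneg (by positivity),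
      Real.mul_rpow (by positivity) hω.le,
      ← Real.rpow_mul hR.le, ← mul_assoc, ← Real.rpow_add hR, ← Real.rpow_add hR]
    have e : critExp d p / 2 + -ampExp d p + d * (ENNReal.toReal 2)⁻¹ = 0 := by
      simp only [critExp, ampExp, ENNReal.toReal_ofNat]
      ring
    rw [e, Real.rpow_zero, one_mul, ENNReal.toReal_ofNat, one_div]
  have h2 : ‖(bump d p R).1.2‖ =
      volume.real (Metric.ball (0 : Rd d) 1) ^ (1 - (p⁻¹).toReal) := by
    refine (norm_ballInd d hq0 hq R _).trans ?_
    rw [measureReal_ball _ hR, Complex.norm_of_nonneg (by positivity),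
      conjExponent_toReal_inv hp, Real.mul_rpow (by positivity) hω.le,
      ← Real.rpow_mul hR.le, ← mul_assoc, ← Real.rpow_add hR, ampExp, neg_add_cancel,
      Real.rpow_zero, one_mul]
  rw [Y.norm_def, h1, h2]

theorem inner_shift_indicator {d : ℕ} {f : L2 d} {R a : ℝ}
    (hf : f =ᵐ[volume] (Metric.ball (0 : Rd d) R).indicator fun _ => (a : ℂ)) (ξ : Rd d) :
    (inner ℂ (shift 2 ξ f) f : ℂ) =
      ((a ^ 2 * volume.real (Metric.ball ξ R ∩ Metric.ball 0 R) : ℝ) : ℂ) := by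
  rw [L2.inner_def]
  have h : (fun x => (inner ℂ (shift 2 ξ f x) (f x) : ℂ)) =ᵐ[volume]
      (Metric.ball ξ R ∩ Metric.ball 0 R).indicator fun _ => ((a ^ 2 : ℝ) : ℂ) := by
    filter_upwards [hf, shift_ae ξ f,
      (measurePreserving_sub_right volume ξ).quasiMeasurePreserving.ae hf] with x h1 h2 h3
    rw [h2, h3, h1, RCLike.inner_apply]
    have e : x - ξ ∈ Metric.ball (0 : Rd d) R ↔ x ∈ Metric.ball ξ R := by
      simp [dist_eq_norm]
    by_cases h4 : x ∈ Metric.ball ξ R <;> by_cases h5 : x ∈ Metric.ball (0 : Rd d) R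
    · rw [indicator_of_mem h5, indicator_of_mem (e.2 h4), indicator_of_mem (mem_inter h4 h5)]
      simp [sq]
    · rw [indicator_of_notMem h5, zero_mul, indicator_of_notMem fun h => h5 h.2]
    · rw [indicator_of_notMem (mt e.1 h4), map_zero, mul_zero,
        indicator_of_notMem fun h => h4 h.1]
    · rw [indicator_of_notMem h5, zero_mul, indicator_of_notMem fun h => h5 h.2]
  rw [integral_congr_ae h, integral_indicator (measurableSet_ball.inter measurableSet_ball),
    setIntegral_const, Complex.real_smul, mul_comm, ← Complex.ofReal_mul]

section

variable {d : ℕ} {p : ℝ≥0∞} {γ : ℝ} {R : ℝ}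

theorem potFun_indicator {f : L2 d} {a : ℝ}
    (hf : f =ᵐ[volume] (Metric.ball (0 : Rd d) R).indicator fun _ => (a : ℂ)) (ξ : Rd d) :
    potFun γ f f ξ = ((rieszConst d γ * ‖ξ‖ ^ (γ - d) *
      (a ^ 2 * volume.real (Metric.ball ξ R ∩ Metric.ball 0 R)) : ℝ) : ℂ) := by
  rw [potFun, inner_shift_indicator hf, ← Complex.ofReal_mul]

theorem potFun_indicator_eq_zero {f : L2 d} {a : ℝ}
    (hf : f =ᵐ[volume] (Metric.ball (0 : Rd d) R).indicator fun _ => (a : ℂ)) {ξ : Rd d}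
    (hξ : 2 * R < ‖ξ‖) : potFun γ f f ξ = 0 := by
  have h : Metric.ball ξ R ∩ Metric.ball 0 R = ∅ := by
    refine disjoint_iff_inter_eq_empty.1 (Metric.ball_disjoint_ball ?_)
    rw [dist_zero_right]; linarith
  rw [potFun_indicator hf, h]
  simp

/-- For |ξ| < R the intersection of the two balls contains the ball of radius R/2 around ξ/2, and
|ξ|^{γ-d} ≥ R^{γ-d}. -/
theorem le_potFun_indicator_re (hγ : 0 < γ) (hγd : γ < d) (hR : 0 < R) {f : L2 d} {a : ℝ}
    (hf : f =ᵐ[volume] (Metric.ball (0 : Rd d) R).indicator fun _ => (a : ℂ)) {ξ : Rd d}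
    (hξ : ξ ∈ Metric.ball (0 : Rd d) R) (h0 : ξ ≠ 0) :
    rieszConst d γ * R ^ (γ - d) *
      (a ^ 2 * ((R / 2) ^ (d : ℝ) * volume.real (Metric.ball (0 : Rd d) 1))) ≤
      (potFun γ f f ξ).re := by
  rw [potFun_indicator hf, Complex.ofReal_re, ← measureReal_ball ((1 / 2 : ℝ) • ξ) (by positivity)]
  have hc := (rieszConst_pos hγ hγd).le
  rw [mem_ball_zero_iff] at hξ
  have h1 : R ^ (γ - d) ≤ ‖ξ‖ ^ (γ - d) :=
    Real.rpow_le_rpow_of_nonpos (norm_pos_iff.2 h0) hξ.le (by linarith)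
  have hn : ‖(1 / 2 : ℝ) • ξ‖ = ‖ξ‖ / 2 := by
    rw [norm_smul, Real.norm_of_nonneg (by norm_num)]; ring
  have hn' : ‖(1 / 2 : ℝ) • ξ - ξ‖ = ‖ξ‖ / 2 := by
    have : (1 / 2 : ℝ) • ξ - ξ = -((1 / 2 : ℝ) • ξ) := by
      module
    rw [this, norm_neg, hn]
  have h2 : volume.real (Metric.ball ((1 / 2 : ℝ) • ξ) (R / 2)) ≤
      volume.real (Metric.ball ξ R ∩ Metric.ball 0 R) := by
    refine measureReal_mono
      (subset_inter (Metric.ball_subset_ball' ?_) (Metric.ball_subset_ball' ?_))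
      (measure_ne_top_of_subset inter_subset_right measure_ball_lt_top.ne)
    · rw [dist_eq_norm, hn']; linarith
    · rw [dist_zero_right, hn]; linarith
  gcongr

theorem pot_bump_eq_zero (hp : 2 < p) (hγ : 0 < γ) (hγp : γ < critExp d p)
    (hs : R ^ (critExp d p / 2) ≠ 0) :
    ∀ᵐ ξ, 2 * R < ‖ξ‖ → pot γ (Y.incl hs (bump d p R)) (Y.incl hs (bump d p R)) ξ = 0 := by
  filter_upwards [pot_ae hp hγ hγp (Y.incl hs (bump d p R)) (Y.incl hs (bump d p R))] with ξ h hξ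
  rw [h]
  exact potFun_indicator_eq_zero (incl_bump_fst_ae d p hs) hξ

/-- The potential of a bump is nonnegative almost everywhere, so there is no cancellation and its
integral is at least the pointwise lower bound times the volume of the ball of radius R. -/
theorem exists_le_norm_integral_pot_bump (hp : 2 < p) (hγ : 0 < γ) (hγp : γ < critExp d p) :
    ∃ c > 0, ∀ R > 0, ∀ hs : R ^ (critExp d p / 2) ≠ 0, c * R ^ (γ - critExp d p) ≤
      ‖∫ ξ, pot γ (Y.incl hs (bump d p R)) (Y.incl hs (bump d p R)) ξ‖ := by
  have hγd : γ < d := hγp.trans_le critExp_le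
  have hd : 0 < d := Nat.cast_pos.1 (hγ.trans hγd)
  have hc := rieszConst_pos hγ hγd
  set ω := volume.real (Metric.ball (0 : Rd d) 1) with hω
  have hω0 : 0 < ω := measureReal_ball_one_pos d
  refine ⟨rieszConst d γ * ω ^ 2 * (1 / 2) ^ (d : ℝ), by positivity, fun R hR hs => ?_⟩
  set f := Y.incl hs (bump d p R)
  set a := R ^ (-ampExp d p) with ha
  have hf := incl_bump_fst_ae d p hs
  set P := potFun γ f.1.1 f.1.1
  have hP : Integrable P := memLp_one_iff_integrable.1 (memLp_potFun hp hγ hγp f f)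
  rw [integral_congr_ae (pot_ae hp hγ hγp f f)]
  refine le_trans ?_ (Complex.re_le_norm _)
  have hre : (∫ ξ, P ξ).re = ∫ ξ, (P ξ).re := (integral_re hP).symm
  rw [hre]
  set m := rieszConst d γ * R ^ (γ - d) * (a ^ 2 * ((R / 2) ^ (d : ℝ) * ω)) with hm
  have h1 : ∀ᵐ ξ, (Metric.ball (0 : Rd d) R).indicator (fun _ => m) ξ ≤ (P ξ).re := by
    have : Nonempty (Fin d) := ⟨⟨0, hd⟩⟩
    filter_upwards [Measure.ae_ne volume (0 : Rd d)] with ξ h0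
    by_cases hξ : ξ ∈ Metric.ball (0 : Rd d) R
    · rw [indicator_of_mem hξ]
      exact le_potFun_indicator_re hγ hγd hR hf hξ h0
    · rw [indicator_of_notMem hξ]
      change 0 ≤ (potFun γ f.1.1 f.1.1 ξ).re
      rw [potFun_indicator hf, Complex.ofReal_re]
      positivity
  have h2 : ∫ ξ, (Metric.ball (0 : Rd d) R).indicator (fun _ => m) ξ = R ^ (d : ℝ) * ω * m := by
    rw [integral_indicator measurableSet_ball, setIntegral_const, measureReal_ball _ hR,
      smul_eq_mul]
  have h3 := integral_mono_ae ((integrable_indicator_iff measurableSet_ball).2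
    (integrableOn_const measure_ball_lt_top.ne)) hP.re h1
  rw [h2] at h3
  refine le_trans (le_of_eq ?_) h3
  rw [hm, ha, div_eq_mul_inv R 2, Real.mul_rpow hR.le (by norm_num), ← Real.rpow_natCast (_ ^ _) 2,
    ← Real.rpow_mul hR.le, one_div]
  have e : R ^ (γ - critExp d p) =
      R ^ (d : ℝ) * R ^ (γ - d) * R ^ (-ampExp d p * (2 : ℕ)) * R ^ (d : ℝ) := by
    rw [← Real.rpow_add hR, ← Real.rpow_add hR, ← Real.rpow_add hR]
    congr 1
    simp only [critExp, ampExp, Nat.cast_ofNat]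
    ring
  rw [e]
  ring

theorem Y.conv_sub_integral_smul {s : ℝ} (hp : 2 < p) (K : L1 d) (h : Y d p s) :
    conv K h - (∫ η, K η) • h = ∫ η, K η • (shift η h - h) := by
  have hK : Integrable K := L1.integrable_coeFn K
  rw [conv, ← integral_smul_const, ← integral_sub (integrable_smul_shift hp K h) (hK.smul_const h)]
  simp only [smul_sub]

/-- A kernel supported in a small ball acts almost as the scalar ∫ K, with an error governed by the
modulus of continuity of translations of h. -/
theorem Y.norm_conv_sub_le {s r ε : ℝ} (hp : 2 < p) {K : L1 d}
    (hK : ∀ᵐ ξ, r < ‖ξ‖ → K ξ = 0) {h : Y d p s}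
    (hε : ∀ η : Rd d, ‖η‖ ≤ r → ‖shift η h - h‖ ≤ ε) :
    ‖conv K h - (∫ η, K η) • h‖ ≤ ‖K‖ * ε := by
  rw [conv_sub_integral_smul hp, L1.norm_eq_integral_norm, ← integral_mul_const]
  refine norm_integral_le_of_norm_le ((L1.integrable_coeFn K).norm.mul_const ε) ?_
  filter_upwards [hK] with η hη
  rw [norm_smul]
  rcases le_or_gt ‖η‖ r with h1 | h1
  · exact mul_le_mul_of_nonneg_left (hε η h1) (norm_nonneg _)
  · rw [hη h1]; simp

end

/-! ### Splitting off a concentrated component -/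

theorem IsIsometricFlow.prod {E F : Type*} [NormedAddCommGroup E] [NormedAddCommGroup F]
    {U : ℝ → E → E} {V : ℝ → F → F} (hU : IsIsometricFlow U) (hV : IsIsometricFlow V) :
    IsIsometricFlow fun t (z : E × F) => (U t z.1, V t z.2) where
  isometry t := (hU.isometry t).prodMap (hV.isometry t)
  map_zero t := Prod.ext (hU.map_zero t) (hV.map_zero t)
  continuous z := (hU.continuous z.1).prodMk (hV.continuous z.2)

theorem IsMildSol.map {E F : Type*} [NormedAddCommGroup E] [NormedSpace ℝ E]
    [NormedAddCommGroup F] [NormedSpace ℝ F] {U : ℝ → E → E} {V : ℝ → F → F} {G : E → E} {H : F → F}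
    {τ : ℝ} {φ : ℝ → E} (h : IsMildSol U G τ φ) (Ψ : E →L[ℝ] F) (hU : ∀ t x, Ψ (U t x) = V t (Ψ x))
    (hG : ∀ x, Ψ (G x) = H (Ψ x)) : IsMildSol V H τ fun t => Ψ (φ t) := fun t ht => by
  have h1 := Ψ.hasFDerivAt.comp_hasDerivWithinAt t (h t ht)
  rw [interaction, hU, hG, hU] at h1
  exact h1

/-- `C` is a constant for the estimate of the potential. -/
def IsPotBound (d : ℕ) (p : ℝ≥0∞) (γ C : ℝ) : Prop :=
  ∀ R > 0, ∀ f g : Y d p 1, ‖pot γ f g‖ ≤ C * (R ^ γ * (‖f.1.1‖ * ‖g.1.1‖) +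
      R ^ (γ - critExp d p) * (‖f.1.2‖ * ‖g.1.2‖))

/-- The inclusion of the weighted space in which a `bump` of radius `R` lies. -/
def inc {d : ℕ} {p : ℝ≥0∞} {R : ℝ} (hR : 0 < R) : Y d p (R ^ (critExp d p / 2)) →L[ℂ] Y d p 1 :=
  Y.incl (Real.rpow_pos_of_pos hR _).ne'

/-- The growth of a mixed interaction as the radius of the bump shrinks. -/
def growth (d : ℕ) (p : ℝ≥0∞) (γ R : ℝ) : ℝ := R ^ ((γ - critExp d p) / 2)

theorem growth_pos {d : ℕ} {p : ℝ≥0∞} {γ R : ℝ} (hR : 0 < R) : 0 < growth d p γ R :=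
  Real.rpow_pos_of_pos hR _

theorem growth_sq {d : ℕ} {p : ℝ≥0∞} {γ R : ℝ} (hR : 0 < R) :
    growth d p γ R ^ 2 = R ^ (γ - critExp d p) := by
  rw [growth, ← Real.rpow_natCast, ← Real.rpow_mul hR.le]
  congr 1
  push_cast
  ring

section

variable {d : ℕ} {p : ℝ≥0∞} {γ C R : ℝ}

theorem IsPotBound.norm_pot_le (hC : IsPotBound d p γ C) (hC0 : 0 ≤ C) {r A B x y K : ℝ}
    (hr : 0 < r) {f g : Y d p 1} (hf : ‖f.1.1‖ ≤ x * A) (hf' : ‖f.1.2‖ ≤ A) (hg : ‖g.1.1‖ ≤ y * B)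
    (hg' : ‖g.1.2‖ ≤ B) (h1 : r ^ γ * (x * y) ≤ K) (h2 : r ^ (γ - critExp d p) ≤ K) :
    ‖pot γ f g‖ ≤ 2 * C * K * (A * B) := by
  have hA : 0 ≤ A := (norm_nonneg _).trans hf'
  have hB : 0 ≤ B := (norm_nonneg _).trans hg'
  have hxA : 0 ≤ x * A := (norm_nonneg _).trans hf
  have hK : 0 ≤ K := (Real.rpow_nonneg hr.le _).trans h2
  calc ‖pot γ f g‖ ≤ C * (r ^ γ * (‖f.1.1‖ * ‖g.1.1‖) +
        r ^ (γ - critExp d p) * (‖f.1.2‖ * ‖g.1.2‖)) := hC r hr f g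
    _ ≤ C * (r ^ γ * ((x * A) * (y * B)) + K * (A * B)) := by gcongr
    _ = C * (r ^ γ * (x * y) * (A * B) + K * (A * B)) := by ring
    _ ≤ C * (K * (A * B) + K * (A * B)) := by gcongr
    _ = 2 * C * K * (A * B) := by ring

theorem IsPotBound.norm_pot (hC : IsPotBound d p γ C) (hC0 : 0 ≤ C) (f g : Y d p 1) :
    ‖pot γ f g‖ ≤ 2 * C * (‖f‖ * ‖g‖) := by
  have := hC.norm_pot_le hC0 one_pos (x := 1) (y := 1) (K := 1) (A := ‖f‖) (B := ‖g‖)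
    (by rw [one_mul]; exact f.norm_fst_le) f.norm_snd_le (by rw [one_mul]; exact g.norm_fst_le)
    g.norm_snd_le (by simp) (by simp)
  rwa [mul_one] at this

theorem norm_inc_fst_le (hR : 0 < R) (w : Y d p (R ^ (critExp d p / 2))) :
    ‖(inc hR w).1.1‖ ≤ R ^ (-critExp d p / 2) * ‖w‖ := by
  have := Y.norm_incl_fst_le (Real.rpow_pos_of_pos hR (critExp d p / 2)) w
  rwa [← Real.rpow_neg hR.le, ← neg_div] at this

theorem norm_inc_snd_le (hR : 0 < R) (w : Y d p (R ^ (critExp d p / 2))) :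
    ‖(inc hR w).1.2‖ ≤ ‖w‖ := w.norm_snd_le

/-- The splitting radius R^{1/2} balances the two terms: with L² sizes 1 and R^{-b/2}, both become
R^{(γ-b)/2}. -/
theorem IsPotBound.norm_pot_inc_right (hC : IsPotBound d p γ C) (hC0 : 0 ≤ C) (hR : 0 < R)
    (f : Y d p 1) (w : Y d p (R ^ (critExp d p / 2))) :
    ‖pot γ f (inc hR w)‖ ≤ 2 * C * growth d p γ R * (‖f‖ * ‖w‖) := by
  have hr : 0 < R ^ (1 / 2 : ℝ) := by positivity
  refine hC.norm_pot_le hC0 hr (x := 1) (by rw [one_mul]; exact f.norm_fst_le) f.norm_snd_le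
    (norm_inc_fst_le hR w) (norm_inc_snd_le hR w) ?_ ?_
  · rw [one_mul, ← Real.rpow_mul hR.le, ← Real.rpow_add hR, growth]
    exact le_of_eq (congrArg _ (by ring))
  · rw [← Real.rpow_mul hR.le, growth]
    exact le_of_eq (congrArg _ (by ring))

theorem IsPotBound.norm_pot_inc_left (hC : IsPotBound d p γ C) (hC0 : 0 ≤ C) (hR : 0 < R)
    (f : Y d p 1) (w : Y d p (R ^ (critExp d p / 2))) :
    ‖pot γ (inc hR w) f‖ ≤ 2 * C * growth d p γ R * (‖w‖ * ‖f‖) := by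
  have hr : 0 < R ^ (1 / 2 : ℝ) := by positivity
  refine hC.norm_pot_le hC0 hr (y := 1) (norm_inc_fst_le hR w) (norm_inc_snd_le hR w)
    (by rw [one_mul]; exact f.norm_fst_le) f.norm_snd_le ?_ ?_
  · rw [mul_one, ← Real.rpow_mul hR.le, ← Real.rpow_add hR, growth]
    exact le_of_eq (congrArg _ (by ring))
  · rw [← Real.rpow_mul hR.le, growth]
    exact le_of_eq (congrArg _ (by ring))

/-- For two concentrated factors the balancing radius is R itself. -/
theorem IsPotBound.norm_pot_inc_inc (hC : IsPotBound d p γ C) (hC0 : 0 ≤ C) (hR : 0 < R)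
    (w w' : Y d p (R ^ (critExp d p / 2))) :
    ‖pot γ (inc hR w) (inc hR w')‖ ≤ 2 * C * growth d p γ R ^ 2 * (‖w‖ * ‖w'‖) := by
  refine hC.norm_pot_le hC0 hR (norm_inc_fst_le hR w) (norm_inc_snd_le hR w)
    (norm_inc_fst_le hR w') (norm_inc_snd_le hR w') ?_ (growth_sq hR).ge
  rw [growth_sq hR, ← Real.rpow_add hR, ← Real.rpow_add hR]
  exact le_of_eq (congrArg _ (by ring))

/-- A pair consisting of a regular part and a concentrated part. -/
abbrev Split (d : ℕ) (p : ℝ≥0∞) (R : ℝ) : Type := Y d p 1 × Y d p (R ^ (critExp d p / 2))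

/-- The function represented by a pair. -/
def merge (hR : 0 < R) (δ : ℝ) : Split d p R →L[ℂ] Y d p 1 :=
  ContinuousLinearMap.fst ℂ _ _ + (δ : ℂ) • (inc hR).comp (ContinuousLinearMap.snd ℂ _ _)

theorem merge_apply (hR : 0 < R) (δ : ℝ) (a : Split d p R) :
    merge hR δ a = a.1 + (δ : ℂ) • inc hR a.2 := rfl

/-- The nonlinearity acting on pairs. -/
def splitTri (γ : ℝ) (hR : 0 < R) (δ : ℝ) (a b c : Split d p R) : Split d p R :=
  (Y.conv (pot γ (merge hR δ a) (merge hR δ b)) c.1,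
    Y.conv (pot γ (merge hR δ a) (merge hR δ b)) c.2)

/-- The evolution of pairs. -/
def splitFlow {N : ℕ} (α t : ℝ) (z : Fin N → Split d p R) : Fin N → Split d p R :=
  fun k => (Y.evol α t (z k).1, Y.evol α t (z k).2)

theorem isIsometricFlow_splitFlow (hp : 2 < p) (α : ℝ) (N : ℕ) :
    IsIsometricFlow (splitFlow (d := d) (p := p) (R := R) (N := N) α) :=
  isIsometricFlow_pi ((isIsometricFlow_evol hp α _).prod (isIsometricFlow_evol hp α _)) N

theorem merge_evol (hR : 0 < R) (δ α t : ℝ) (a : Split d p R) :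
    merge hR δ (Y.evol α t a.1, Y.evol α t a.2) = Y.evol α t (merge hR δ a) := by
  rw [merge_apply, merge_apply, map_add, map_smul]
  simp only [inc, Y.incl_evol]

/-- The potential is formed from the merged functions and applied to the two parts of the last
factor separately, which is consistent because the nonlinearity is linear in that factor. -/
theorem merge_splitTri (hp : 2 < p) (hR : 0 < R) (δ : ℝ) (a b c : Split d p R) :
    merge hR δ (splitTri γ hR δ a b c) = tri γ (merge hR δ a) (merge hR δ b) (merge hR δ c) := by
  rw [tri, merge_apply hR δ c, Y.conv_add_right hp, Y.conv_smul_right, merge_apply]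
  simp only [splitTri, inc, Y.incl_conv hp]

section

variable (hp : 2 < p) (hγ : 0 < γ) (hγp : γ < critExp d p)

include hp hγ hγp

theorem pot_merge (hR : 0 < R) (δ : ℝ) (a b : Split d p R) :
    pot γ (merge hR δ a) (merge hR δ b) = pot γ a.1 b.1 + (δ : ℂ) • pot γ a.1 (inc hR b.2) +
      (δ : ℂ) • pot γ (inc hR a.2) b.1 + ((δ ^ 2 : ℝ) : ℂ) • pot γ (inc hR a.2) (inc hR b.2) := by
  rw [merge_apply, merge_apply, pot_add_left hp hγ hγp, pot_add_right hp hγ hγp,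
    pot_add_right hp hγ hγp, pot_smul_left hp hγ hγp, pot_smul_left hp hγ hγp,
    pot_smul_right hp hγ hγp, pot_smul_right hp hγ hγp, Complex.conj_ofReal, smul_smul, sq,
    Complex.ofReal_mul, add_assoc, add_assoc, add_assoc]

/-- Only the concentrated self-interaction is of order β² with β = δ R^{(γ-b)/2}; the mixed terms
are of order β and the regular one of order 1. -/
theorem norm_pot_merge_sub_le (hC : IsPotBound d p γ C) (hC0 : 0 ≤ C) (hR : 0 < R) {δ M : ℝ}
    (hδ : 0 ≤ δ) {a b : Split d p R} (ha : ‖a‖ ≤ M) (hb : ‖b‖ ≤ M) :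
    ‖pot γ (merge hR δ a) (merge hR δ b) -
        ((δ ^ 2 : ℝ) : ℂ) • pot γ (inc hR a.2) (inc hR b.2)‖ ≤
      2 * C * (1 + 2 * (δ * growth d p γ R)) * M ^ 2 := by
  have hρ := growth_pos (d := d) (p := p) (γ := γ) hR
  have hM : 0 ≤ M := (norm_nonneg _).trans ha
  have a1 : ‖a.1‖ ≤ M := (norm_fst_le a).trans ha
  have a2 : ‖a.2‖ ≤ M := (norm_snd_le a).trans ha
  have b1 : ‖b.1‖ ≤ M := (norm_fst_le b).trans hb
  have b2 : ‖b.2‖ ≤ M := (norm_snd_le b).trans hb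
  rw [pot_merge hp hγ hγp, add_sub_cancel_right]
  refine norm_add₃_le.trans ?_
  rw [norm_smul, norm_smul, Complex.norm_of_nonneg hδ]
  have h1 := hC.norm_pot hC0 a.1 b.1
  have h2 := hC.norm_pot_inc_right hC0 hR a.1 b.2
  have h3 := hC.norm_pot_inc_left hC0 hR b.1 a.2
  have i1 : ‖a.1‖ * ‖b.1‖ ≤ M * M := by gcongr
  have i2 : ‖a.1‖ * ‖b.2‖ ≤ M * M := by gcongr
  have i3 : ‖a.2‖ * ‖b.1‖ ≤ M * M := by gcongr
  calc _ ≤ 2 * C * (M * M) + δ * (2 * C * growth d p γ R * (M * M)) +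
        δ * (2 * C * growth d p γ R * (M * M)) := by
        gcongr
        · exact h1.trans (by gcongr)
        · exact h2.trans (by gcongr)
        · exact h3.trans (by gcongr)
    _ = _ := by ring

theorem norm_pot_merge_le (hC : IsPotBound d p γ C) (hC0 : 0 ≤ C) (hR : 0 < R) {δ : ℝ}
    (hδ : 0 ≤ δ) (h1 : 1 ≤ δ * growth d p γ R) (a b : Split d p R) :
    ‖pot γ (merge hR δ a) (merge hR δ b)‖ ≤
      8 * C * (δ * growth d p γ R) ^ 2 * (‖a‖ * ‖b‖) := by
  have hρ := growth_pos (d := d) (p := p) (γ := γ) hR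
  rw [pot_merge hp hγ hγp]
  have i1 := hC.norm_pot hC0 a.1 b.1
  have i2 := hC.norm_pot_inc_right hC0 hR a.1 b.2
  have i3 := hC.norm_pot_inc_left hC0 hR b.1 a.2
  have i4 := hC.norm_pot_inc_inc hC0 hR a.2 b.2
  have a1 := norm_fst_le a
  have a2 := norm_snd_le a
  have b1 := norm_fst_le b
  have b2 := norm_snd_le b
  set β := δ * growth d p γ R with hβ
  have hβ2 : β ≤ β ^ 2 := by nlinarith
  have hβ1 : 1 ≤ β ^ 2 := h1.trans hβ2
  refine norm_add₄_le.trans ?_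
  rw [norm_smul, norm_smul, norm_smul, Complex.norm_of_nonneg hδ,
    Complex.norm_of_nonneg (by positivity)]
  calc _ ≤ 2 * C * (‖a‖ * ‖b‖) + δ * (2 * C * growth d p γ R * (‖a‖ * ‖b‖)) +
        δ * (2 * C * growth d p γ R * (‖a‖ * ‖b‖)) +
        δ ^ 2 * (2 * C * growth d p γ R ^ 2 * (‖a‖ * ‖b‖)) := by
        gcongr
        · exact i1.trans (by gcongr)
        · exact i2.trans (by gcongr)
        · exact i3.trans (by gcongr)
        · exact i4.trans (by gcongr)
    _ = 2 * C * (‖a‖ * ‖b‖) * (1 + 2 * β + β ^ 2) := by rw [hβ]; ring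
    _ ≤ 2 * C * (‖a‖ * ‖b‖) * (4 * β ^ 2) := by
        gcongr
        linarith
    _ = 8 * C * β ^ 2 * (‖a‖ * ‖b‖) := by ring

theorem isTrilinearBounded_splitTri (hC : IsPotBound d p γ C) (hC0 : 0 ≤ C) (hR : 0 < R) {δ : ℝ}
    (hδ : 0 ≤ δ) (h1 : 1 ≤ δ * growth d p γ R) :
    IsTrilinearBounded (splitTri (d := d) (p := p) γ hR δ)
      (8 * C * (δ * growth d p γ R) ^ 2) where
  sub_left a a' b c := by
    simp only [splitTri, map_sub, pot_sub_left hp hγ hγp, Y.conv_sub_left hp, Prod.mk_sub_mk]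
  sub_mid a b b' c := by
    simp only [splitTri, map_sub, pot_sub_right hp hγ hγp, Y.conv_sub_left hp, Prod.mk_sub_mk]
  sub_right a b c c' := by
    simp only [splitTri, Prod.fst_sub, Prod.snd_sub, Y.conv_sub_right hp, Prod.mk_sub_mk]
  norm_le a b c := by
    have h := norm_pot_merge_le hp hγ hγp hC hC0 hR hδ h1 a b
    rw [← mul_assoc]
    refine (max_le ((Y.norm_conv_le _ _).trans ?_) ((Y.norm_conv_le _ _).trans ?_))
    · exact mul_le_mul h (norm_fst_le c) (norm_nonneg _) (by positivity)
    · exact mul_le_mul h (norm_snd_le c) (norm_nonneg _) (by positivity)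

/-- To leading order, a concentrated part in the component `k₀` acts on the regular part of
another component by convolution with its own potential. -/
theorem norm_system_split_sub_le (hC : IsPotBound d p γ C) (hC0 : 0 ≤ C) (hR : 0 < R) {δ M : ℝ}
    (hδ : 0 ≤ δ) {N : ℕ} {m : Model} (κ : ℝ) {k₀ k₁ : Fin N} (hk : m = .hartreeFock → k₁ ≠ k₀)
    {z : Fin N → Split d p R} (hz : ‖z‖ ≤ M) (hz0 : ∀ k ≠ k₀, (z k).2 = 0) :
    ‖(system m κ (splitTri γ hR δ) z k₁).1 - ((κ * δ ^ 2 : ℝ) : ℂ) •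
        Y.conv (pot γ (inc hR (z k₀).2) (inc hR (z k₀).2)) (z k₁).1‖ ≤
      |κ| * (2 * N) * (2 * C * (1 + 2 * (δ * growth d p γ R)) * M ^ 3) := by
  have hρ := growth_pos (d := d) (p := p) (γ := γ) hR
  have hM : 0 ≤ M := (norm_nonneg _).trans hz
  have n1 : ∀ l, ‖z l‖ ≤ M := fun l => (norm_le_pi_norm z l).trans hz
  have n2 : ∀ l, ‖(z l).1‖ ≤ M := fun l => (norm_fst_le _).trans (n1 l)
  set E := 2 * C * (1 + 2 * (δ * growth d p γ R)) * M ^ 2 with hE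
  have hE0 : 0 ≤ E := by positivity
  set P := pot γ (inc hR (z k₀).2) (inc hR (z k₀).2) with hP
  set Q : Fin N → L1 d := fun l => pot γ (merge hR δ (z l)) (merge hR δ (z l)) with hQ
  -- Components other than k₀ have no concentrated part, so their leading term vanishes.
  have hQl : ∀ l, ‖Q l - if l = k₀ then ((δ ^ 2 : ℝ) : ℂ) • P else 0‖ ≤ E := fun l => by
    have h := norm_pot_merge_sub_le hp hγ hγp hC hC0 hR hδ (n1 l) (n1 l)
    split_ifs with hl
    · rwa [hl] at h ⊢
    · rw [hz0 l hl, map_zero] at h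
      have e : pot γ (0 : Y d p 1) 0 = 0 := by
        have := pot_sub_left hp hγ hγp 0 0 (0 : Y d p 1)
        rwa [sub_zero, sub_self] at this
      rwa [e, smul_zero] at h
  have s1 : ‖((κ : ℂ) • ∑ l, splitTri γ hR δ (z l) (z l) (z k₁)).1 - ((κ * δ ^ 2 : ℝ) : ℂ) •
      Y.conv P (z k₁).1‖ ≤ |κ| * (N * (E * M)) := by
    have e : ((κ : ℂ) • ∑ l, splitTri γ hR δ (z l) (z l) (z k₁)).1 - ((κ * δ ^ 2 : ℝ) : ℂ) •
        Y.conv P (z k₁).1 =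
        (κ : ℂ) • ∑ l, Y.conv (Q l - if l = k₀ then ((δ ^ 2 : ℝ) : ℂ) • P else 0) (z k₁).1 := by
      have e1 : ∀ l, Y.conv (Q l - if l = k₀ then ((δ ^ 2 : ℝ) : ℂ) • P else 0) (z k₁).1 =
          Y.conv (Q l) (z k₁).1 -
            if l = k₀ then ((δ ^ 2 : ℝ) : ℂ) • Y.conv P (z k₁).1 else 0 := fun l => by
        rw [Y.conv_sub_left hp]
        split_ifs
        · rw [Y.conv_smul_left]
        · have := Y.conv_smul_left (0 : ℂ) P (z k₁).1
          rw [zero_smul, zero_smul] at this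
          rw [this]
      simp only [e1, Finset.sum_sub_distrib, Finset.sum_ite_eq', Finset.mem_univ, if_true,
        smul_sub, smul_smul, Complex.ofReal_mul, Prod.smul_fst, Prod.fst_sum]
      rfl
    rw [e, norm_smul, Complex.norm_real, Real.norm_eq_abs]
    gcongr
    refine (norm_sum_le_of_le _ fun l _ => (Y.norm_conv_le _ _).trans
      (mul_le_mul (hQl l) (n2 k₁) (norm_nonneg _) hE0)).trans (le_of_eq ?_)
    simp
  have e : |κ| * (2 * N) * (2 * C * (1 + 2 * (δ * growth d p γ R)) * M ^ 3) =
      |κ| * (N * (E * M)) + |κ| * (N * (E * M)) := by rw [hE]; ring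
  rw [e]
  cases m with
  | reduced => exact s1.trans (le_add_of_nonneg_right (by positivity))
  | hartreeFock =>
    have hk' := hk rfl
    -- The potential in the exchange term has z k₁ as a factor, which is purely regular since k₁ ≠
    -- k₀; hence there is no term of order β².
    have s2 : ‖((κ : ℂ) • ∑ l, splitTri γ hR δ (z k₁) (z l) (z l)).1‖ ≤ |κ| * (N * (E * M)) := by
      rw [Prod.smul_fst, Prod.fst_sum, norm_smul, Complex.norm_real, Real.norm_eq_abs]
      gcongr
      refine (norm_sum_le_of_le _ fun l _ => (Y.norm_conv_le _ _).trans
        (mul_le_mul ?_ (n2 l) (norm_nonneg _) hE0)).trans (le_of_eq ?_)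
      · have h := norm_pot_merge_sub_le hp hγ hγp hC hC0 hR hδ (n1 k₁) (n1 l)
        have e : pot γ (0 : Y d p 1) (inc hR (z l).2) = 0 := by
          have := pot_sub_left hp hγ hγp 0 0 (inc hR (z l).2)
          rwa [sub_zero, sub_self] at this
        rwa [hz0 k₁ hk', map_zero, e, smul_zero, sub_zero] at h
      · simp
    simp only [system, Prod.fst_sub]
    rw [sub_right_comm]
    exact (norm_sub_le _ _).trans (add_le_add s1 s2)

end

end

/-! ### Norm inflation -/

section

variable {d : ℕ} {p : ℝ≥0∞} {γ C R : ℝ}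

/-- The regular data `g` together with a bump of radius `R` in the component `k₀`. -/
def splitData {N : ℕ} (g : Fin N → Y d p 1) (k₀ : Fin N) (R : ℝ) : Fin N → Split d p R :=
  fun k => (g k, if k = k₀ then bump d p R else 0)

theorem norm_splitData_le {N : ℕ} {g : Fin N → Y d p 1} {k₀ : Fin N} {R M W : ℝ}
    (hg : ‖g‖ ≤ M) (hW : ‖bump d p R‖ ≤ W) (hWM : W ≤ M) : ‖splitData g k₀ R‖ ≤ M := by
  have hM : 0 ≤ M := (norm_nonneg _).trans hg
  refine (pi_norm_le_iff_of_nonneg hM).2 fun k => max_le ((norm_le_pi_norm g k).trans hg) ?_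
  simp only [splitData]
  split_ifs
  · exact hW.trans hWM
  · simpa using hM

theorem norm_splitFlow_splitData_sub_le {N : ℕ} {g : Fin N → Y d p 1} {k₀ : Fin N}
    {α t ε W : ℝ} (hα : 0 < α) (hR : 0 < R) (hR1 : R ≤ 1) (hε : 0 ≤ ε)
    (hg : ∀ k, ‖Y.evol α t (g k) - g k‖ ≤ ε) (hW : ‖bump d p R‖ ≤ W)
    (ht : (2 * Real.pi) ^ α * |t| * W ≤ ε) :
    ‖splitFlow α t (splitData g k₀ R) - splitData g k₀ R‖ ≤ ε := by
  refine (pi_norm_le_iff_of_nonneg hε).2 fun k => max_le (hg k) ?_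
  change ‖Y.evol α t (if k = k₀ then bump d p R else 0) - (if k = k₀ then bump d p R else 0)‖ ≤ ε
  split_ifs
  · have h : ∀ᵐ ξ, R < ‖ξ‖ → (bump d p R).1.2 ξ = 0 := by
      filter_upwards [bump_snd_ae d p R] with ξ h1 h2
      rw [h1, indicator_of_notMem (by simpa using h2.le)]
    refine (Y.norm_evol_sub_le hα t hR.le h).trans (le_trans ?_ ht)
    have := Real.rpow_le_one hR.le hR1 hα.le
    calc (2 * Real.pi) ^ α * R ^ α * |t| * ‖bump d p R‖
        ≤ (2 * Real.pi) ^ α * 1 * |t| * W := by gcongr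
      _ = (2 * Real.pi) ^ α * |t| * W := by ring
  · rw [map_zero, sub_zero, norm_zero]
    exact hε

/-- The self-interaction of a bump. -/
def bumpPot (γ : ℝ) (p : ℝ≥0∞) (hR : 0 < R) : L1 d :=
  pot γ (inc hR (bump d p R)) (inc hR (bump d p R))

/-- The direction in which a bump drives the component `k₁`. -/
def drift {N : ℕ} (γ κ δ : ℝ) (hR : 0 < R) (g : Fin N → Y d p 1) (k₁ : Fin N) : Y d p 1 :=
  (Complex.I * ((κ * δ ^ 2 : ℝ) : ℂ) * ∫ ξ, bumpPot (d := d) γ p hR ξ) • g k₁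

variable (hp : 2 < p) (hγ : 0 < γ) (hγp : γ < critExp d p)

include hp hγ hγp

/-- The error is ε relative to the main size β². It collects the flow before and after the
nonlinearity, the mixed interactions, and the replacement of convolution by multiplication with the
integral. -/
theorem norm_interaction_sub_drift_le (hC : IsPotBound d p γ C) (hC0 : 0 ≤ C) (hR : 0 < R)
    (hR1 : R ≤ 1) {δ M W ε α t r : ℝ} (hδ : 0 ≤ δ) (h1 : 1 ≤ δ * growth d p γ R) (hα : 0 < α)
    {N : ℕ} {m : Model} (κ : ℝ) {k₀ k₁ : Fin N} (hk : m = .hartreeFock → k₁ ≠ k₀)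
    {g : Fin N → Y d p 1} (hgM : ‖g‖ ≤ M) (hW : ‖bump d p R‖ ≤ W) (hWM : W ≤ M) (hε : 0 ≤ ε)
    (hgt : ∀ k, ‖Y.evol α t (g k) - g k‖ ≤ ε) (hgt' : ∀ k, ‖Y.evol α (-t) (g k) - g k‖ ≤ ε)
    (htW : (2 * Real.pi) ^ α * |t| * W ≤ ε) (hRr : 2 * R ≤ r)
    (hgr : ∀ η : Rd d, ‖η‖ ≤ r → ‖Y.shift η (g k₁) - g k₁‖ ≤ ε)
    (hβ : 1 ≤ ε * (δ * growth d p γ R)) :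
    ‖(interaction (splitFlow α) (rhs m κ (splitTri γ hR δ)) t (splitData g k₀ R) k₁).1 -
        drift γ κ δ hR g k₁‖ ≤
      (|κ| * (2 * N) * (24 * C * M ^ 2) + |κ| * (2 * N) * (6 * C * M ^ 3) + 4 * |κ| * C * M ^ 2) *
        ε * (δ * growth d p γ R) ^ 2 := by
  set z := splitData g k₀ R with hz
  have hρ := growth_pos (d := d) (p := p) (γ := γ) hR
  have hM : 0 ≤ M := (norm_nonneg _).trans hgM
  have hzM : ‖z‖ ≤ M := norm_splitData_le hgM hW hWM
  set G := rhs (N := N) m κ (splitTri (d := d) (p := p) γ hR δ) with hG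
  set β := δ * growth d p γ R with hβdef
  have hU := isIsometricFlow_splitFlow (d := d) (R := R) hp α N
  have hT := isTrilinearBounded_splitTri hp hγ hγp hC hC0 hR hδ h1
  have hK : 0 ≤ 8 * C * β ^ 2 := by positivity
  have hL := lipschitzOnBalls_rhs (N := N) hT hK m κ
  have hzk : (z k₀).2 = bump d p R := by simp [hz, splitData]
  have hz0 : ∀ k ≠ k₀, (z k).2 = 0 := fun k hk => by simp [hz, splitData, hk]
  have hP : ‖bumpPot (d := d) γ p hR‖ ≤ 2 * C * growth d p γ R ^ 2 * M ^ 2 := by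
    refine (hC.norm_pot_inc_inc hC0 hR _ _).trans ?_
    have := hW.trans hWM
    rw [sq M]
    gcongr
  -- the flow acting on the data before the nonlinearity
  have e1 : ‖(splitFlow α (-t) (G (splitFlow α t z)) k₁).1 - (splitFlow α (-t) (G z) k₁).1‖ ≤
      |κ| * (2 * N) * (24 * C * M ^ 2) * ε * β ^ 2 := by
    have i1 : ‖splitFlow α t z - z‖ ≤ ε :=
      norm_splitFlow_splitData_sub_le hα hR hR1 hε hgt hW htW
    have i2 := (hL M).dist_le_mul (splitFlow α t z)
      (by rw [mem_closedBall_zero_iff, hU.norm_map]; exact hzM) z (by simpa using hzM)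
    rw [dist_eq_norm, dist_eq_norm, coe_lipConst hK] at i2
    have i3 : ‖splitFlow α (-t) (G (splitFlow α t z)) - splitFlow α (-t) (G z)‖ =
        ‖G (splitFlow α t z) - G z‖ := by
      rw [← dist_eq_norm, (hU.isometry _).dist_eq, dist_eq_norm]
    calc _ ≤ ‖splitFlow α (-t) (G (splitFlow α t z)) - splitFlow α (-t) (G z)‖ :=
          (norm_fst_le _).trans (norm_le_pi_norm
            (splitFlow α (-t) (G (splitFlow α t z)) - splitFlow α (-t) (G z)) k₁)
      _ ≤ |κ| * (2 * N) * (3 * (8 * C * β ^ 2) * M ^ 2) * ‖splitFlow α t z - z‖ := by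
          rw [i3]; exact i2
      _ ≤ |κ| * (2 * N) * (3 * (8 * C * β ^ 2) * M ^ 2) * ε := by gcongr
      _ = _ := by ring
  -- the leading part of the nonlinearity
  have e2 : ‖(G z k₁).1 - drift γ κ δ hR g k₁‖ ≤
      |κ| * (2 * N) * (6 * C * M ^ 3) * ε * β ^ 2 + 2 * |κ| * C * M ^ 2 * ε * β ^ 2 := by
    have i1 := norm_system_split_sub_le hp hγ hγp hC hC0 hR hδ κ hk hzM hz0
    rw [hzk] at i1
    have i2 : ‖Y.conv (bumpPot γ p hR) (g k₁) - (∫ ξ, bumpPot (d := d) γ p hR ξ) • g k₁‖ ≤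
        2 * C * growth d p γ R ^ 2 * M ^ 2 * ε := by
      refine (Y.norm_conv_sub_le hp (r := r) ?_ hgr).trans (mul_le_mul_of_nonneg_right hP hε)
      filter_upwards [pot_bump_eq_zero hp hγ hγp (Real.rpow_pos_of_pos hR _).ne'] with ξ h2 h3
      exact h2 (hRr.trans_lt h3)
    have e : (G z k₁).1 - drift γ κ δ hR g k₁ = Complex.I •
        (((system m κ (splitTri γ hR δ) z k₁).1 - ((κ * δ ^ 2 : ℝ) : ℂ) •
          Y.conv (bumpPot γ p hR) (g k₁)) + ((κ * δ ^ 2 : ℝ) : ℂ) •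
          (Y.conv (bumpPot γ p hR) (g k₁) - (∫ ξ, bumpPot (d := d) γ p hR ξ) • g k₁)) := by
      rw [smul_sub ((κ * δ ^ 2 : ℝ) : ℂ), sub_add_sub_cancel, smul_sub, drift, smul_smul, smul_smul]
      rfl
    rw [e, norm_smul, Complex.norm_I, one_mul]
    refine (norm_add_le _ _).trans (add_le_add (i1.trans ?_) ?_)
    -- The hypothesis εβ ≥ 1 makes everything of order β or 1 negligible against εβ².
    · have hb : 1 + 2 * β ≤ 3 * (ε * β ^ 2) := by
        have : β ≤ ε * β * β := le_mul_of_one_le_left (by positivity) hβ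
        nlinarith
      calc |κ| * (2 * N) * (2 * C * (1 + 2 * β) * M ^ 3)
          ≤ |κ| * (2 * N) * (2 * C * (3 * (ε * β ^ 2)) * M ^ 3) := by gcongr
        _ = _ := by ring
    · rw [norm_smul, Complex.norm_real, Real.norm_eq_abs, abs_mul, abs_of_nonneg (sq_nonneg δ)]
      calc |κ| * δ ^ 2 * ‖Y.conv (bumpPot γ p hR) (g k₁) -
            (∫ ξ, bumpPot (d := d) γ p hR ξ) • g k₁‖
          ≤ |κ| * δ ^ 2 * (2 * C * growth d p γ R ^ 2 * M ^ 2 * ε) := by gcongr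
        _ = _ := by rw [hβdef]; ring
  -- the flow acting on the drift
  have e3 : ‖Y.evol α (-t) (drift γ κ δ hR g k₁) - drift γ κ δ hR g k₁‖ ≤
      2 * |κ| * C * M ^ 2 * ε * β ^ 2 := by
    rw [drift, map_smul, ← smul_sub, norm_smul, norm_mul, norm_mul, Complex.norm_I, one_mul,
      Complex.norm_real, Real.norm_eq_abs, abs_mul, abs_of_nonneg (sq_nonneg δ)]
    have hint : ‖∫ ξ, bumpPot (d := d) γ p hR ξ‖ ≤ 2 * C * growth d p γ R ^ 2 * M ^ 2 := by
      refine (norm_integral_le_integral_norm _).trans ?_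
      rwa [← L1.norm_eq_integral_norm]
    calc _ ≤ |κ| * δ ^ 2 * (2 * C * growth d p γ R ^ 2 * M ^ 2) * ε := by
          gcongr
          exact hgt' k₁
      _ = _ := by rw [hβdef]; ring
  have e4 : ‖(splitFlow α (-t) (G z) k₁).1 - Y.evol α (-t) (drift γ κ δ hR g k₁)‖ =
      ‖(G z k₁).1 - drift γ κ δ hR g k₁‖ := by
    change ‖Y.evol α (-t) (G z k₁).1 - Y.evol α (-t) (drift γ κ δ hR g k₁)‖ = _
    rw [← map_sub, (Y.evol α (-t)).norm_map]
  calc _ = ‖((splitFlow α (-t) (G (splitFlow α t z)) k₁).1 - (splitFlow α (-t) (G z) k₁).1) +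
        ((splitFlow α (-t) (G z) k₁).1 - Y.evol α (-t) (drift γ κ δ hR g k₁)) +
        (Y.evol α (-t) (drift γ κ δ hR g k₁) - drift γ κ δ hR g k₁)‖ := by
        rw [sub_add_sub_cancel, sub_add_sub_cancel]; rfl
    _ ≤ _ := norm_add₃_le
    _ ≤ |κ| * (2 * N) * (24 * C * M ^ 2) * ε * β ^ 2 +
        (|κ| * (2 * N) * (6 * C * M ^ 3) * ε * β ^ 2 + 2 * |κ| * C * M ^ 2 * ε * β ^ 2) +
        2 * |κ| * C * M ^ 2 * ε * β ^ 2 := by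
        rw [e4]
        gcongr
    _ = _ := by ring

end

section

variable {d : ℕ} {p : ℝ≥0∞} {γ C R : ℝ}

/-- `merge` in each component. -/
def mergePi (N : ℕ) (hR : 0 < R) (δ : ℝ) : (Fin N → Split d p R) →L[ℝ] (Fin N → Y d p 1) :=
  (ContinuousLinearMap.pi fun k => (merge hR δ).comp
    (ContinuousLinearMap.proj (R := ℂ) (φ := fun _ : Fin N => Split d p R) k)).restrictScalars ℝ

theorem mergePi_apply {N : ℕ} (hR : 0 < R) (δ : ℝ) (z : Fin N → Split d p R) (k : Fin N) :
    mergePi N hR δ z k = merge hR δ (z k) := rfl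

/-- The `L^{p'}` part of the regular part of a component. -/
def regularPart {N : ℕ} (k : Fin N) : (Fin N → Split d p R) →L[ℝ] LpConj d p :=
  (((Y.sndL d p 1).comp (ContinuousLinearMap.fst ℂ _ _)).comp
    (ContinuousLinearMap.proj (R := ℂ) (φ := fun _ : Fin N => Split d p R) k)).restrictScalars ℝ

theorem regularPart_apply {N : ℕ} (k : Fin N) (z : Fin N → Split d p R) :
    regularPart k z = (z k).1.1.2 := rfl

theorem norm_regularPart_le {N : ℕ} (k : Fin N) (z : Fin N → Split d p R) :
    ‖regularPart k z‖ ≤ ‖z‖ :=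
  ((z k).1.norm_snd_le.trans (norm_fst_le _)).trans (norm_le_pi_norm z k)

theorem IsMildSol.mergePi (hp : 2 < p) (hR : 0 < R) {δ α κ τ : ℝ} {N : ℕ} {m : Model}
    {z : ℝ → Fin N → Split d p R}
    (h : IsMildSol (splitFlow α) (rhs m κ (splitTri γ hR δ)) τ z) :
    IsMildSol (flow α) (rhs m κ (tri γ)) τ fun t => HartreeFock.mergePi N hR δ (z t) := by
  refine h.map _ (fun t x => ?_) fun x => ?_
  · funext k
    exact merge_evol hR δ α t (x k)
  · funext k
    have h := system_map (T := splitTri γ hR δ) (T' := tri (d := d) (p := p) γ)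
      (merge (d := d) (p := p) hR δ).toLinearMap (merge_splitTri hp hR δ) m κ x k
    change merge hR δ (Complex.I • system m κ (splitTri γ hR δ) x k) =
      Complex.I • system m κ (tri γ) (fun l => merge hR δ (x l)) k
    rw [map_smul]
    exact congrArg _ h.symm

theorem Y.shift_zero (y : Y d p 1) : shift (0 : Rd d) y = y := by
  refine L2FL.ext_fst one_ne_zero (Lp.ext ((shift_ae 0 y.1.1).trans ?_))
  simp

theorem eventually_norm_sub_le {X E : Type*} [TopologicalSpace X] [NormedAddCommGroup E]
    {f : X → E} (hf : Continuous f) {x : X} {y : E} (h : f x = y) {ε : ℝ} (hε : 0 < ε) :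
    ∀ᶠ x' in nhds x, ‖f x' - y‖ ≤ ε :=
  ((hf.tendsto' x y h).eventually (Metric.closedBall_mem_nhds y hε)).mono fun _ h' =>
    mem_closedBall_iff_norm.1 h'

variable (hp : 2 < p) (hγ : 0 < γ) (hγp : γ < critExp d p)

include hp hγ hγp

/-- The equation for pairs is solved and the result merged. The three errors are the second order
term in τβ² = η, the deviation of the frozen field from the drift, and the concentrated part, still
of size at most 2M in its own norm and multiplied by δ. -/
theorem exists_isMildSol_near_drift (hC : IsPotBound d p γ C) (hC0 : 0 ≤ C) (hR : 0 < R)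
    (hR1 : R ≤ 1) {δ M W ε α r τ η l D : ℝ} (hδ : 0 ≤ δ) (h1 : 1 ≤ δ * growth d p γ R)
    (hα : 0 < α) {N : ℕ} {m : Model} (κ : ℝ) {k₀ k₁ : Fin N} (hk : m = .hartreeFock → k₁ ≠ k₀)
    {g : Fin N → Y d p 1} (hgM : ‖g‖ ≤ M) (hW : ‖bump d p R‖ ≤ W) (hWM : W ≤ M) (hε : 0 ≤ ε)
    (hgt : ∀ t, |t| ≤ τ → ∀ k, ‖Y.evol α t (g k) - g k‖ ≤ ε)
    (hτW : (2 * Real.pi) ^ α * τ * W ≤ ε) (hRr : 2 * R ≤ r)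
    (hgr : ∀ η : Rd d, ‖η‖ ≤ r → ‖Y.shift η (g k₁) - g k₁‖ ≤ ε)
    (hβ : 1 ≤ ε * (δ * growth d p γ R)) (hη : 0 ≤ η)
    (hτ : τ * (δ * growth d p γ R) ^ 2 = η) (hl : l = |κ| * (2 * N) * (24 * C * (2 * M) ^ 2))
    (hlη : 2 * l * η ≤ 1)
    (hD : D = |κ| * (2 * N) * (24 * C * M ^ 2) + |κ| * (2 * N) * (6 * C * M ^ 3) +
      4 * |κ| * C * M ^ 2) :
    ∃ φ : ℝ → Fin N → Y d p 1, IsMildSol (flow α) (rhs m κ (tri γ)) τ φ ∧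
      (φ 0 = fun k => g k + if k = k₀ then (δ : ℂ) • inc hR (bump d p R) else 0) ∧
      ‖(φ τ k₁).1.2 - (g k₁).1.2 - τ • (drift γ κ δ hR g k₁).1.2‖ ≤
        l ^ 2 * (2 * M) * η ^ 2 + D * ε * η + δ * (2 * M) := by
  set β := δ * growth d p γ R with hβdef
  have hβ0 : 0 < β := one_pos.trans_le h1
  have hτ0 : 0 ≤ τ := by
    by_contra h
    have : τ * β ^ 2 < 0 := mul_neg_of_neg_of_pos (not_le.1 h) (by positivity)
    linarith
  have hM : 0 ≤ M := (norm_nonneg _).trans hgM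
  have hU := isIsometricFlow_splitFlow (d := d) (R := R) hp α N
  have hT := isTrilinearBounded_splitTri hp hγ hγp hC hC0 hR hδ h1
  have hK : 0 ≤ 8 * C * β ^ 2 := by positivity
  have hL := lipschitzOnBalls_rhs (N := N) hT hK m κ
  -- The Lipschitz constant scales like β², so the Picard condition 2Lτ ≤ 1 becomes 2lη ≤ 1,
  -- independent of R and δ.
  have hLl : (lipConst N κ (8 * C * β ^ 2) (2 * M) : ℝ) = l * β ^ 2 := by
    rw [coe_lipConst hK, hl]; ring
  obtain ⟨z, hz0, hz, hzM⟩ := exists_isMildSol hU hL (rhs_zero hT m κ) hM hτ0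
    (by rw [hLl, show 2 * (l * β ^ 2) * τ = 2 * l * (τ * β ^ 2) by ring, hτ]; exact hlη)
    (norm_splitData_le (k₀ := k₀) hgM hW hWM)
  refine ⟨fun t => mergePi N hR δ (z t), hz.mergePi hp hR, ?_, ?_⟩
  · funext k
    simp only [hz0, mergePi_apply, merge_apply, splitData]
    split_ifs
    · rfl
    · rw [map_zero, smul_zero]
  · have hexp := hz.norm_sub_sub_le hU hL (rhs_zero hT m κ) hzM hτ0 (regularPart k₁)
      (norm_regularPart_le k₁) (drift γ κ δ hR g k₁).1.2 (θ := D * ε * β ^ 2) fun t ht => by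
        have ht' : |t| ≤ τ := by rw [abs_of_nonneg ht.1]; exact ht.2
        have h := norm_interaction_sub_drift_le hp hγ hγp hC hC0 hR hR1 hδ h1 hα κ hk hgM hW hWM
          hε (hgt t ht') (hgt (-t) (by rwa [abs_neg])) ((by
            have : 0 ≤ W := (norm_nonneg _).trans hW
            gcongr : (2 * Real.pi) ^ α * |t| * W ≤ (2 * Real.pi) ^ α * τ * W).trans hτW) hRr hgr hβ
        rw [← hD] at h
        rw [hz0]
        exact ((interaction (splitFlow α) (rhs m κ (splitTri γ hR δ)) t (splitData g k₀ R) k₁).1 -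
          drift γ κ δ hR g k₁).norm_snd_le.trans h
    rw [hz0, hLl, regularPart_apply, regularPart_apply] at hexp
    have hmerge : (mergePi N hR δ (z τ) k₁).1.2 =
        (z τ k₁).1.1.2 + (δ : ℂ) • (inc hR (z τ k₁).2).1.2 := rfl
    have hw : ‖(δ : ℂ) • (inc hR (z τ k₁).2).1.2‖ ≤ δ * (2 * M) := by
      rw [norm_smul, Complex.norm_of_nonneg hδ]
      have h2 := (norm_inc_snd_le hR (z τ k₁).2).trans ((norm_snd_le _).trans
        ((norm_le_pi_norm (z τ) k₁).trans (hzM τ ⟨hτ0, le_rfl⟩)))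
      gcongr
    have e : (mergePi N hR δ (z τ) k₁).1.2 - (g k₁).1.2 - τ • (drift γ κ δ hR g k₁).1.2 =
        ((z τ k₁).1.1.2 - (splitData g k₀ R k₁).1.1.2 - τ • (drift γ κ δ hR g k₁).1.2) +
          (δ : ℂ) • (inc hR (z τ k₁).2).1.2 := by
      rw [hmerge]
      simp only [splitData]
      abel
    rw [e]
    refine (norm_add_le _ _).trans (add_le_add (hexp.trans (le_of_eq ?_)) hw)
    rw [← hτ]
    ring

set_option maxHeartbeats 1000000 in
-- Order of choices: η depends on g only, which fixes the separation; then δ is made small, then the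
-- tolerance and the bound on the time, and finally R so small that β is large.
theorem exists_inflation {α κ T : ℝ} (hα : 0 < α) (hκ : κ ≠ 0) (hT : 0 < T) {N : ℕ} {m : Model}
    {k₀ k₁ : Fin N} (hk : m = .hartreeFock → k₁ ≠ k₀) {g : Fin N → Y d p 1}
    (hg : (g k₁).1.2 ≠ 0) :
    ∃ ε > 0, ∀ δ > 0, ∃ τ ∈ Ioc 0 T, ∃ w : Y d p 1, ‖w.1.2‖ ≤ δ ∧
      ∃ φ χ : ℝ → Fin N → Y d p 1, IsMildSol (flow α) (rhs m κ (tri γ)) τ φ ∧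
        IsMildSol (flow α) (rhs m κ (tri γ)) τ χ ∧
        (φ 0 = fun k => g k + if k = k₀ then w else 0) ∧ χ 0 = g ∧
        ε ≤ ‖(φ τ k₁).1.2 - (χ τ k₁).1.2‖ := by
  obtain ⟨C, hC0, hC⟩ := exists_norm_pot_le hp hγ hγp
  obtain ⟨c, hc, hcR⟩ := exists_le_norm_integral_pot_bump hp hγ hγp
  have hκ' : 0 < |κ| := abs_pos.2 hκ
  have hN : (0 : ℝ) < N := Nat.cast_pos.2 (Fin.pos k₁)
  have hg' : 0 < ‖(g k₁).1.2‖ := norm_pos_iff.2 hg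
  set W := ‖bump d p 1‖ with hW
  have hWR : ∀ R : ℝ, 0 < R → ‖bump d p R‖ = W := fun R hR => by
    rw [hW, norm_bump hp hR, norm_bump hp one_pos]
  set M := ‖g‖ + W + 1 with hM
  have hW0 : 0 ≤ W := norm_nonneg _
  have hM0 : 0 < M := by positivity
  have hgM : ‖g‖ ≤ M := by rw [hM]; linarith
  have hWM : W ≤ M := by rw [hM]; linarith [norm_nonneg g]
  set l := |κ| * (2 * N) * (24 * C * (2 * M) ^ 2) with hl
  set D := |κ| * (2 * N) * (24 * C * M ^ 2) + |κ| * (2 * N) * (6 * C * M ^ 3) +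
      4 * |κ| * C * M ^ 2 with hD
  set c₂ := |κ| * c * ‖(g k₁).1.2‖ with hc₂
  have hl0 : 0 < l := by positivity
  have hD0 : 0 < D := by positivity
  have hc₂0 : 0 < c₂ := by positivity
  -- The drift moves the component by at least c₂η. The first bound ensures existence up to τ; the
  -- second keeps the quadratic error below an eighth of c₂η.
  set η := min (1 / (2 * l)) (c₂ / (8 * (l ^ 2 * (2 * M)))) with hη
  have hη0 : 0 < η := by positivity
  have hlη : 2 * l * η ≤ 1 := by
    have h := min_le_left (1 / (2 * l)) (c₂ / (8 * (l ^ 2 * (2 * M))))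
    rw [← hη, le_div_iff₀ (by positivity)] at h
    linarith
  have hlη2 : l ^ 2 * (2 * M) * η ^ 2 ≤ c₂ * η / 8 := by
    have h := min_le_right (1 / (2 * l)) (c₂ / (8 * (l ^ 2 * (2 * M))))
    rw [← hη, le_div_iff₀ (by positivity)] at h
    calc l ^ 2 * (2 * M) * η ^ 2 = η * (8 * (l ^ 2 * (2 * M))) * η / 8 := by ring
      _ ≤ c₂ * η / 8 := by gcongr
  -- the solution with data `g`
  obtain ⟨K, hK, hTri⟩ := exists_isTrilinearBounded_tri (d := d) hp hγ hγp
  have hU := isIsometricFlow_flow (d := d) hp α N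
  have hL := lipschitzOnBalls_rhs (N := N) hTri hK m κ
  obtain ⟨L, hLdef⟩ : ∃ L : ℝ, L = lipConst N κ K (2 * M) := ⟨_, rfl⟩
  have hL0 : 0 ≤ L := hLdef ▸ NNReal.coe_nonneg _
  set T₁ := (2 * L + 1)⁻¹ with hT₁
  have hT₁0 : 0 < T₁ := by positivity
  obtain ⟨χ, hχ0, hχ, hχM⟩ := exists_isMildSol hU hL (rhs_zero hTri m κ) hM0.le hT₁0.le
    (by rw [← hLdef, hT₁, ← div_eq_mul_inv, div_le_one (by positivity)]; linarith) hgM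
  refine ⟨c₂ * η / 2, by positivity, fun δ₀ hδ₀ => ?_⟩
  set δ := min (δ₀ / (W + 1)) (c₂ * η / (8 * (2 * M))) with hδ
  have hδ0 : 0 < δ := by positivity
  have hδM : δ * (2 * M) ≤ c₂ * η / 8 := by
    have h := min_le_right (δ₀ / (W + 1)) (c₂ * η / (8 * (2 * M)))
    rw [← hδ, le_div_iff₀ (by positivity)] at h
    linarith
  have hδW : δ * W ≤ δ₀ := by
    have h := min_le_left (δ₀ / (W + 1)) (c₂ * η / (8 * (2 * M)))
    rw [← hδ, le_div_iff₀ (by positivity), mul_add, mul_one] at h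
    exact (le_add_of_nonneg_right hδ0.le).trans h
  set ε := c₂ / (8 * D) with hε
  have hε0 : 0 < ε := by positivity
  have hDε : D * ε * η = c₂ * η / 8 := by
    rw [hε]; field_simp
  -- smallness of times, translations and radii
  have ht : ∀ᶠ t in nhds (0 : ℝ), ∀ k, ‖Y.evol α t (g k) - g k‖ ≤ ε :=
    Filter.eventually_all.2 fun k =>
      eventually_norm_sub_le (Y.continuous_evol hp α (g k)) (Y.evol_zero α _) hε0
  obtain ⟨t₀, ht₀, ht⟩ := Metric.eventually_nhds_iff.1 ht
  have hr : ∀ᶠ ξ in nhds (0 : Rd d), ‖Y.shift ξ (g k₁) - g k₁‖ ≤ ε :=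
    eventually_norm_sub_le (Y.continuous_shift hp (g k₁)) (Y.shift_zero _) hε0
  obtain ⟨r₀, hr₀, hr⟩ := Metric.eventually_nhds_iff.1 hr
  -- The time must fit in [0, T] and in the lifespan of χ, keep the free evolution of g and of the
  -- bump within ε, and let χ move by at most an eighth of c₂η.
  set τ₀ := min (min T T₁) (min (t₀ / 2)
    (min (ε / ((2 * Real.pi) ^ α * (W + 1))) (c₂ * η / (8 * (L * (2 * M) + 1))))) with hτ₀
  have hτ₀0 : 0 < τ₀ := by positivity
  have hneg : (γ - critExp d p) / 2 < 0 := by linarith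
  have hlim : Filter.Tendsto (fun R : ℝ => δ * growth d p γ R) (nhdsWithin 0 (Ioi 0))
      Filter.atTop := (tendsto_rpow_neg_nhdsGT_zero hneg).const_mul_atTop hδ0
  -- This is where γ < b enters: β tends to infinity as R → 0 with δ fixed.
  obtain ⟨R, ⟨hβ, hR0⟩, hR⟩ := ((hlim.eventually_ge_atTop (max 1 (max (1 / ε) (η / τ₀)))).and
    self_mem_nhdsWithin).and (nhdsWithin_le_nhds (Iio_mem_nhds
      (by positivity : (0 : ℝ) < min 1 (r₀ / 4)))) |>.exists
  have hR0 : 0 < R := hR0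
  have hR1 : R ≤ 1 := (le_of_lt hR).trans (min_le_left _ _)
  have hRr : 2 * R ≤ r₀ / 2 := by
    have := (le_of_lt hR).trans (min_le_right _ _)
    linarith
  set β := δ * growth d p γ R with hβdef
  have hβ1 : 1 ≤ β := (le_max_left _ _).trans hβ
  have hβε : 1 ≤ ε * β := by
    have h := ((le_max_left _ _).trans (le_max_right _ _)).trans hβ
    rw [div_le_iff₀ hε0] at h
    linarith
  have hβτ : η / β ^ 2 ≤ τ₀ := by
    have h := ((le_max_right _ _).trans (le_max_right _ _)).trans hβ
    rw [div_le_iff₀ hτ₀0] at h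
    rw [div_le_iff₀ (by positivity)]
    calc η ≤ β * τ₀ := h
      _ ≤ β * τ₀ * β := le_mul_of_one_le_right (by positivity) hβ1
      _ = τ₀ * β ^ 2 := by ring
  set τ := η / β ^ 2 with hτ
  have hβ0 : 0 < β := one_pos.trans_le hβ1
  have hτ0 : 0 < τ := by positivity
  have hτT : τ ≤ T := hβτ.trans ((min_le_left _ _).trans (min_le_left _ _))
  have hτT₁ : τ ≤ T₁ := hβτ.trans ((min_le_left _ _).trans (min_le_right _ _))
  have hτ' := hβτ.trans (min_le_right _ _)
  have hτt : τ ≤ t₀ / 2 := hτ'.trans (min_le_left _ _)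
  have hτ'' := hτ'.trans (min_le_right _ _)
  have hτW : (2 * Real.pi) ^ α * τ * W ≤ ε := by
    have h := hτ''.trans (min_le_left _ _)
    rw [le_div_iff₀ (by positivity)] at h
    calc (2 * Real.pi) ^ α * τ * W ≤ (2 * Real.pi) ^ α * τ * (W + 1) := by
          gcongr
          exact le_add_of_nonneg_right zero_le_one
      _ = τ * ((2 * Real.pi) ^ α * (W + 1)) := by ring
      _ ≤ ε := h
  have hτL : L * (2 * M) * τ ≤ c₂ * η / 8 := by
    have h := hτ''.trans (min_le_right _ _)
    rw [le_div_iff₀ (by positivity)] at h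
    have e : τ * (8 * (L * (2 * M) + 1)) = 8 * (L * (2 * M) * τ) + 8 * τ := by ring
    rw [e] at h
    linarith only [h, hτ0]
  obtain ⟨φ, hφ, hφ0, hφτ⟩ := exists_isMildSol_near_drift hp hγ hγp hC hC0.le hR0 hR1 hδ0.le hβ1 hα
    κ hk hgM (hWR R hR0).le hWM hε0.le
    (fun t h => ht (by rw [Real.dist_eq, sub_zero]; linarith)) hτW hRr
    (fun ξ h => hr (by rw [dist_zero_right]; linarith)) hβε hη0.le
    (div_mul_cancel₀ η (by positivity)) hl hlη hD
  refine ⟨τ, ⟨hτ0, hτT⟩, (δ : ℂ) • inc hR0 (bump d p R), ?_, φ, χ, hφ, hχ.mono hτT₁, hφ0, hχ0, ?_⟩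
  · refine le_trans ?_ hδW
    change ‖(δ : ℂ) • (inc hR0 (bump d p R)).1.2‖ ≤ _
    rw [norm_smul, Complex.norm_of_nonneg hδ0.le]
    have := (norm_inc_snd_le hR0 (bump d p R)).trans (hWR R hR0).le
    gcongr
  · have hχτ : ‖(χ τ k₁).1.2 - (g k₁).1.2‖ ≤ c₂ * η / 8 := by
      have h := hχ.norm_sub_le hU hL (rhs_zero hTri m κ) hχM ⟨hτ0.le, hτT₁⟩
      rw [hχ0, ← hLdef] at h
      exact (((χ τ k₁ - g k₁).norm_snd_le.trans (norm_le_pi_norm (χ τ - g) k₁)).trans h).trans hτL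
    have hdrift : c₂ * η ≤ ‖τ • (drift γ κ δ hR0 g k₁).1.2‖ := by
      have e : (drift γ κ δ hR0 g k₁).1.2 = (Complex.I * ((κ * δ ^ 2 : ℝ) : ℂ) *
        ∫ ξ, bumpPot (d := d) γ p hR0 ξ) • (g k₁).1.2 := rfl
      rw [e, norm_smul, norm_smul, norm_mul, norm_mul, Complex.norm_I, one_mul, Complex.norm_real,
        Real.norm_of_nonneg hτ0.le, Real.norm_eq_abs, abs_mul, abs_of_nonneg (sq_nonneg δ)]
      have h := hcR R hR0 (Real.rpow_pos_of_pos hR0 _).ne'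
      rw [← growth_sq hR0] at h
      calc c₂ * η = c₂ * (τ * β ^ 2) := by rw [hτ, div_mul_cancel₀ η (by positivity)]
        _ = τ * (|κ| * δ ^ 2 * (c * growth d p γ R ^ 2) * ‖(g k₁).1.2‖) := by
            rw [hc₂, hβdef]; ring
        _ ≤ _ := by
            gcongr
            exact h
    -- Four errors of an eighth of c₂η each, three from φ and one from χ, leave half of the drift as
    -- separation.
    have hfin : τ • (drift γ κ δ hR0 g k₁).1.2 = ((φ τ k₁).1.2 - (χ τ k₁).1.2) -
        ((φ τ k₁).1.2 - (g k₁).1.2 - τ • (drift γ κ δ hR0 g k₁).1.2) +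
        ((χ τ k₁).1.2 - (g k₁).1.2) := by abel
    have h1 := norm_add_le (((φ τ k₁).1.2 - (χ τ k₁).1.2) -
        ((φ τ k₁).1.2 - (g k₁).1.2 - τ • (drift γ κ δ hR0 g k₁).1.2)) ((χ τ k₁).1.2 - (g k₁).1.2)
    have h2 := norm_sub_le ((φ τ k₁).1.2 - (χ τ k₁).1.2)
      ((φ τ k₁).1.2 - (g k₁).1.2 - τ • (drift γ κ δ hR0 g k₁).1.2)
    rw [← hfin] at h1
    linarith

end

/-! ### Ill-posedness in the Fourier-Lebesgue space -/

/-- The restriction of a trajectory to a shorter interval. -/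
def restrictTime {X : Type*} [TopologicalSpace X] {τ T : ℝ} (h : τ ≤ T) (ψ : C(Icc (0 : ℝ) T, X)) :
    C(Icc (0 : ℝ) τ, X) :=
  ψ.comp ⟨inclusion (Icc_subset_Icc_right h), continuous_inclusion _⟩

theorem IsSolution.restrictTime {d N : ℕ} {p : ℝ≥0∞} {m : Model} {κ γ α τ T : ℝ}
    {ψ₀ : Fin N → L2FL d p} {ψ : C(Icc (0 : ℝ) T, Fin N → L2FL d p)}
    (h : IsSolution m κ γ α ψ₀ ψ) (hτ : τ ≤ T) :
    IsSolution m κ γ α ψ₀ (HartreeFock.restrictTime hτ ψ) := by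
  obtain ⟨F, hF, hψ⟩ := h
  exact ⟨F, fun k s => hF k (inclusion (Icc_subset_Icc_right hτ) s),
    fun k t => hψ k (inclusion (Icc_subset_Icc_right hτ) t)⟩

section

variable {d : ℕ} {p : ℝ≥0∞}

theorem FL.dist_def (f g : FL d p) : dist f g = dist f.hat g.hat := by
  rw [dist_eq_norm, dist_eq_norm, FL.norm_def]
  exact congrArg norm ((FL.hatₗ d p).map_sub f g)

theorem L2FL.hat_toFL_ofFt (y : Y d p 1) : (ofFt y).toFL.hat = y.1.2 := by
  rw [← ft_snd, ft_ofFt]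

theorem dist_toFLN_ofFt_le {N : ℕ} {y z : Fin N → Y d p 1} {r : ℝ} (hr : 0 ≤ r)
    (h : ∀ k, dist (y k).1.2 (z k).1.2 ≤ r) :
    dist (toFLN fun k => L2FL.ofFt (y k)) (toFLN fun k => L2FL.ofFt (z k)) ≤ r := by
  refine (dist_pi_le_iff hr).2 fun k => ?_
  rw [FL.dist_def]
  simp only [toFLN, L2FL.hat_toFL_ofFt]
  exact h k

/-- The free evolution is isometric on L^{p'}, so distances in L̂^p can be read off in the
interaction picture. -/
theorem le_dist_toFLN_trajectory (hp : 2 < p) {N : ℕ} {τ α : ℝ} (hτ : 0 ≤ τ)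
    {φ χ : ℝ → Fin N → Y d p 1} (hφ : ContinuousOn φ (Icc 0 τ)) (hχ : ContinuousOn χ (Icc 0 τ))
    (k : Fin N) :
    ‖(φ τ k).1.2 - (χ τ k).1.2‖ ≤ dist (toFLN (trajectory hp α hφ ⟨τ, hτ, le_rfl⟩))
      (toFLN (trajectory hp α hχ ⟨τ, hτ, le_rfl⟩)) := by
  refine le_trans (le_of_eq ?_) (dist_le_pi_dist _ _ k)
  rw [FL.dist_def]
  simp only [toFLN, trajectory_apply, L2FL.hat_toFL_ofFt]
  change _ = dist (symbolMul α τ p.conjExponent (φ τ k).1.2)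
    (symbolMul α τ p.conjExponent (χ τ k).1.2)
  rw [(symbolMul α τ p.conjExponent).dist_map, dist_eq_norm]

theorem exists_separating_solutions {γ α κ : ℝ} (hp : 2 < p) (hγ : 0 < γ) (hγp : γ < critExp d p)
    (hα : 0 < α) (hκ : κ ≠ 0) {N : ℕ} {m : Model} (hN : m.minParticles ≤ N) (c : Fin N → FL d p)
    {r T : ℝ} (hr : 0 < r) (hT : 0 < T) :
    ∃ ε > 0, ∀ δ > 0, ∃ τ ∈ Ioc 0 T, ∃ (ψ₀ φ₀ : Fin N → L2FL d p)
        (ψ φ : C(Icc (0 : ℝ) τ, Fin N → L2FL d p)),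
        toFLN ψ₀ ∈ Metric.ball c r ∧ toFLN φ₀ ∈ Metric.ball c r ∧
        IsSolution m κ γ α ψ₀ ψ ∧ IsSolution m κ γ α φ₀ φ ∧
        dist (toFLN ψ₀) (toFLN φ₀) < δ ∧ ∃ t, ε ≤ dist (toFLN (ψ t)) (toFLN (φ t)) := by
  -- For the reduced system a single component may drive itself, as no exchange term cancels its
  -- self-interaction.
  obtain ⟨k₀, k₁, hk⟩ : ∃ k₀ k₁ : Fin N, m = .hartreeFock → k₁ ≠ k₀ := by
    cases m with
    | hartreeFock =>
      refine ⟨⟨0, lt_of_lt_of_le (by decide) hN⟩, ⟨1, lt_of_lt_of_le (by decide) hN⟩, fun _ h => ?_⟩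
      simp at h
    | reduced =>
      exact ⟨⟨0, lt_of_lt_of_le (by decide) hN⟩, ⟨0, lt_of_lt_of_le (by decide) hN⟩,
        fun h => by cases h⟩
  -- Data within r/4 of the centre and a perturbation of at most r/2 stay inside the open ball.
  obtain ⟨g, hg⟩ := exists_snd_near hp (fun k => (c k).hat) (half_pos (half_pos hr))
  obtain ⟨ε, hε, h⟩ := exists_inflation hp hγ hγp hα hκ hT hk (hg k₁).2
  refine ⟨ε, hε, fun δ hδ => ?_⟩
  obtain ⟨τ, hτ, w, hw, φ, χ, hφ, hχ, hφ0, hχ0, hsep⟩ := h (min (δ / 2) (r / 2)) (by positivity)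
  have hball : dist (toFLN fun k => L2FL.ofFt (χ 0 k)) c ≤ r / 2 / 2 := by
    refine (dist_pi_le_iff (by positivity)).2 fun k => ?_
    rw [FL.dist_def]
    simp only [toFLN, L2FL.hat_toFL_ofFt, hχ0]
    exact (hg k).1.le
  have hclose : dist (toFLN fun k => L2FL.ofFt (φ 0 k)) (toFLN fun k => L2FL.ofFt (χ 0 k)) ≤
      min (δ / 2) (r / 2) := by
    refine dist_toFLN_ofFt_le (by positivity) fun k => ?_
    rw [hφ0, hχ0, dist_eq_norm]
    change ‖(g k + if k = k₀ then w else 0).1.2 - (g k).1.2‖ ≤ _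
    split_ifs
    · change ‖(g k).1.2 + w.1.2 - (g k).1.2‖ ≤ _
      rwa [add_sub_cancel_left]
    · rw [add_zero, sub_self, norm_zero]
      positivity
  refine ⟨τ, hτ, _, _, _, _, ?_, ?_, hφ.isSolution hp hγ hγp, hχ.isSolution hp hγ hγp, ?_,
    ⟨τ, hτ.1.le, le_rfl⟩, hsep.trans (le_dist_toFLN_trajectory hp hτ.1.le _ _ k₁)⟩
  · rw [Metric.mem_ball]
    have := dist_triangle (toFLN fun k => L2FL.ofFt (φ 0 k)) (toFLN fun k => L2FL.ofFt (χ 0 k)) c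
    have := hclose.trans (min_le_right _ _)
    linarith
  · rw [Metric.mem_ball]
    linarith
  · have := hclose.trans (min_le_left _ _)
    linarith

/-- By uniqueness the separating solutions on [0, τ] are restrictions of the values of the solution
map, so nearby data would have images at distance at least ε in the supremum norm. -/
theorem not_exists_uniformContinuous_solution_map {γ α κ : ℝ} (hp : 2 < p) (hγ : 0 < γ)
    (hγp : γ < critExp d p) (hα : 0 < α) (hκ : κ ≠ 0) {N : ℕ} {m : Model}
    (hN : m.minParticles ≤ N) (c : Fin N → FL d p) {r T : ℝ} (hr : 0 < r) (hT : 0 < T) :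
    ¬ ∃ S : Metric.ball c r → C(Icc (0 : ℝ) T, Fin N → FL d p),
        (∀ (ψ₀ : Fin N → L2FL d p) (h : toFLN ψ₀ ∈ Metric.ball c r),
          ∃ ψ : C(Icc (0 : ℝ) T, Fin N → L2FL d p),
            IsSolution m κ γ α ψ₀ ψ ∧ ∀ t, S ⟨toFLN ψ₀, h⟩ t = toFLN (ψ t)) ∧
        UniformContinuous S := by
  rintro ⟨S, hS, hSc⟩
  obtain ⟨ε, hε, h⟩ := exists_separating_solutions hp hγ hγp hα hκ hN c hr hT
  obtain ⟨δ, hδ, hSδ⟩ := Metric.uniformContinuous_iff.1 hSc ε hε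
  obtain ⟨τ, hτ, ψ₀, φ₀, ψ, φ, hψB, hφB, hψ, hφ, hdist, t, ht⟩ := h δ hδ
  obtain ⟨ψ', hψ', hSψ⟩ := hS ψ₀ hψB
  obtain ⟨φ', hφ', hSφ⟩ := hS φ₀ hφB
  have e1 := hψ.unique hp hγ hγp (hψ'.restrictTime hτ.2)
  have e2 := hφ.unique hp hγ hγp (hφ'.restrictTime hτ.2)
  have h1 := (ContinuousMap.dist_apply_le_dist (inclusion (Icc_subset_Icc_right hτ.2) t)).trans_lt
    (hSδ (a := ⟨toFLN ψ₀, hψB⟩) (b := ⟨toFLN φ₀, hφB⟩) hdist)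
  rw [hSψ, hSφ] at h1
  rw [e1, e2] at ht
  exact (ht.trans_lt h1).false

end

end

end HartreeFock

theorem theorem1p6 (d N : ℕ) (m : Model) (hN : m.minParticles ≤ N) (p : ℝ≥0∞) (hp : 2 < p)
    (α γ κ : ℝ) (hα : 0 < α) (hκ : κ ≠ 0) (hγ : 0 < γ)
    (hγp : γ < 2 * d * (1 / 2 - (p⁻¹).toReal)) :
    -- Local well-posedness in `(L² ∩ L̂^p)^N`: uniqueness on every interval `[0, T]` ...
    (∀ (T : ℝ) (ψ₀ : Fin N → L2FL d p) (ψ φ : C(Icc (0 : ℝ) T, Fin N → L2FL d p)),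
      IsSolution m κ γ α ψ₀ ψ → IsSolution m κ γ α ψ₀ φ → ψ = φ) ∧
    -- ... existence, and uniformly continuous dependence, on bounded sets of initial data.
    (∀ B : Set (Fin N → L2FL d p), Bornology.IsBounded B →
      ∃ T > 0, ∃ S : B → C(Icc (0 : ℝ) T, Fin N → L2FL d p),
        (∀ ψ₀ : B, IsSolution m κ γ α ψ₀.1 (S ψ₀)) ∧ UniformContinuous S) ∧
    -- Ill-posedness in `(L̂^p)^N`: no ball and no `T > 0` admit a uniformly continuous solution map
    -- into `C([0, T], (L̂^p)^N)` ...
    (∀ (c : Fin N → FL d p) (r T : ℝ), 0 < r → 0 < T →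
      ¬ ∃ S : Metric.ball c r → C(Icc (0 : ℝ) T, Fin N → FL d p),
        (∀ (ψ₀ : Fin N → L2FL d p) (h : toFLN ψ₀ ∈ Metric.ball c r),
          ∃ ψ : C(Icc (0 : ℝ) T, Fin N → L2FL d p),
            IsSolution m κ γ α ψ₀ ψ ∧ ∀ t, S ⟨toFLN ψ₀, h⟩ t = toFLN (ψ t)) ∧
        UniformContinuous S) ∧
    -- ... and this is not due to a lack of solutions: solutions up to some time in `(0, T]`, whose
    -- initial data lie in the ball and are arbitrarily close, separate by a fixed amount.
    (∀ (c : Fin N → FL d p) (r T : ℝ), 0 < r → 0 < T →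
      ∃ ε > 0, ∀ δ > 0, ∃ τ ∈ Ioc 0 T, ∃ (ψ₀ φ₀ : Fin N → L2FL d p)
        (ψ φ : C(Icc (0 : ℝ) τ, Fin N → L2FL d p)),
        toFLN ψ₀ ∈ Metric.ball c r ∧ toFLN φ₀ ∈ Metric.ball c r ∧
        IsSolution m κ γ α ψ₀ ψ ∧ IsSolution m κ γ α φ₀ φ ∧
        dist (toFLN ψ₀) (toFLN φ₀) < δ ∧ ∃ t, ε ≤ dist (toFLN (ψ t)) (toFLN (φ t))) := by
  have hγp' : γ < critExp d p := hγp.trans_eq (by rw [critExp]; ring)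
  exact ⟨fun _ _ _ _ hψ hφ => hψ.unique hp hγ hγp' hφ,
    fun _ hB => exists_isSolution hp hγ hγp' m κ α hB,
    fun c _ _ hr hT => not_exists_uniformContinuous_solution_map hp hγ hγp' hα hκ hN c hr hT,
    fun c _ _ hr hT => exists_separating_solutions hp hγ hγp' hα hκ hN c hr hT⟩
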